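/- **Setting.** Let $\langle x\rangle=(1+|x|^2)^{1/2}$, $\hat f(\xi)=\int_{\mathbb R^3}e^{-ix\cdot\xi}f(x)\,dx$ (extended to tempered distributions), $f^X(x)=f(x-X)$, $\hat\xi=\xi/|\xi|$. For a real-valued $W$ on $\mathbb{R}^3$ consider the system $$\dot X_t=P_t,\qquad \dot P_t=\int_{\mathbb R^3}\nabla W^{X_t}\,\mathrm{Re}\,\beta_t\,dx,\qquad i\dot\beta_t=-\Delta\beta_t+\mathrm{Re}\,\beta_t+W^{X_t}, \qquad (1)$$ for $X_t,P_t\in\mathbb R^3$ and complex-valued fields $\beta_t$ on $\mathbb R^3$. The field equation is understood in the sense of tempered distributions, and the force integral as the $L^2$ duality pairing, i.e. as the absolutely convergent integral $(2\pi)^{-3}\int \widehat{\nabla W^{X_t}}\;\overline{\widehat{\mathrm{Re}\,\beta_t}}\,d\xi$. A traveling wave solution with velocity $v\in\mathbb R^3$ and profile $\gamma_v$ is a solution of (1) of the form $$X_t=vt,\qquad P_t\equiv v,\qquad \beta_t(x)=\gamma_v(x-vt). \qquad (2)$$ For $a,s\in\mathbb R$ let $H_a^s(\mathbb R^3)$ be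 the space of tempered distributions $f$ whose Fourier transform is a function with $$\int_{|\xi|\le1}|\xi|^{2a}|\hat f(\xi)|^2d\xi+\int_{|\xi|\ge1}|\xi|^{2s}|\hat f(\xi)|^2d\xi<\infty .$$ Call $W$ *fast decaying* if $\langle x\rangle^6W\in L^2(\mathbb R^3)$. Call $\beta$ of *finite energy* if $\nabla\beta\in L^2(\mathbb R^3)$ and $\mathrm{Re}\,\beta\in L^2(\mathbb R^3)$. **Theorem.** Let $v\in\mathbb R^3$ and $b\in[-1/2,\infty)$. 1. If $|v|<1$, then for every real-valued $W\in L^1(\mathbb R^3)\cap H^b(\mathbb R^3)$ there exists a unique traveling wave solution (2) of (1) with $$\mathrm{Re}\,\gamma_v\in\bigcap_{a>-3/2}H_a^{b+2}(\mathbb R^3),\qquad \mathrm{Im}\,\gamma_v\in\bigcap_{a>-1/2}H_a^{b+2}(\mathbb R^3).$$ Moreover, if $W$ is fast decaying, then $\gamma_v$ is (represented by) a continuous function, and for every $\epsilon>0$ there is a constant $C$ such that for all $x$ $$|\mathrm{Re}\,\gamma_v(x)|\le C\langle x\rangle^{-3+\epsilon},\qquad|\mathrm{Im}\,\gamma_v(x)|\le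 C\langle x\rangle^{-2+\epsilon}.$$ 2. If $|v|=1$, then for every real-valued $W\in L^1(\mathbb R^3)\cap H^b(\mathbb R^3)$ there exists a unique traveling wave solution (2) of (1) with $$\mathrm{Re}\,\gamma_v\in\bigcap_{a>-1/2}H_a^{b+2}(\mathbb R^3),\qquad \mathrm{Im}\,\gamma_v\in\bigcap_{a>1/2}H_a^{b+2}(\mathbb R^3).$$ Moreover, if $W$ is fast decaying, then $\gamma_v$ is (represented by) a continuous function, and for every $\epsilon>0$ there is a constant $C$ such that for all $x$ $$|\mathrm{Re}\,\gamma_v(x)|\le C\langle x\rangle^{-1+\epsilon},\qquad|\mathrm{Im}\,\gamma_v(x)|\le C\langle x\rangle^{-2/3+\epsilon}.$$ 3. If $|v|>1$, then for every real-valued Schwartz function $W$ whose Fourier transform $\hat W$ does not vanish identically on the set $$\{\xi\in\mathbb R^3\setminus\{0\}\;:\;1+|\xi|^2-(v\cdot\hat\xi)^2=0\},$$ there is no traveling wave solution (2) of (1) whose profile $\gamma_v$ has finite energy. -/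

import Mathlib

open MeasureTheory SchwartzMap FourierTransform LineDeriv Laplacian

noncomputable section

namespace InertialWave

/-- Three-dimensional Euclidean space. -/
abbrev E3 : Type := EuclideanSpace ℝ (Fin 3)

/-- The Japanese bracket `⟨x⟩ = (1 + |x|²)^(1/2)`. -/
def jb (x : E3) : ℝ := Real.sqrt (1 + ‖x‖ ^ 2)

/-! ### Operations on tempered distributions -/

/-- Translation `φ ↦ φ(· + X)` of test functions. -/
def shiftTest (X : E3) : 𝓢(E3, ℂ) →L[ℂ] 𝓢(E3, ℂ) :=
  SchwartzMap.compCLMOfAntilipschitz (K := 1) ℂ (g := fun x : E3 => x + X)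
    (by fun_prop) (fun x y => by simp)

/-- The translate `u^X = u(· - X)` of a tempered distribution. -/
def translate (X : E3) (u : 𝓢'(E3, ℂ)) : 𝓢'(E3, ℂ) :=
  PointwiseConvergenceCLM.precomp ℂ (shiftTest X) u

theorem translate_apply (X : E3) (u : 𝓢'(E3, ℂ)) (φ : 𝓢(E3, ℂ)) :
    translate X u φ = u (shiftTest X φ) := rfl

/-- Pointwise complex conjugation of test functions. -/
def conjTest : 𝓢(E3, ℂ) →L[ℝ] 𝓢(E3, ℂ) :=
  SchwartzMap.postcompCLM (𝕜 := ℝ) (Complex.conjCLE : ℂ →L[ℝ] ℂ)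

theorem conjTest_apply (φ : 𝓢(E3, ℂ)) (x : E3) :
    conjTest φ x = (starRingEnd ℂ) (φ x) := rfl

/-- The complex conjugate of a tempered distribution, `ū(φ) = conj (u (conj φ))`. -/
def conjDist (u : 𝓢'(E3, ℂ)) : 𝓢'(E3, ℂ) :=
  ContinuousLinearMap.toPointwiseConvergenceCLM _ _ _ _
    { toFun := fun φ => (starRingEnd ℂ) (u (conjTest φ))
      map_add' := fun φ ψ => by simp
      map_smul' := fun c φ => by
        have h : conjTest (c • φ) = (starRingEnd ℂ) c • conjTest φ := by
          ext x; simp [conjTest_apply]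
        simp [h]
      cont := Complex.continuous_conj.comp (u.continuous.comp conjTest.continuous) }

theorem conjDist_apply (u : 𝓢'(E3, ℂ)) (φ : 𝓢(E3, ℂ)) :
    conjDist u φ = (starRingEnd ℂ) (u (conjTest φ)) := rfl

/-- The real part of a tempered distribution. -/
def reDist (u : 𝓢'(E3, ℂ)) : 𝓢'(E3, ℂ) := (1 / 2 : ℂ) • (u + conjDist u)

/-- The imaginary part of a tempered distribution, so that `u = reDist u + i imDist u`. -/
def imDist (u : 𝓢'(E3, ℂ)) : 𝓢'(E3, ℂ) := (1 / (2 * Complex.I) : ℂ) • (u - conjDist u)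

/-- The tempered distribution `φ ↦ ∫ f φ` of a real-valued integrable function `f`. -/
def ofIntegrable (f : E3 → ℝ) (hf : Integrable f) : 𝓢'(E3, ℂ) :=
  Lp.toTemperedDistribution (hf.ofReal (𝕜 := ℂ)).toL1

/-- The tempered distribution `u` is given by integration against the function `f`. -/
def Represents (f : E3 → ℂ) (u : 𝓢'(E3, ℂ)) : Prop :=
  ∀ φ : 𝓢(E3, ℂ), Integrable (fun x => φ x * f x) ∧ u φ = ∫ x, φ x * f x

/-! ### Fourier transforms and function spaces

Mathlib's transform has the kernel `exp (-2πi⟨x, ξ⟩)`, so its frequency variable `ξ` corresponds to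
the angular frequency `2πξ`, i.e. `û(2πξ) = 𝓕 u (ξ)` when `û` has the kernel `exp (-i⟨x, ξ⟩)`. -/

/-- The Fourier transform with kernel `exp (-i⟨x, ξ⟩)` of an integrable function. -/
def angularFourier (f : E3 → ℝ) (ξ : E3) : ℂ :=
  ∫ x, Complex.exp (-(Complex.I * ((inner ℝ x ξ : ℝ) : ℂ))) * (f x : ℂ)

/-- The generalized Sobolev space `H_a^b(ℝ³)`: tempered distributions whose Fourier transform is a
function `û` with `∫_{|ξ| ≤ 1} |ξ|^{2a} |û|² + ∫_{|ξ| ≥ 1} |ξ|^{2b} |û|² < ∞`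
(`ξ` being the angular frequency). For `a < 3/2` every measurable `û` satisfying this bound is the
Fourier transform of a tempered distribution. -/
def MemHab (a b : ℝ) (u : 𝓢'(E3, ℂ)) : Prop :=
  ∃ g : E3 → ℂ, Represents g (𝓕 u) ∧
    IntegrableOn (fun ξ => (2 * Real.pi * ‖ξ‖) ^ (2 * a) * ‖g ξ‖ ^ 2)
      {ξ : E3 | 2 * Real.pi * ‖ξ‖ ≤ 1} ∧
    IntegrableOn (fun ξ => (2 * Real.pi * ‖ξ‖) ^ (2 * b) * ‖g ξ‖ ^ 2)
      {ξ : E3 | 1 ≤ 2 * Real.pi * ‖ξ‖}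

/-- The `L²` duality pairing `∫ u w̄ dx` exists, as the absolutely convergent integral
`∫ û conj(ŵ) dξ`, and equals `c` (both agree for `u, w ∈ L²` by Plancherel's theorem). For
`u ∈ H_a^b` and `w ∈ H_{-a}^{-b}` this is the usual duality pairing. -/
def HasPairing (u w : 𝓢'(E3, ℂ)) (c : ℂ) : Prop :=
  ∃ g h : E3 → ℂ, Represents g (𝓕 u) ∧ Represents h (𝓕 w) ∧
    Integrable (fun ξ => g ξ * (starRingEnd ℂ) (h ξ)) ∧
    c = ∫ ξ, g ξ * (starRingEnd ℂ) (h ξ)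

/-- `F` is the force `∫ ∇W^X Re β dx` which the field `β` exerts on a particle at `X`. -/
def IsForce (W : 𝓢'(E3, ℂ)) (X : E3) (β : 𝓢'(E3, ℂ)) (F : E3) : Prop :=
  ∀ m : E3, HasPairing (∂_{m} (translate X W)) (reDist β) ((inner ℝ F m : ℝ) : ℂ)

/-! ### The equations of motion -/

/-- `(X, P, β)` solves, for all times,
`Ẋ = P`, `Ṗ = ∫ ∇W^X Re β dx`, `i β̇ = -Δβ + Re β + W^X`,
the last equation holding in the sense of tempered distributions. -/
structure IsSolution (W : 𝓢'(E3, ℂ)) (X P : ℝ → E3) (β : ℝ → 𝓢'(E3, ℂ)) : Prop where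
  position : ∀ t, HasDerivAt X (P t) t
  momentum : ∀ t, ∃ F, IsForce W (X t) (β t) F ∧ HasDerivAt P F t
  field : ∀ t (φ : 𝓢(E3, ℂ)), HasDerivAt (fun s => Complex.I * β s φ)
    ((-Δ (β t) + reDist (β t) + translate (X t) W) φ) t

/-- `γ` is the profile of an inertial solution with velocity `v`:
`X_t = vt`, `P_t = v`, `β_t = γ(· - vt)` solves the equations of motion. -/
def IsTravelingWave (W : 𝓢'(E3, ℂ)) (v : E3) (γ : 𝓢'(E3, ℂ)) : Prop :=
  IsSolution W (fun t => t • v) (fun _ => v) (fun t => translate (t • v) γ)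

/-- `β` has finite energy: the terms `∫ |∇β|²` and `∫ |Re β|²` of the Hamiltonian are finite.
(The term `∫ W^X Re β` is then finite as well when `W ∈ L²`.) -/
def FiniteEnergy (β : 𝓢'(E3, ℂ)) : Prop :=
  (∀ m : E3, ∃ f : Lp ℂ 2 (volume : Measure E3), ∂_{m} β = (f : 𝓢'(E3, ℂ))) ∧
  ∃ f : Lp ℂ 2 (volume : Measure E3), reDist β = (f : 𝓢'(E3, ℂ))

/-- `W` decays sufficiently fast: `‖⟨x⟩⁶ W‖_{L²} < ∞`. -/
def FastDecaying (W : E3 → ℝ) : Prop := MemLp (fun x => jb x ^ 6 * W x) 2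

/-- The regularity `Re γ ∈ ⋂_{a > r} H_a^s`, `Im γ ∈ ⋂_{a > q} H_a^s`. -/
def Regular (r q s : ℝ) (γ : 𝓢'(E3, ℂ)) : Prop :=
  (∀ a, r < a → MemHab a s (reDist γ)) ∧ (∀ a, q < a → MemHab a s (imDist γ))

/-- `γ` is a continuous function with `|Re γ(x)| ≲_ε ⟨x⟩^{-p+ε}` and `|Im γ(x)| ≲_ε ⟨x⟩^{-q+ε}` for
every `ε > 0`. -/
def Decays (p q : ℝ) (γ : 𝓢'(E3, ℂ)) : Prop :=
  ∃ g : E3 → ℂ, Continuous g ∧ Represents g γ ∧ ∀ ε : ℝ, 0 < ε → ∃ C : ℝ, ∀ x,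
    |(g x).re| ≤ C * jb x ^ (-p + ε) ∧ |(g x).im| ≤ C * jb x ^ (-q + ε)

/-- The set `{ξ | 1 + |ξ|² - (v · ξ̂)² = 0}`, where `ξ̂ = ξ / |ξ|`. -/
def resonantSet (v : E3) : Set E3 :=
  {ξ | ξ ≠ 0 ∧ 1 + ‖ξ‖ ^ 2 - (inner ℝ v (‖ξ‖⁻¹ • ξ)) ^ 2 = 0}

end InertialWave

end

open InertialWave SchwartzMap MeasureTheory

namespace InertialWave

open Filter Topology

/-! Inserting the ansatz into the field equation leaves a linear constant-coefficient equation for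
the profile, `-i ∂_v γ = -Δγ + Re γ + W` (`isTravelingWave_iff`). Splitting into real and imaginary
parts (`fieldEq_iff`) and eliminating `Im γ` turns it, at angular frequency `η`, into `N R̂ = -|η|²
Ŵ` with `N = |η|² + |η|⁴ - (v·η)²`, together with `|η|² Ŝ = -i (v·η) R̂`. So `γ` is governed by the
two multipliers `mRe = |η|² / N` and `mIm = (v·η) / N`, and everything depends on the zeros of `N`.

For `|v| ≤ 1` the only zero is the origin, a null set, so the transforms are determined and the
profile is unique among those whose transforms are functions. The factor `|η|⁻²` at infinity gains
two derivatives. At the origin `N` is comparable to `|η|²` if `|v| < 1`; if `|v| = 1` it equals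
`|η_⊥|² + |η|⁴`, an anisotropic zero whose negative powers are dominated by products of one-variable
powers (`symN_rpow_le`). The force vanishes because its density in frequency is `mRe |Ŵ|²`, which is
even, times a linear function.

Pointwise decay comes from finite differences in frequency. For `h = x / (2|x|²)` each difference
with step `h` multiplies the inverse transform at `x` by `-2`, so an `L¹` bound `C |h|^κ` on third
differences gives decay `|x|^(-κ)` (`exists_decay_of_fwdDiff`), for fractional `κ` as well. Fast
decay of `W` controls the differences of `Ŵ`. Those of the multipliers follow from symbol estimates
away from the origin (`exists_fwdDiff_multiplier_le`) and, for `|v| = 1`, from Lipschitz and Hölder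
estimates near it (`abs_mRe_sub_le`, `abs_mIm_sub_le`).

For `|v| > 1` a resonant point is a zero of `N` away from the origin, and `N` has a simple zero on
every nearby ray. If `Ŵ` does not vanish there, `R̂` is at least of size `1/|N|`, which is not
square integrable (`lintegral_sq_eq_top_of_resonance`). -/

/-! ### Differentiability of translations and reduction to the profile equation. -/

theorem shiftTest_apply (X : E3) (φ : 𝓢(E3, ℂ)) (x : E3) : shiftTest X φ x = φ (x + X) := rfl

theorem lineDeriv_comm (a b : E3) (ψ : 𝓢(E3, ℂ)) : ∂_{a} (∂_{b} ψ) = ∂_{b} (∂_{a} ψ) := by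
  have key : ∀ (c d : E3) (x : E3), (∂_{c} (∂_{d} ψ) : 𝓢(E3, ℂ)) x = fderiv ℝ (fderiv ℝ ψ) x c d := by
    intro c d x
    rw [SchwartzMap.lineDerivOp_apply_eq_fderiv]
    have h1 : (⇑(∂_{d} ψ : 𝓢(E3, ℂ)) : E3 → ℂ) = fun y => fderiv ℝ ψ y d := by
      ext y; rw [SchwartzMap.lineDerivOp_apply_eq_fderiv]
    rw [h1, fderiv_clm_apply]
    · simp
    · exact ((ψ.smooth 2).fderiv_right (m := 1) (by norm_num)).differentiable (by norm_num) x
    · fun_prop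
  ext x
  rw [key, key]
  have : IsSymmSndFDerivAt ℝ ψ x :=
    (ψ.contDiffAt 2).isSymmSndFDerivAt (by simp)
  exact this a b

theorem iteratedLineDeriv_comm (v : E3) (n : ℕ) (m : Fin n → E3) (ψ : 𝓢(E3, ℂ)) :
    ∂^{m} (∂_{v} ψ) = ∂_{v} (∂^{m} ψ) := by
  induction n with
  | zero => simp
  | succ n ih =>
    rw [LineDeriv.iteratedLineDerivOp_succ_left, ih, LineDeriv.iteratedLineDerivOp_succ_left,
      lineDeriv_comm]

theorem fderiv_iteratedFDeriv_apply (v : E3) (n : ℕ) (ψ : 𝓢(E3, ℂ)) (x : E3) :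
    fderiv ℝ (iteratedFDeriv ℝ n ψ) x v = iteratedFDeriv ℝ n (∂_{v} ψ : 𝓢(E3, ℂ)) x := by
  ext m
  have hd : DifferentiableAt ℝ (iteratedFDeriv ℝ n ψ) x :=
    ((ψ.smooth (n + 1 : ℕ)).differentiable_iteratedFDeriv
      (by exact_mod_cast Nat.lt_succ_self n)) x
  rw [← SchwartzMap.iteratedLineDerivOp_eq_iteratedFDeriv, iteratedLineDeriv_comm,
    SchwartzMap.lineDerivOp_apply_eq_fderiv]
  have h1 : (⇑(∂^{m} ψ : 𝓢(E3, ℂ)) : E3 → ℂ) = fun y => iteratedFDeriv ℝ n ψ y m := by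
    ext y; rw [SchwartzMap.iteratedLineDerivOp_eq_iteratedFDeriv]
  rw [h1, fderiv_continuousMultilinear_apply_const_apply hd]

theorem hasDerivAt_iteratedFDeriv_line (v : E3) (n : ℕ) (ψ : 𝓢(E3, ℂ)) (x : E3) (s : ℝ) :
    HasDerivAt (fun s : ℝ => iteratedFDeriv ℝ n ψ (x + s • v))
      (iteratedFDeriv ℝ n (∂_{v} ψ : 𝓢(E3, ℂ)) (x + s • v)) s := by
  have hd : DifferentiableAt ℝ (iteratedFDeriv ℝ n ψ) (x + s • v) :=
    ((ψ.smooth (n + 1 : ℕ)).differentiable_iteratedFDeriv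
      (by exact_mod_cast Nat.lt_succ_self n)) _
  have h2 : HasDerivAt (fun s : ℝ => x + s • v) v s := by
    simpa using ((hasDerivAt_id s).smul_const v).const_add x
  have := hd.hasFDerivAt.comp_hasDerivAt s h2
  rwa [fderiv_iteratedFDeriv_apply] at this

theorem iteratedFDeriv_shiftTest (X : E3) (n : ℕ) (ψ : 𝓢(E3, ℂ)) (x : E3) :
    iteratedFDeriv ℝ n (shiftTest X ψ) x = iteratedFDeriv ℝ n ψ (x + X) :=
  iteratedFDeriv_comp_add_right n X x

theorem exists_bound_shift (v : E3) (k n : ℕ) (ψ : 𝓢(E3, ℂ)) :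
    ∃ C, 0 ≤ C ∧ ∀ s : ℝ, |s| ≤ 1 → ∀ x,
      ‖x‖ ^ k * ‖iteratedFDeriv ℝ n ψ (x + s • v)‖ ≤ C := by
  refine ⟨2 ^ (k - 1) * (SchwartzMap.seminorm ℝ k n ψ + ‖v‖ ^ k * SchwartzMap.seminorm ℝ 0 n ψ),
    by positivity, fun s hs x => ?_⟩
  have h1 : ‖x‖ ≤ ‖x + s • v‖ + ‖v‖ := by
    calc ‖x‖ = ‖(x + s • v) - s • v‖ := by simp
      _ ≤ ‖x + s • v‖ + ‖s • v‖ := norm_sub_le _ _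
      _ ≤ ‖x + s • v‖ + ‖v‖ := by
        gcongr; rw [norm_smul]
        exact mul_le_of_le_one_left (norm_nonneg _) hs
  have h2 : ‖x‖ ^ k ≤ 2 ^ (k - 1) * (‖x + s • v‖ ^ k + ‖v‖ ^ k) :=
    (pow_le_pow_left₀ (norm_nonneg _) h1 k).trans
      (add_pow_le (norm_nonneg _) (norm_nonneg _) k)
  have h3 := SchwartzMap.le_seminorm ℝ k n ψ (x + s • v)
  have h4 := SchwartzMap.le_seminorm ℝ 0 n ψ (x + s • v)
  rw [pow_zero, one_mul] at h4
  calc _ ≤ 2 ^ (k - 1) * (‖x + s • v‖ ^ k + ‖v‖ ^ k) * ‖iteratedFDeriv ℝ n ψ (x + s • v)‖ := by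
        gcongr
    _ = 2 ^ (k - 1) * (‖x + s • v‖ ^ k * ‖iteratedFDeriv ℝ n ψ (x + s • v)‖ +
        ‖v‖ ^ k * ‖iteratedFDeriv ℝ n ψ (x + s • v)‖) := by ring
    _ ≤ _ := by gcongr

theorem norm_sub_le_of_hasDerivAt {G : Type*} [NormedAddCommGroup G] [NormedSpace ℝ G]
    {f f' : ℝ → G} {C s : ℝ} (hf : ∀ t, HasDerivAt f (f' t) t)
    (hb : ∀ t, |t| ≤ |s| → ‖f' t‖ ≤ C) : ‖f s - f 0‖ ≤ C * |s| := by
  have := Convex.norm_image_sub_le_of_norm_hasDerivWithin_le (𝕜 := ℝ) (f := f) (f' := f')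
    (s := Set.Icc (-|s|) |s|) (x := 0) (y := s) (C := C)
    (fun t _ => (hf t).hasDerivWithinAt) (fun t ht => hb t (abs_le.2 ht)) (convex_Icc _ _)
    (by simp) (abs_le.1 le_rfl)
  simpa using this

theorem exists_seminorm_shift_sub_le (v : E3) (k n : ℕ) (ψ : 𝓢(E3, ℂ)) :
    ∃ C, 0 ≤ C ∧ ∀ s : ℝ, |s| ≤ 1 → ∀ x,
      ‖x‖ ^ k * ‖iteratedFDeriv ℝ n ψ (x + s • v) - iteratedFDeriv ℝ n ψ x‖ ≤ C * |s| := by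
  obtain ⟨C, hC0, hC⟩ := exists_bound_shift v k n (∂_{v} ψ)
  refine ⟨C, hC0, fun s hs x => ?_⟩
  have := norm_sub_le_of_hasDerivAt (s := s) (C := C)
    (f := fun s : ℝ => ‖x‖ ^ k • iteratedFDeriv ℝ n ψ (x + s • v))
    (fun t => (hasDerivAt_iteratedFDeriv_line v n ψ x t).const_smul (‖x‖ ^ k)) (fun t ht => by
      rw [norm_smul, norm_pow, norm_norm]
      exact hC t (ht.trans hs) x)
  rw [← smul_sub, norm_smul, norm_pow, norm_norm] at this
  simpa using this

/-- Mean value inequality applied to the first-order remainder, whose derivative in `s` is a first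
difference of `∂_v ψ` and hence already `O(|s|)`. -/
theorem exists_seminorm_shift_taylor_le (v : E3) (k n : ℕ) (ψ : 𝓢(E3, ℂ)) :
    ∃ C, 0 ≤ C ∧ ∀ s : ℝ, |s| ≤ 1 → ∀ x,
      ‖x‖ ^ k * ‖iteratedFDeriv ℝ n ψ (x + s • v) - iteratedFDeriv ℝ n ψ x -
        s • iteratedFDeriv ℝ n (∂_{v} ψ : 𝓢(E3, ℂ)) x‖ ≤ C * |s| ^ 2 := by
  obtain ⟨C, hC0, hC⟩ := exists_seminorm_shift_sub_le v k n (∂_{v} ψ)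
  refine ⟨C, hC0, fun s hs x => ?_⟩
  have := norm_sub_le_of_hasDerivAt (s := s) (C := C * |s|)
    (f := fun s : ℝ => ‖x‖ ^ k • (iteratedFDeriv ℝ n ψ (x + s • v) -
      s • iteratedFDeriv ℝ n (∂_{v} ψ : 𝓢(E3, ℂ)) x))
    (f' := fun s : ℝ => ‖x‖ ^ k • (iteratedFDeriv ℝ n (∂_{v} ψ : 𝓢(E3, ℂ)) (x + s • v) -
      iteratedFDeriv ℝ n (∂_{v} ψ : 𝓢(E3, ℂ)) x))
    (fun t => by
      have h1 : HasDerivAt (fun s : ℝ => s • iteratedFDeriv ℝ n (∂_{v} ψ : 𝓢(E3, ℂ)) x)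
          (iteratedFDeriv ℝ n (∂_{v} ψ : 𝓢(E3, ℂ)) x) t := by
        simpa using (hasDerivAt_id t).smul_const (iteratedFDeriv ℝ n (∂_{v} ψ : 𝓢(E3, ℂ)) x)
      exact ((hasDerivAt_iteratedFDeriv_line v n ψ x t).sub h1).const_smul (‖x‖ ^ k)) (fun t ht => by
      rw [norm_smul, norm_pow, norm_norm]
      exact (hC t (ht.trans hs) x).trans (by gcongr))
  rw [← smul_sub, norm_smul, norm_pow, norm_norm] at this
  convert this using 1
  · congr 2
    simp only [zero_smul, add_zero, sub_zero]
    abel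
  · ring

/-- The limit must hold in the Schwartz topology, not just pointwise, since a tempered distribution
is only continuous for that topology. -/
theorem tendsto_slope_shiftTest (v : E3) (ψ : 𝓢(E3, ℂ)) :
    Tendsto (fun s : ℝ => s⁻¹ • (shiftTest (s • v) ψ - ψ)) (𝓝[≠] 0) (𝓝 (∂_{v} ψ)) := by
  rw [(schwartz_withSeminorms ℝ E3 ℂ).tendsto_nhds]
  rintro ⟨k, n⟩ ε hε
  obtain ⟨C, hC0, hC⟩ := exists_seminorm_shift_taylor_le v k n ψ
  have hlt : ∀ᶠ s : ℝ in 𝓝[≠] 0, |s| < min 1 (ε / (C + 1)) := by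
    refine eventually_nhdsWithin_of_eventually_nhds ?_
    have : (0 : ℝ) < min 1 (ε / (C + 1)) := by positivity
    filter_upwards [Metric.ball_mem_nhds (0 : ℝ) this] with s hs
    simpa [Real.dist_eq] using hs
  filter_upwards [hlt, self_mem_nhdsWithin] with s hs hs0
  have hs0 : s ≠ 0 := hs0
  have hs1 : |s| ≤ 1 := (hs.le).trans (min_le_left _ _)
  have hs2 : |s| < ε / (C + 1) := hs.trans_le (min_le_right _ _)
  rw [SchwartzMap.schwartzSeminormFamily_apply]
  have hle : SchwartzMap.seminorm ℝ k n (s⁻¹ • (shiftTest (s • v) ψ - ψ) - ∂_{v} ψ) ≤ C * |s| := by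
    refine SchwartzMap.seminorm_le_bound ℝ k n _ (by positivity) fun x => ?_
    have e1 : iteratedFDeriv ℝ n (⇑(s⁻¹ • (shiftTest (s • v) ψ - ψ) - ∂_{v} ψ : 𝓢(E3, ℂ))) x =
        s⁻¹ • (iteratedFDeriv ℝ n ψ (x + s • v) - iteratedFDeriv ℝ n ψ x -
          s • iteratedFDeriv ℝ n (∂_{v} ψ : 𝓢(E3, ℂ)) x) := by
      ext m
      rw [← SchwartzMap.iteratedLineDerivOp_eq_iteratedFDeriv]
      have : ∂^{m} (s⁻¹ • (shiftTest (s • v) ψ - ψ) - ∂_{v} ψ) =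
          s⁻¹ • (∂^{m} (shiftTest (s • v) ψ) - ∂^{m} ψ) - ∂^{m} (∂_{v} ψ) := by
        simp [sub_eq_add_neg, LineDeriv.iteratedLineDerivOp_add, LineDeriv.iteratedLineDerivOp_neg,
          LineDeriv.iteratedLineDerivOp_smul]
      rw [this]
      simp only [sub_apply, smul_apply,
        SchwartzMap.iteratedLineDerivOp_eq_iteratedFDeriv, iteratedFDeriv_shiftTest,
        smul_sub, smul_smul, inv_mul_cancel₀ hs0, one_smul]
    rw [e1, norm_smul, norm_inv, Real.norm_eq_abs]
    have h := hC s hs1 x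
    have hs3 : 0 < |s| := abs_pos.2 hs0
    calc _ = |s|⁻¹ * (‖x‖ ^ k * ‖iteratedFDeriv ℝ n ψ (x + s • v) - iteratedFDeriv ℝ n ψ x -
          s • iteratedFDeriv ℝ n (∂_{v} ψ : 𝓢(E3, ℂ)) x‖) := by ring
      _ ≤ |s|⁻¹ * (C * |s| ^ 2) := by gcongr
      _ = C * |s| := by field_simp
  calc _ ≤ C * |s| := hle
    _ ≤ (C + 1) * |s| := by gcongr; linarith
    _ < (C + 1) * (ε / (C + 1)) := by gcongr
    _ = ε := by field_simp

theorem shiftTest_shiftTest (X Y : E3) (φ : 𝓢(E3, ℂ)) :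
    shiftTest X (shiftTest Y φ) = shiftTest (X + Y) φ := by
  ext x; simp [shiftTest_apply, add_assoc]

theorem lineDeriv_shiftTest (X m : E3) (φ : 𝓢(E3, ℂ)) :
    ∂_{m} (shiftTest X φ) = shiftTest X (∂_{m} φ) := by
  ext x
  rw [shiftTest_apply, SchwartzMap.lineDerivOp_apply_eq_fderiv,
    SchwartzMap.lineDerivOp_apply_eq_fderiv]
  have : (⇑(shiftTest X φ) : E3 → ℂ) = fun x => φ (x + X) := rfl
  rw [this, fderiv_comp_add_right]

theorem laplacian_shiftTest (X : E3) (φ : 𝓢(E3, ℂ)) :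
    Δ (shiftTest X φ) = shiftTest X (Δ φ) := by
  simp only [SchwartzMap.laplacian_eq_sum (stdOrthonormalBasis ℝ E3), map_sum, lineDeriv_shiftTest]

theorem dist_smul (u : 𝓢'(E3, ℂ)) (c : ℂ) (φ : 𝓢(E3, ℂ)) : u (c • φ) = c * u φ := by
  simp

theorem dist_sub (u : 𝓢'(E3, ℂ)) (φ ψ : 𝓢(E3, ℂ)) : u (φ - ψ) = u φ - u ψ := by
  simp

theorem dist_neg (u : 𝓢'(E3, ℂ)) (φ : 𝓢(E3, ℂ)) : u (-φ) = -u φ := by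
  simp

theorem hasDerivAt_shiftTest (u : 𝓢'(E3, ℂ)) (v : E3) (φ : 𝓢(E3, ℂ)) (t : ℝ) :
    HasDerivAt (fun s : ℝ => u (shiftTest (s • v) φ)) (u (∂_{v} (shiftTest (t • v) φ))) t := by
  rw [hasDerivAt_iff_tendsto_slope_zero]
  have hc : Continuous (fun ψ : 𝓢(E3, ℂ) => u ψ) := u.continuous
  have h : Tendsto (fun s : ℝ => u (s⁻¹ • (shiftTest (s • v) (shiftTest (t • v) φ) -
      shiftTest (t • v) φ))) (𝓝[≠] 0) (𝓝 (u (∂_{v} (shiftTest (t • v) φ)))) :=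
    (hc.tendsto _).comp (tendsto_slope_shiftTest v (shiftTest (t • v) φ))
  refine h.congr fun s => ?_
  simp only [shiftTest_shiftTest, ← add_smul]
  rw [show s⁻¹ • (shiftTest ((s + t) • v) φ - shiftTest (t • v) φ) =
    ((s⁻¹ : ℝ) : ℂ) • (shiftTest ((s + t) • v) φ - shiftTest (t • v) φ) from by
      ext x; simp, dist_smul, dist_sub, add_comm s t]
  simp

theorem reDist_translate (X : E3) (u : 𝓢'(E3, ℂ)) :
    reDist (translate X u) = translate X (reDist u) := by
  ext φ; rfl

theorem laplacian_translate (X : E3) (u : 𝓢'(E3, ℂ)) :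
    Δ (translate X u) = translate X (Δ u) := by
  ext φ
  simp [translate_apply, laplacian_shiftTest]

theorem shiftTest_zero (φ : 𝓢(E3, ℂ)) : shiftTest 0 φ = φ := by
  ext x; simp [shiftTest_apply]

/-- All terms of the field equation commute with translations, so the equation at time `t` tested
against `φ` is the profile equation tested against the shifted `φ`; time `0` alone gives it back. -/
theorem isTravelingWave_iff {W : 𝓢'(E3, ℂ)} {v : E3} {γ : 𝓢'(E3, ℂ)} :
    IsTravelingWave W v γ ↔
      (∀ t : ℝ, IsForce W (t • v) (translate (t • v) γ) 0) ∧
      -Complex.I • ∂_{v} γ = -Δ γ + reDist γ + W := by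
  have hder : ∀ (φ : 𝓢(E3, ℂ)) (t : ℝ), HasDerivAt (fun s : ℝ => Complex.I * translate (s • v) γ φ)
      ((-Complex.I • ∂_{v} γ) (shiftTest (t • v) φ)) t := by
    intro φ t
    have := (hasDerivAt_shiftTest γ v φ t).const_mul Complex.I
    have e : (-Complex.I • ∂_{v} γ) (shiftTest (t • v) φ) =
        Complex.I * γ (∂_{v} (shiftTest (t • v) φ)) := by
      show -Complex.I * γ (-∂_{v} (shiftTest (t • v) φ)) = _
      rw [dist_neg]; ring
    rw [e]
    exact this
  have hrhs : ∀ (φ : 𝓢(E3, ℂ)) (t : ℝ), (-Δ (translate (t • v) γ) + reDist (translate (t • v) γ) +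
      translate (t • v) W) φ = (-Δ γ + reDist γ + W) (shiftTest (t • v) φ) := by
    intro φ t
    rw [laplacian_translate, reDist_translate]
    rfl
  constructor
  · intro h
    refine ⟨fun t => ?_, ?_⟩
    · obtain ⟨F, hF, hd⟩ := h.momentum t
      rw [hd.unique (hasDerivAt_const t v)] at hF
      exact hF
    · ext φ
      have h1 := (h.field 0 φ).unique (hder φ 0)
      rw [hrhs] at h1
      simpa [shiftTest_zero] using h1.symm
  · rintro ⟨h1, h2⟩
    refine ⟨fun t => ?_, fun t => ⟨0, h1 t, hasDerivAt_const t v⟩, fun t φ => ?_⟩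
    · simpa using (hasDerivAt_id t).smul_const v
    · rw [hrhs, ← h2]
      exact hder φ t

/-! ### Distributions given by functions, and their Fourier transforms. -/

theorem exists_schwartz_eq_one_on_closedBall (R : ℝ) :
    ∃ φ : 𝓢(E3, ℂ), ∀ x ∈ Metric.closedBall (0 : E3) R, φ x = 1 := by
  have hR : 0 < max R 0 + 1 := by positivity
  let f : ContDiffBump (0 : E3) := ⟨max R 0 + 1, max R 0 + 2, hR, by linarith⟩
  have h1 : HasCompactSupport (Complex.ofRealCLM ∘ f) := f.hasCompactSupport.comp_left rfl
  have h2 : ContDiff ℝ (⊤ : ℕ∞) (Complex.ofRealCLM ∘ f) :=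
    Complex.ofRealCLM.contDiff.comp f.contDiff
  refine ⟨h1.toSchwartzMap h2, fun x hx => ?_⟩
  have : f x = 1 := f.one_of_mem_closedBall (Metric.closedBall_subset_closedBall
    (by show R ≤ max R 0 + 1; linarith [le_max_left R 0]) hx)
  show ((f x : ℝ) : ℂ) = 1
  rw [this]; simp

theorem Represents.integrableOn_closedBall {g : E3 → ℂ} {u : 𝓢'(E3, ℂ)} (h : Represents g u)
    (R : ℝ) : IntegrableOn g (Metric.closedBall 0 R) := by
  obtain ⟨φ, hφ⟩ := exists_schwartz_eq_one_on_closedBall R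
  refine ((h φ).1.integrableOn (s := Metric.closedBall 0 R)).congr_fun (fun x hx => ?_)
    Metric.isClosed_closedBall.measurableSet
  simp only [hφ x hx, one_mul]

theorem Represents.locallyIntegrable {g : E3 → ℂ} {u : 𝓢'(E3, ℂ)} (h : Represents g u) :
    LocallyIntegrable g := by
  intro x
  exact ⟨Metric.closedBall 0 (‖x‖ + 1), Metric.closedBall_mem_nhds_of_mem (by simp),
    h.integrableOn_closedBall _⟩

theorem Represents.ae_eq {g h : E3 → ℂ} {u : 𝓢'(E3, ℂ)} (hg : Represents g u)
    (hh : Represents h u) : g =ᵐ[volume] h := by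
  refine ae_eq_of_integral_contDiff_smul_eq hg.locallyIntegrable hh.locallyIntegrable ?_
  intro f hf hfc
  have h1 : HasCompactSupport (Complex.ofRealCLM ∘ f) := hfc.comp_left rfl
  have h2 : ContDiff ℝ (⊤ : ℕ∞) (Complex.ofRealCLM ∘ f) :=
    Complex.ofRealCLM.contDiff.comp hf
  have e : ∀ k : E3 → ℂ, ∫ x, f x • k x = ∫ x, (h1.toSchwartzMap h2) x * k x := by
    intro k
    refine integral_congr_ae (Eventually.of_forall fun x => ?_)
    show f x • k x = ((f x : ℝ) : ℂ) * k x
    rw [Complex.real_smul]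
  rw [e, e, ← (hg _).2, ← (hh _).2]

theorem Represents.congr {g h : E3 → ℂ} {u : 𝓢'(E3, ℂ)} (hg : Represents g u)
    (hh : g =ᵐ[volume] h) : Represents h u := by
  intro φ
  have e : (fun x => φ x * g x) =ᵐ[volume] fun x => φ x * h x := by
    filter_upwards [hh] with x hx; rw [hx]
  exact ⟨(hg φ).1.congr e, (hg φ).2.trans (integral_congr_ae e)⟩

theorem Represents.ext {g : E3 → ℂ} {u w : 𝓢'(E3, ℂ)} (hu : Represents g u)
    (hw : Represents g w) : u = w := by
  ext φ
  rw [(hu φ).2, (hw φ).2]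

theorem Represents.add {g h : E3 → ℂ} {u w : 𝓢'(E3, ℂ)} (hg : Represents g u)
    (hh : Represents h w) : Represents (fun x => g x + h x) (u + w) := by
  intro φ
  have e : (fun x => φ x * (g x + h x)) = fun x => φ x * g x + φ x * h x := by
    ext x; ring
  rw [e]
  refine ⟨(hg φ).1.add (hh φ).1, ?_⟩
  rw [integral_add (hg φ).1 (hh φ).1, ← (hg φ).2, ← (hh φ).2]
  rfl

theorem Represents.smul {g : E3 → ℂ} {u : 𝓢'(E3, ℂ)} (hg : Represents g u) (c : ℂ) :
    Represents (fun x => c * g x) (c • u) := by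
  intro φ
  have e : (fun x => φ x * (c * g x)) = fun x => c * (φ x * g x) := by
    ext x; ring
  rw [e]
  refine ⟨(hg φ).1.const_mul c, ?_⟩
  rw [integral_const_mul, ← (hg φ).2]
  rfl

theorem Represents.sum {ι : Type*} (s : Finset ι) {g : ι → E3 → ℂ} {u : ι → 𝓢'(E3, ℂ)}
    (hg : ∀ i, Represents (g i) (u i)) :
    Represents (fun x => ∑ i ∈ s, g i x) (∑ i ∈ s, u i) := by
  classical
  induction s using Finset.induction_on with
  | empty => intro φ; simp
  | insert a s ha ih =>
    simp only [Finset.sum_insert ha]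
    exact (hg a).add ih

theorem Represents.smulLeftCLM {g m : E3 → ℂ} {u : 𝓢'(E3, ℂ)} (hg : Represents g u)
    (hm : m.HasTemperateGrowth) :
    Represents (fun x => m x * g x) (TemperedDistribution.smulLeftCLM ℂ m u) := by
  intro φ
  have := hg (SchwartzMap.smulLeftCLM ℂ m φ)
  have e : (fun x => SchwartzMap.smulLeftCLM ℂ m φ x * g x) = fun x => φ x * (m x * g x) := by
    ext x
    rw [SchwartzMap.smulLeftCLM_apply_apply hm, smul_eq_mul]; ring
  rw [e] at this
  exact this

theorem Represents.fourier_lineDeriv {g : E3 → ℂ} {u : 𝓢'(E3, ℂ)} (hg : Represents g (𝓕 u))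
    (m : E3) : Represents (fun ξ => 2 * Real.pi * Complex.I * ((inner ℝ ξ m : ℝ) : ℂ) * g ξ)
      (𝓕 (∂_{m} u)) := by
  rw [TemperedDistribution.fourier_lineDerivOp_eq]
  have := (hg.smulLeftCLM (m := fun ξ => ((inner ℝ ξ m : ℝ) : ℂ)) (by fun_prop)).smul
    (2 * Real.pi * Complex.I)
  simpa only [mul_assoc] using this

theorem Represents.fourier_laplacian {g : E3 → ℂ} {u : 𝓢'(E3, ℂ)} (hg : Represents g (𝓕 u)) :
    Represents (fun ξ => -((((2 * Real.pi * ‖ξ‖) ^ 2 : ℝ)) : ℂ) * g ξ) (𝓕 (Δ u)) := by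
  rw [TemperedDistribution.laplacian_eq_sum (EuclideanSpace.basisFun (Fin 3) ℝ)]
  have h1 := Represents.sum Finset.univ
    (fun i : Fin 3 => (hg.fourier_lineDeriv (EuclideanSpace.basisFun (Fin 3) ℝ i)).fourier_lineDeriv
      (EuclideanSpace.basisFun (Fin 3) ℝ i))
  have e1 : 𝓕 (∑ i, ∂_{EuclideanSpace.basisFun (Fin 3) ℝ i}
      (∂_{EuclideanSpace.basisFun (Fin 3) ℝ i} u)) = ∑ i, 𝓕 (∂_{EuclideanSpace.basisFun (Fin 3) ℝ i}
      (∂_{EuclideanSpace.basisFun (Fin 3) ℝ i} u)) :=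
    map_sum (fourierCLM ℂ 𝓢'(E3, ℂ)) _ _
  rw [e1]
  convert h1 using 2 with ξ
  have h2 : ((‖ξ‖ ^ 2 : ℝ) : ℂ) = ∑ i : Fin 3, (ξ i : ℂ) ^ 2 := by
    rw [EuclideanSpace.real_norm_sq_eq]; push_cast; rfl
  push_cast at h2 ⊢
  rw [mul_pow, h2]
  have h3 : ∀ i : Fin 3, inner ℝ ξ (EuclideanSpace.basisFun (Fin 3) ℝ i) = ξ i := by
    intro i; simp [EuclideanSpace.inner_single_right]
  simp only [h3, Fin.sum_univ_three]
  linear_combination (-4 * (Real.pi : ℂ) ^ 2 * ((ξ 0 : ℂ) ^ 2 + (ξ 1 : ℂ) ^ 2 + (ξ 2 : ℂ) ^ 2) * g ξ)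
    * Complex.I_sq

theorem fourierInv_shiftTest (X : E3) (φ : 𝓢(E3, ℂ)) (ξ : E3) :
    (𝓕⁻ (shiftTest X φ) : 𝓢(E3, ℂ)) ξ =
      Complex.exp (-(2 * Real.pi * Complex.I * ((inner ℝ X ξ : ℝ) : ℂ))) * (𝓕⁻ φ : 𝓢(E3, ℂ)) ξ := by
  rw [SchwartzMap.fourierInv_coe, SchwartzMap.fourierInv_coe, Real.fourierInv_eq',
    Real.fourierInv_eq', ← integral_const_mul]
  simp only [shiftTest_apply]
  rw [← integral_sub_right_eq_self _ X]
  refine integral_congr_ae (Eventually.of_forall fun x => ?_)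
  simp only [sub_add_cancel, smul_eq_mul, ← mul_assoc, ← Complex.exp_add, inner_sub_left]
  congr 2
  push_cast
  ring

theorem Represents.fourier_translate {g : E3 → ℂ} {u : 𝓢'(E3, ℂ)} (hg : Represents g (𝓕 u))
    (X : E3) : Represents (fun ξ => Complex.exp (-(2 * Real.pi * Complex.I *
      ((inner ℝ X ξ : ℝ) : ℂ))) * g ξ) (𝓕 (translate X u)) := by
  intro φ
  have h := hg (𝓕⁻ (shiftTest X (𝓕 φ)))
  have e1 : ∀ ξ, (𝓕⁻ (shiftTest X (𝓕 φ)) : 𝓢(E3, ℂ)) ξ =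
      Complex.exp (-(2 * Real.pi * Complex.I * ((inner ℝ X ξ : ℝ) : ℂ))) * φ ξ := by
    intro ξ
    rw [fourierInv_shiftTest, FourierTransform.fourierInv_fourier_eq]
  have e2 : (fun x => (𝓕⁻ (shiftTest X (𝓕 φ)) : 𝓢(E3, ℂ)) x * g x) = fun ξ =>
      φ ξ * (Complex.exp (-(2 * Real.pi * Complex.I * ((inner ℝ X ξ : ℝ) : ℂ))) * g ξ) := by
    ext ξ; rw [e1]; ring
  rw [e2] at h
  refine ⟨h.1, ?_⟩
  rw [← h.2, TemperedDistribution.fourier_apply, TemperedDistribution.fourier_apply,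
    translate_apply, FourierTransform.fourier_fourierInv_eq]

theorem fourierInv_conjTest (φ : 𝓢(E3, ℂ)) (ξ : E3) :
    (𝓕⁻ (conjTest (𝓕 φ)) : 𝓢(E3, ℂ)) ξ = (starRingEnd ℂ) (φ (-ξ)) := by
  have h1 : φ (-ξ) = (𝓕 (𝓕 φ) : 𝓢(E3, ℂ)) ξ := by
    have h0 : (𝓕⁻ (𝓕 φ : 𝓢(E3, ℂ)) : 𝓢(E3, ℂ)) = φ := FourierTransform.fourierInv_fourier_eq φ
    conv_lhs => rw [← h0]
    rw [SchwartzMap.fourierInv_coe, Real.fourierInv_eq_fourier_neg, neg_neg]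
    rfl
  rw [h1, SchwartzMap.fourierInv_coe, SchwartzMap.fourier_coe (𝓕 φ), Real.fourierInv_eq',
    Real.fourier_eq', ← integral_conj]
  refine integral_congr_ae (Eventually.of_forall fun x => ?_)
  simp only [conjTest_apply, smul_eq_mul, map_mul, ← Complex.exp_conj, Complex.conj_ofReal,
    Complex.conj_I]
  congr 2
  push_cast
  ring

theorem Represents.fourier_conjDist {g : E3 → ℂ} {u : 𝓢'(E3, ℂ)} (hg : Represents g (𝓕 u)) :
    Represents (fun ξ => (starRingEnd ℂ) (g (-ξ))) (𝓕 (conjDist u)) := by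
  intro φ
  have h := hg (𝓕⁻ (conjTest (𝓕 φ)))
  have e2 : (fun x => (𝓕⁻ (conjTest (𝓕 φ)) : 𝓢(E3, ℂ)) x * g x) = fun ξ =>
      (starRingEnd ℂ) (φ (-ξ)) * g ξ := by
    ext ξ; rw [fourierInv_conjTest]
  rw [e2] at h
  have h2 : Integrable fun ξ => (starRingEnd ℂ) (φ ξ) * g (-ξ) := by
    simpa using h.1.comp_neg
  constructor
  · refine (Complex.conjCLE.toContinuousLinearMap.integrable_comp h2).congr
      (Eventually.of_forall fun ξ => ?_)
    simp
  · rw [TemperedDistribution.fourier_apply, conjDist_apply]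
    have h3 := h.2
    rw [TemperedDistribution.fourier_apply, FourierTransform.fourier_fourierInv_eq] at h3
    rw [h3, ← integral_conj, ← integral_neg_eq_self]
    simp

/-- Hermitian symmetry of the Fourier transform means that the distribution is real. The real and
imaginary parts of the profile, built on the Fourier side, are recognised this way. -/
theorem Represents.conjDist_eq_self {g : E3 → ℂ} {u : 𝓢'(E3, ℂ)} (hg : Represents g (𝓕 u))
    (hs : ∀ ξ, g (-ξ) = (starRingEnd ℂ) (g ξ)) : conjDist u = u := by
  have h := hg.fourier_conjDist
  simp only [hs, Complex.conj_conj] at h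
  have := congrArg (fun w : 𝓢'(E3, ℂ) => 𝓕⁻ w) (h.ext hg)
  simpa using this

theorem represents_toTemperedDistribution {p : ENNReal} [Fact (1 ≤ p)]
    (f : Lp ℂ p (volume : Measure E3)) : Represents f (f : 𝓢'(E3, ℂ)) := by
  intro φ
  constructor
  · have : Fact (1 ≤ (1 - p⁻¹)⁻¹) := by simp [fact_iff]
    have hpq : ENNReal.HolderConjugate p (1 - p⁻¹)⁻¹ :=
      ENNReal.HolderConjugate.inv_one_sub_inv' (Fact.out)
    have := (Lp.memLp f).integrable_mul (φ.memLp (1 - p⁻¹)⁻¹)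
    exact this.congr (Eventually.of_forall fun x => mul_comm _ _)
  · simp [Lp.toTemperedDistribution_apply]

theorem exists_represents_of_memLp {p : ENNReal} [Fact (1 ≤ p)] {f : E3 → ℂ}
    (hf : MemLp f p) : ∃ u : 𝓢'(E3, ℂ), Represents f u :=
  ⟨_, (represents_toTemperedDistribution hf.toLp).congr hf.coeFn_toLp⟩

theorem exists_represents_add {f g : E3 → ℂ} (hf : Integrable f) (hg : MemLp g 2) :
    ∃ u : 𝓢'(E3, ℂ), Represents (fun x => f x + g x) u := by
  obtain ⟨u, hu⟩ := exists_represents_of_memLp (memLp_one_iff_integrable.2 hf)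
  obtain ⟨w, hw⟩ := exists_represents_of_memLp hg
  exact ⟨_, hu.add hw⟩

theorem represents_ofIntegrable (W : E3 → ℝ) (hW : Integrable W) :
    Represents (fun x => (W x : ℂ)) (ofIntegrable W hW) :=
  (represents_toTemperedDistribution _).congr (Integrable.coeFn_toL1 _)

theorem Represents.fourier_of_integrable {f : E3 → ℂ} {u : 𝓢'(E3, ℂ)} (h : Represents f u)
    (hf : Integrable f) : Represents (𝓕 f) (𝓕 u) := by
  intro φ
  have hc : Continuous (𝓕 f) := VectorFourier.fourierIntegral_continuous Real.continuous_fourierChar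
    (by exact continuous_inner) hf
  constructor
  · refine φ.integrable.mul_bdd (c := ∫ x, ‖f x‖) hc.aestronglyMeasurable
      (Eventually.of_forall fun ξ => ?_)
    exact VectorFourier.norm_fourierIntegral_le_integral_norm _ _ _ _ _
  · rw [TemperedDistribution.fourier_apply, (h _).2]
    have := VectorFourier.integral_fourierIntegral_smul_eq_flip (e := Real.fourierChar)
      (μ := (volume : Measure E3)) (ν := (volume : Measure E3)) (L := innerₗ E3)
      (f := φ) (g := f) Real.continuous_fourierChar (by exact continuous_inner) φ.integrable hf
    simp only [smul_eq_mul, flip_innerₗ] at this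
    exact this

theorem Represents.fourierInv_of_integrable {f : E3 → ℂ} {u : 𝓢'(E3, ℂ)} (h : Represents f (𝓕 u))
    (hf : Integrable f) : Represents (𝓕⁻ f) u := by
  intro φ
  have h1 := (h.fourier_of_integrable hf) (𝓕⁻ (𝓕⁻ φ))
  have e1 : ∀ x, (𝓕⁻ (𝓕⁻ φ) : 𝓢(E3, ℂ)) x = φ (-x) := by
    intro x
    rw [SchwartzMap.fourierInv_coe, Real.fourierInv_eq_fourier_neg, ← SchwartzMap.fourier_coe,
      FourierTransform.fourier_fourierInv_eq]
  simp only [e1] at h1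
  have e2 : ∀ x, 𝓕⁻ f x = 𝓕 f (-x) := fun x => Real.fourierInv_eq_fourier_neg f x
  constructor
  · have := h1.1.comp_neg
    simpa [e2] using this
  · have h2 := h1.2
    rw [TemperedDistribution.fourier_apply, TemperedDistribution.fourier_apply,
      FourierTransform.fourier_fourierInv_eq, FourierTransform.fourier_fourierInv_eq] at h2
    rw [h2, ← integral_neg_eq_self]
    simp [e2]

/-- Both the Fourier integral and the `L²` transform represent the same tempered distribution, hence
agree almost everywhere, and Plancherel carries over to the integral. -/
theorem memLp_fourier_of_memLp {f : E3 → ℂ} (h1 : Integrable f) (h2 : MemLp f 2) :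
    MemLp (𝓕 f) 2 ∧ eLpNorm (𝓕 f) 2 volume = eLpNorm f 2 volume := by
  have hu := (represents_toTemperedDistribution h2.toLp).congr h2.coeFn_toLp
  have h3 := hu.fourier_of_integrable h1
  rw [Lp.fourier_toTemperedDistribution_eq] at h3
  have h4 := h3.ae_eq (represents_toTemperedDistribution _)
  refine ⟨(memLp_congr_ae h4).2 (Lp.memLp _), ?_⟩
  rw [eLpNorm_congr_ae h4, ← eLpNorm_congr_ae h2.coeFn_toLp]
  have h5 := Lp.norm_fourier_eq (h2.toLp)
  rw [Lp.norm_def, Lp.norm_def] at h5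
  exact (ENNReal.toReal_eq_toReal_iff' (Lp.eLpNorm_ne_top _) (Lp.eLpNorm_ne_top _)).1 h5

theorem memLp_of_memSobolev {b : ℝ} {u : 𝓢'(E3, ℂ)} {g : E3 → ℂ} (hg : Represents g (𝓕 u))
    (hu : TemperedDistribution.MemSobolev b 2 u) :
    MemLp (fun ξ => (((1 + ‖ξ‖ ^ 2) ^ (b / 2) : ℝ) : ℂ) * g ξ) 2 := by
  obtain ⟨f, hf⟩ := TemperedDistribution.memSobolev_iff_exists_smulLeftCLM_fourier.1 hu
  have h1 := hg.smulLeftCLM (m := fun ξ => (((1 + ‖ξ‖ ^ 2) ^ (b / 2) : ℝ) : ℂ)) (by fun_prop)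
  rw [hf] at h1
  exact (memLp_congr_ae (h1.ae_eq (represents_toTemperedDistribution _))).2 (Lp.memLp _)

/-! ### The symbol: lower bounds and integrability of its negative powers. -/

/-- The symbol `|η|² + |η|⁴ - (v · η)²`. -/
noncomputable def symN (v η : E3) : ℝ := ‖η‖ ^ 2 + ‖η‖ ^ 4 - (inner ℝ v η) ^ 2

@[fun_prop]
theorem continuous_symN (v : E3) : Continuous (symN v) := by
  unfold symN; fun_prop

theorem integrableOn_abs_rpow {α : ℝ} (hα : α < 1) (R : ℝ) :
    IntegrableOn (fun t : ℝ => |t| ^ (-α)) (Set.Icc (-R) R) := by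
  have h := locallyIntegrable_of_norm_le_rpow (E := ℝ) (μ := volume) (f := fun t : ℝ => |t| ^ (-α))
    (C := 1) (α := α) (by simp) (by simpa using hα)
    (Eventually.of_forall fun t => by
      rw [one_mul, Real.norm_of_nonneg (by positivity), Real.norm_eq_abs])
    (Measurable.aestronglyMeasurable (by fun_prop))
  exact h.integrableOn_isCompact isCompact_Icc

theorem integrableOn_norm_rpow {s : ℝ} (hs : s < 3) (R : ℝ) :
    IntegrableOn (fun x : E3 => ‖x‖ ^ (-s)) (Metric.closedBall 0 R) := by
  have h := locallyIntegrable_of_norm_le_rpow (E := E3) (μ := volume)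
    (f := fun t : E3 => ‖t‖ ^ (-s)) (C := 1) (α := s) (by simp) (by simpa using hs)
    (Eventually.of_forall fun t => by
      rw [one_mul, Real.norm_of_nonneg (by positivity)])
    (Measurable.aestronglyMeasurable (by fun_prop))
  exact h.integrableOn_isCompact (isCompact_closedBall _ _)

theorem integrableOn_prod_abs_inner_rpow (b : OrthonormalBasis (Fin 3) ℝ E3) {α : Fin 3 → ℝ}
    (hα : ∀ i, α i < 1) (R : ℝ) :
    IntegrableOn (fun x : E3 => ∏ i, |inner ℝ (b i) x| ^ (-α i)) (Metric.closedBall 0 R) := by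
  have h1 : ∀ i, Integrable ((Set.Icc (-R) R).indicator fun t : ℝ => |t| ^ (-α i)) := fun i =>
    (integrable_indicator_iff measurableSet_Icc).2 (integrableOn_abs_rpow (hα i) R)
  have h2 : Integrable (fun x : Fin 3 → ℝ => ∏ i, (Set.Icc (-R) R).indicator
      (fun t : ℝ => |t| ^ (-α i)) (x i)) := Integrable.fintype_prod h1
  have h3 := (PiLp.volume_preserving_ofLp (Fin 3)).integrable_comp_of_integrable h2
  have h4 := b.measurePreserving_repr.integrable_comp_of_integrable h3
  refine (h4.integrableOn (s := Metric.closedBall 0 R)).congr_fun (fun x hx => ?_)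
    Metric.isClosed_closedBall.measurableSet
  simp only [Function.comp]
  refine Finset.prod_congr rfl fun i _ => ?_
  have h5 : (b.repr x).ofLp i = inner ℝ (b i) x := b.repr_apply_apply x i
  rw [h5, Set.indicator_of_mem]
  have h6 : |inner ℝ (b i) x| ≤ R := by
    refine (abs_real_inner_le_norm _ _).trans ?_
    rw [b.norm_eq_one, one_mul]
    simpa using hx
  exact abs_le.1 h6

theorem ae_inner_ne_zero {u : E3} (hu : u ≠ 0) : ∀ᵐ x : E3, inner ℝ u x ≠ 0 := by
  have h : (LinearMap.ker (innerₛₗ ℝ u) : Submodule ℝ E3) ≠ ⊤ := by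
    intro h
    have : u ∈ LinearMap.ker (innerₛₗ ℝ u) := h ▸ Submodule.mem_top
    simp at this
    exact hu this
  have := Measure.addHaar_submodule (volume : Measure E3) _ h
  rw [ae_iff]
  convert this using 2
  ext x
  simp

theorem exists_orthonormalBasis_zero_eq {v : E3} (hv : ‖v‖ = 1) :
    ∃ b : OrthonormalBasis (Fin 3) ℝ E3, b 0 = v := by
  obtain ⟨b, hb⟩ := Orthonormal.exists_orthonormalBasis_extension_of_card_eq (𝕜 := ℝ) (E := E3)
    (ι := Fin 3) (by simp) (v := fun _ => v) (s := {0}) (by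
      rw [orthonormal_iff_ite]
      rintro ⟨i, hi⟩ ⟨j, hj⟩
      simp only [Set.mem_singleton_iff] at hi hj
      subst hi; subst hj
      simp [Set.domRestrict, hv])
  exact ⟨b, hb 0 rfl⟩

theorem norm_sq_eq_sum (b : OrthonormalBasis (Fin 3) ℝ E3) (η : E3) :
    ‖η‖ ^ 2 = inner ℝ (b 0) η ^ 2 + inner ℝ (b 1) η ^ 2 + inner ℝ (b 2) η ^ 2 := by
  have := b.sum_sq_norm_inner_right η
  rw [← this, Fin.sum_univ_three]
  simp [Real.norm_eq_abs, sq_abs]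

theorem inner_sq_le (v η : E3) : inner ℝ v η ^ 2 ≤ ‖v‖ ^ 2 * ‖η‖ ^ 2 := by
  rw [← mul_pow, ← sq_abs]
  exact pow_le_pow_left₀ (abs_nonneg _) (abs_real_inner_le_norm v η) 2

theorem norm_pow_four_le_symN {v : E3} (hv : ‖v‖ ≤ 1) (η : E3) : ‖η‖ ^ 4 ≤ symN v η := by
  have h1 := inner_sq_le v η
  have h2 : ‖v‖ ^ 2 * ‖η‖ ^ 2 ≤ 1 * ‖η‖ ^ 2 := by
    gcongr; exact pow_le_one₀ (norm_nonneg _) hv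
  unfold symN; linarith

theorem symN_pos {v : E3} (hv : ‖v‖ ≤ 1) {η : E3} (hη : η ≠ 0) : 0 < symN v η :=
  lt_of_lt_of_le (by positivity) (norm_pow_four_le_symN hv η)

theorem symN_nonneg {v : E3} (hv : ‖v‖ ≤ 1) (η : E3) : 0 ≤ symN v η :=
  le_trans (by positivity) (norm_pow_four_le_symN hv η)

theorem le_symN (v η : E3) :
    (1 - ‖v‖ ^ 2) * (‖η‖ ^ 2 + ‖η‖ ^ 4) ≤ symN v η := by
  have h1 := inner_sq_le v η
  have h2 : 0 ≤ ‖v‖ ^ 2 * ‖η‖ ^ 4 := by positivity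
  unfold symN; nlinarith

theorem ae_coord_ne_zero (b : OrthonormalBasis (Fin 3) ℝ E3) :
    ∀ᵐ x : E3, ∀ i, inner ℝ (b i) x ≠ 0 := by
  rw [ae_all_iff]
  exact fun i => ae_inner_ne_zero (fun h => by
    have := b.norm_eq_one i
    rw [h] at this; simp at this)

/-- In coordinates with first axis `v`, the symbol is `η₁² + η₂² + |η|⁴`. It dominates both `|η|⁴`
and `|η₁ η₂|`; the first bound is raised to the power `-s`, the second to `-t`. -/
theorem symN_rpow_le (b : OrthonormalBasis (Fin 3) ℝ E3) {η : E3}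
    (h : ∀ i, inner ℝ (b i) η ≠ 0) {s t : ℝ} (hs : 0 ≤ s) (ht : 0 ≤ t) :
    symN (b 0) η ^ (-(s + t)) ≤ ‖η‖ ^ (-(4 * s)) * (|inner ℝ (b 1) η| ^ (-t) * |inner ℝ (b 2) η| ^ (-t)) := by
  have hη : η ≠ 0 := by rintro rfl; simp at h
  have hη' : 0 < ‖η‖ := norm_pos_iff.2 hη
  have hN : 0 < symN (b 0) η := symN_pos (b.norm_eq_one 0).le hη
  have h1 : ‖η‖ ^ 4 ≤ symN (b 0) η := norm_pow_four_le_symN (b.norm_eq_one 0).le η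
  have h2 : |inner ℝ (b 1) η| * |inner ℝ (b 2) η| ≤ symN (b 0) η := by
    have h3 := norm_sq_eq_sum b η
    have h4 : 0 ≤ ‖η‖ ^ 4 := by positivity
    unfold symN
    nlinarith [sq_nonneg (|inner ℝ (b 1) η| - |inner ℝ (b 2) η|), sq_abs (inner ℝ (b 1) η),
      sq_abs (inner ℝ (b 2) η), sq_nonneg (|inner ℝ (b 1) η|)]
  have h5 : 0 < |inner ℝ (b 1) η| := abs_pos.2 (h 1)
  have h6 : 0 < |inner ℝ (b 2) η| := abs_pos.2 (h 2)
  rw [neg_add, Real.rpow_add hN]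
  gcongr
  · calc symN (b 0) η ^ (-s) ≤ (‖η‖ ^ 4) ^ (-s) :=
          Real.rpow_le_rpow_of_nonpos (by positivity) h1 (by linarith)
      _ = ‖η‖ ^ (-(4 * s)) := by
          rw [← Real.rpow_natCast, ← Real.rpow_mul hη'.le]; congr 1; push_cast; ring
  · calc symN (b 0) η ^ (-t) ≤ (|inner ℝ (b 1) η| * |inner ℝ (b 2) η|) ^ (-t) :=
          Real.rpow_le_rpow_of_nonpos (by positivity) h2 (by linarith)
      _ = _ := Real.mul_rpow h5.le h6.le

/-- The integrand is dominated by `|η₀|^(σ - 4s) |η₁|^(-t) |η₂|^(-t)`, a product of one-variable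
functions. The conditions on `σ, s, t` make each exponent larger than `-1`, and the sign of `σ - 4s`
allows `|η|` to be replaced by `|η₀|`. -/
theorem integrableOn_norm_rpow_mul_symN_rpow {v : E3} (hv : ‖v‖ = 1) {σ s t : ℝ} (hs : 0 ≤ s)
    (ht : 0 ≤ t) (ht1 : t < 1) (h0 : σ - 4 * s ≤ 0) (h1 : -1 < σ - 4 * s) (R : ℝ) :
    IntegrableOn (fun η => ‖η‖ ^ σ * symN v η ^ (-(s + t))) (Metric.closedBall 0 R) := by
  obtain ⟨b, rfl⟩ := exists_orthonormalBasis_zero_eq hv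
  have h2 := integrableOn_prod_abs_inner_rpow b (α := ![4 * s - σ, t, t])
    (by intro i; fin_cases i <;> simp <;> linarith) R
  refine h2.mono' (by
    apply Measurable.aestronglyMeasurable
    have := (continuous_symN (b 0)).measurable
    fun_prop) (ae_restrict_of_ae ?_)
  filter_upwards [ae_coord_ne_zero b] with η hη
  have hη0 : η ≠ 0 := by rintro rfl; simp at hη
  have hη' : 0 < ‖η‖ := norm_pos_iff.2 hη0
  have hN : 0 < symN (b 0) η := symN_pos (b.norm_eq_one 0).le hη0
  rw [Real.norm_of_nonneg (by positivity), Fin.prod_univ_three]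
  simp only [Matrix.cons_val_zero, Matrix.cons_val_one, Matrix.cons_val]
  have h3 : |inner ℝ (b 0) η| ≤ ‖η‖ := by
    simpa [b.norm_eq_one] using abs_real_inner_le_norm (b 0) η
  have h4 : 0 < |inner ℝ (b 0) η| := abs_pos.2 (hη 0)
  calc ‖η‖ ^ σ * symN (b 0) η ^ (-(s + t))
      ≤ ‖η‖ ^ σ * (‖η‖ ^ (-(4 * s)) * (|inner ℝ (b 1) η| ^ (-t) * |inner ℝ (b 2) η| ^ (-t))) := by
        gcongr; exact symN_rpow_le b hη hs ht
    _ = ‖η‖ ^ (σ - 4 * s) * (|inner ℝ (b 1) η| ^ (-t) * |inner ℝ (b 2) η| ^ (-t)) := by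
        rw [← mul_assoc, ← Real.rpow_add hη', sub_eq_add_neg]
    _ ≤ |inner ℝ (b 0) η| ^ (σ - 4 * s) *
          (|inner ℝ (b 1) η| ^ (-t) * |inner ℝ (b 2) η| ^ (-t)) := by
        gcongr ?_ * _
        exact Real.rpow_le_rpow_of_nonpos h4 h3 h0
    _ = _ := by rw [mul_assoc, show σ - 4 * s = -(4 * s - σ) by ring]

theorem integrableOn_symN_rpow {v : E3} (hv : ‖v‖ = 1) (R : ℝ) :
    IntegrableOn (fun η => symN v η ^ (-(13 / 12) : ℝ)) (Metric.closedBall 0 R) := by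
  -- `1/6 + 11/12 = 13/12`, with coordinate exponents `-2/3`, `-11/12`, `-11/12`.
  have := integrableOn_norm_rpow_mul_symN_rpow hv (σ := 0) (s := 1 / 6) (t := 11 / 12)
    (by norm_num) (by norm_num) (by norm_num) (by norm_num) (by norm_num) R
  norm_num at this
  exact this

theorem integrableOn_norm_rpow_mul_symN_neg_two {v : E3} (hv : ‖v‖ = 1) {σ : ℝ} (hσ : 3 < σ) :
    IntegrableOn (fun η => ‖η‖ ^ σ * symN v η ^ (-2 : ℝ)) (Metric.closedBall 0 1) := by
  -- On the unit ball the exponent may be lowered towards `3`. The cap `7/2` keeps `τ - 4s = (τ -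
  -- 3)/2 - 1` nonpositive, and `τ > 3` makes it larger than `-1` and `t` smaller than `1`.
  set τ := min σ (7 / 2) with hτ
  have h3 : 3 < τ := lt_min hσ (by norm_num)
  have h4 : τ ≤ 7 / 2 := min_le_right _ _
  have h5 : τ ≤ σ := min_le_left _ _
  have := integrableOn_norm_rpow_mul_symN_rpow hv (σ := τ) (s := 1 + (τ - 3) / 8)
    (t := 1 - (τ - 3) / 8) (by linarith) (by linarith) (by linarith) (by linarith) (by linarith) 1
  rw [show -(1 + (τ - 3) / 8 + (1 - (τ - 3) / 8)) = (-2 : ℝ) by ring] at this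
  refine this.mono' (by
    apply Measurable.aestronglyMeasurable
    have := (continuous_symN v).measurable
    fun_prop) ?_
  filter_upwards [ae_restrict_mem Metric.isClosed_closedBall.measurableSet] with η hη
  have hη1 : ‖η‖ ≤ 1 := by simpa using hη
  have hN := symN_nonneg hv.le η
  rw [Real.norm_of_nonneg (by positivity)]
  gcongr ?_ * _
  rcases eq_or_ne η 0 with rfl | h0
  · rw [norm_zero, Real.zero_rpow (by linarith), Real.zero_rpow (by linarith)]
  · exact Real.rpow_le_rpow_of_exponent_ge (norm_pos_iff.2 h0) hη1 h5

theorem memLp_one_add_norm_rpow_neg_two : MemLp (fun x : E3 => (1 + ‖x‖) ^ (-2 : ℝ)) 2 := by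
  rw [memLp_two_iff_integrable_sq (by
    apply Measurable.aestronglyMeasurable; fun_prop)]
  have := integrable_one_add_norm (E := E3) (μ := volume) (r := 4) (by simp; norm_num)
  refine this.congr (Eventually.of_forall fun x => ?_)
  simp only
  rw [← Real.rpow_natCast, ← Real.rpow_mul (by positivity)]
  norm_num

/-! ### Real and imaginary parts of the profile equation. -/

theorem dist_add_apply (u w : 𝓢'(E3, ℂ)) (φ : 𝓢(E3, ℂ)) : (u + w) φ = u φ + w φ := rfl

theorem dist_sub_apply (u w : 𝓢'(E3, ℂ)) (φ : 𝓢(E3, ℂ)) : (u - w) φ = u φ - w φ := rfl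

theorem dist_neg_apply (u : 𝓢'(E3, ℂ)) (φ : 𝓢(E3, ℂ)) : (-u) φ = -u φ := rfl

theorem dist_smul_apply (c : ℂ) (u : 𝓢'(E3, ℂ)) (φ : 𝓢(E3, ℂ)) : (c • u) φ = c * u φ := rfl

theorem conjTest_conjTest (φ : 𝓢(E3, ℂ)) : conjTest (conjTest φ) = φ := by
  ext x; simp [conjTest_apply]

theorem conjTest_lineDeriv (m : E3) (φ : 𝓢(E3, ℂ)) :
    conjTest (∂_{m} φ) = ∂_{m} (conjTest φ) := by
  ext x
  rw [conjTest_apply, SchwartzMap.lineDerivOp_apply_eq_fderiv,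
    SchwartzMap.lineDerivOp_apply_eq_fderiv]
  have h : HasFDerivAt (conjTest φ) ((Complex.conjCLE : ℂ →L[ℝ] ℂ).comp (fderiv ℝ φ x)) x :=
    (Complex.conjCLE : ℂ →L[ℝ] ℂ).hasFDerivAt.comp x (φ.hasFDerivAt x)
  rw [h.fderiv]
  rfl

theorem conjTest_laplacian (φ : 𝓢(E3, ℂ)) : conjTest (Δ φ) = Δ (conjTest φ) := by
  simp only [SchwartzMap.laplacian_eq_sum (stdOrthonormalBasis ℝ E3), map_sum, conjTest_lineDeriv]

theorem lineDeriv_laplacian_comm (m : E3) (φ : 𝓢(E3, ℂ)) : ∂_{m} (Δ φ) = Δ (∂_{m} φ) := by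
  simp only [SchwartzMap.laplacian_eq_sum (stdOrthonormalBasis ℝ E3), LineDeriv.lineDerivOp_sum,
    lineDeriv_comm m]

theorem dist_lineDeriv_laplacian_comm (m : E3) (u : 𝓢'(E3, ℂ)) :
    ∂_{m} (Δ u) = Δ (∂_{m} u) := by
  ext φ
  rw [TemperedDistribution.lineDerivOp_apply_apply, TemperedDistribution.laplacian_apply_apply,
    TemperedDistribution.laplacian_apply_apply, TemperedDistribution.lineDerivOp_apply_apply]
  have : Δ (-(∂_{m} φ)) = -Δ (∂_{m} φ) := by
    rw [← SchwartzMap.laplacianCLM_eq', ← SchwartzMap.laplacianCLM_eq', map_neg]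
  rw [this, lineDeriv_laplacian_comm]

theorem conjDist_add (u w : 𝓢'(E3, ℂ)) : conjDist (u + w) = conjDist u + conjDist w := by
  ext φ
  show (starRingEnd ℂ) (u _ + w _) = (starRingEnd ℂ) (u _) + (starRingEnd ℂ) (w _)
  rw [map_add]

theorem conjDist_smul (c : ℂ) (u : 𝓢'(E3, ℂ)) :
    conjDist (c • u) = (starRingEnd ℂ) c • conjDist u := by
  ext φ
  show (starRingEnd ℂ) (c * u _) = (starRingEnd ℂ) c * (starRingEnd ℂ) (u _)
  rw [map_mul]

theorem conjDist_neg (u : 𝓢'(E3, ℂ)) : conjDist (-u) = -conjDist u := by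
  ext φ
  show (starRingEnd ℂ) (-u _) = -(starRingEnd ℂ) (u _)
  rw [map_neg]

theorem conjDist_conjDist (u : 𝓢'(E3, ℂ)) : conjDist (conjDist u) = u := by
  ext φ
  rw [conjDist_apply, conjDist_apply, conjTest_conjTest, Complex.conj_conj]

theorem conjDist_lineDeriv (m : E3) (u : 𝓢'(E3, ℂ)) :
    conjDist (∂_{m} u) = ∂_{m} (conjDist u) := by
  ext φ
  rw [conjDist_apply, TemperedDistribution.lineDerivOp_apply_apply,
    TemperedDistribution.lineDerivOp_apply_apply, conjDist_apply,
    show conjTest (-∂_{m} φ) = -conjTest (∂_{m} φ) from map_neg _ _, conjTest_lineDeriv]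

theorem conjDist_laplacian (u : 𝓢'(E3, ℂ)) : conjDist (Δ u) = Δ (conjDist u) := by
  ext φ
  rw [conjDist_apply, TemperedDistribution.laplacian_apply_apply,
    TemperedDistribution.laplacian_apply_apply, conjDist_apply, conjTest_laplacian]

theorem Represents.conjDist_eq_self_of_real {f : E3 → ℝ} {u : 𝓢'(E3, ℂ)}
    (h : Represents (fun x => (f x : ℂ)) u) : conjDist u = u := by
  ext φ
  rw [conjDist_apply, (h _).2, (h φ).2, ← integral_conj]
  simp [conjTest_apply]

theorem reDist_add_imDist (u : 𝓢'(E3, ℂ)) : reDist u + Complex.I • imDist u = u := by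
  ext φ
  simp only [reDist, imDist, dist_add_apply, dist_sub_apply, dist_smul_apply]
  field_simp
  ring

theorem conjDist_reDist (u : 𝓢'(E3, ℂ)) : conjDist (reDist u) = reDist u := by
  unfold reDist
  rw [conjDist_smul, conjDist_add, conjDist_conjDist, add_comm (conjDist u)]
  congr 1
  rw [map_div₀, map_one, Complex.conj_ofNat]

theorem conjDist_imDist (u : 𝓢'(E3, ℂ)) : conjDist (imDist u) = imDist u := by
  unfold imDist
  rw [conjDist_smul, sub_eq_add_neg, conjDist_add, conjDist_neg, conjDist_conjDist,
    show (starRingEnd ℂ) (1 / (2 * Complex.I)) = -(1 / (2 * Complex.I)) by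
      rw [map_div₀, map_one, map_mul, Complex.conj_ofNat, Complex.conj_I]; ring]
  ext φ
  simp only [dist_add_apply, dist_smul_apply, dist_neg_apply]
  ring

section RealParts

variable {R S : 𝓢'(E3, ℂ)}

theorem conjDist_add_smul_I (hR : conjDist R = R) (hS : conjDist S = S) :
    conjDist (R + Complex.I • S) = R - Complex.I • S := by
  rw [conjDist_add, conjDist_smul, hR, hS, Complex.conj_I]
  ext φ
  simp only [dist_add_apply, dist_sub_apply, dist_smul_apply]
  ring

theorem reDist_add_smul_I (hR : conjDist R = R) (hS : conjDist S = S) :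
    reDist (R + Complex.I • S) = R := by
  ext φ
  simp only [reDist, conjDist_add_smul_I hR hS, dist_add_apply, dist_sub_apply, dist_smul_apply]
  ring

theorem imDist_add_smul_I (hR : conjDist R = R) (hS : conjDist S = S) :
    imDist (R + Complex.I • S) = S := by
  ext φ
  simp only [imDist, conjDist_add_smul_I hR hS, dist_add_apply, dist_sub_apply, dist_smul_apply]
  field_simp
  ring

theorem add_smul_I_inj {R' S' : 𝓢'(E3, ℂ)} (hR : conjDist R = R) (hS : conjDist S = S)
    (hR' : conjDist R' = R') (hS' : conjDist S' = S') :
    R + Complex.I • S = R' + Complex.I • S' ↔ R = R' ∧ S = S' := by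
  constructor
  · intro h
    refine ⟨?_, ?_⟩
    · rw [← reDist_add_smul_I hR hS, h, reDist_add_smul_I hR' hS']
    · rw [← imDist_add_smul_I hR hS, h, imDist_add_smul_I hR' hS']
  · rintro ⟨rfl, rfl⟩; rfl

theorem laplacian_add_smul (c : ℂ) : Δ (R + c • S) = Δ R + c • Δ S := by
  rw [← TemperedDistribution.laplacianCLM_apply, map_add, map_smul]
  simp only [TemperedDistribution.laplacianCLM_apply]

/-- The term `Re β` makes the equation only real-linear, so it is split into a real system before
the Fourier transform is taken. -/
theorem fieldEq_iff {W : 𝓢'(E3, ℂ)} {v : E3} (hW : conjDist W = W) (hR : conjDist R = R)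
    (hS : conjDist S = S) :
    -Complex.I • ∂_{v} (R + Complex.I • S) =
      -Δ (R + Complex.I • S) + reDist (R + Complex.I • S) + W ↔
    ∂_{v} S = -Δ R + R + W ∧ ∂_{v} R = Δ S := by
  have e1 : -Complex.I • ∂_{v} (R + Complex.I • S) = ∂_{v} S + Complex.I • (-∂_{v} R) := by
    rw [LineDeriv.lineDerivOp_add, LineDeriv.lineDerivOp_smul, smul_add, smul_smul, neg_mul,
      Complex.I_mul_I, neg_neg, one_smul, neg_smul, smul_neg, add_comm]
  have e2 : -Δ (R + Complex.I • S) + reDist (R + Complex.I • S) + W =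
      (-Δ R + R + W) + Complex.I • (-Δ S) := by
    rw [reDist_add_smul_I hR hS, laplacian_add_smul, smul_neg]
    abel
  rw [e1, e2, add_smul_I_inj, neg_inj]
  · rw [conjDist_lineDeriv, hS]
  · rw [conjDist_neg, conjDist_lineDeriv, hR]
  · rw [conjDist_add, conjDist_add, conjDist_neg, conjDist_laplacian, hR, hW]
  · rw [conjDist_neg, conjDist_laplacian, hS]

end RealParts

theorem fourier_inj {u w : 𝓢'(E3, ℂ)} (h : 𝓕 u = 𝓕 w) : u = w := by
  have := congrArg (fun w : 𝓢'(E3, ℂ) => 𝓕⁻ w) h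
  simpa using this

theorem Represents.neg {g : E3 → ℂ} {u : 𝓢'(E3, ℂ)} (hg : Represents g u) :
    Represents (fun x => -g x) (-u) := by
  have e : -u = (-1 : ℂ) • u := by
    ext φ
    simp only [dist_smul_apply, dist_neg_apply]
    ring
  rw [e]
  simpa using hg.smul (-1)

theorem fourier_neg' (u : 𝓢'(E3, ℂ)) : 𝓕 (-u) = -𝓕 u := map_neg (fourierCLM ℂ 𝓢'(E3, ℂ)) u

theorem fourier_add' (u w : 𝓢'(E3, ℂ)) : 𝓕 (u + w) = 𝓕 u + 𝓕 w :=
  map_add (fourierCLM ℂ 𝓢'(E3, ℂ)) u w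

theorem inner_two_pi_smul (v ξ : E3) :
    inner ℝ v ((2 * Real.pi) • ξ) = 2 * Real.pi * inner ℝ ξ v := by
  rw [inner_smul_right, real_inner_comm]

theorem norm_two_pi_smul (ξ : E3) : ‖(2 * Real.pi) • ξ‖ = 2 * Real.pi * ‖ξ‖ := by
  rw [norm_smul, Real.norm_of_nonneg (by positivity)]

theorem symN_two_pi_smul (v ξ : E3) : symN v ((2 * Real.pi) • ξ) =
    (2 * Real.pi * ‖ξ‖) ^ 2 + (2 * Real.pi * ‖ξ‖) ^ 4 - (2 * Real.pi * inner ℝ ξ v) ^ 2 := by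
  rw [symN, norm_two_pi_smul, inner_two_pi_smul]

/-- The real part of a solution of the profile equation satisfies a scalar equation of fourth
order, which the Fourier transform turns into an algebraic one. -/
theorem symN_mul_fourier_re_ae_eq {W R S : 𝓢'(E3, ℂ)} {v : E3} {w r : E3 → ℂ}
    (h1 : ∂_{v} S = -Δ R + R + W) (h2 : ∂_{v} R = Δ S) (hw : Represents w (𝓕 W))
    (hr : Represents r (𝓕 R)) :
    ∀ᵐ ξ, (symN v ((2 * Real.pi) • ξ) : ℂ) * r ξ =
      -((((2 * Real.pi * ‖ξ‖) ^ 2 : ℝ)) : ℂ) * w ξ := by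
  have h3 : ∂_{v} (∂_{v} R) = -Δ (Δ R) + Δ R + Δ W := by
    rw [h2, dist_lineDeriv_laplacian_comm, h1]
    simp only [← TemperedDistribution.laplacianCLM_apply, map_add, map_neg]
  have h4 := (hr.fourier_lineDeriv v).fourier_lineDeriv v
  rw [h3, fourier_add', fourier_add', fourier_neg'] at h4
  have h5 := (hr.fourier_laplacian.fourier_laplacian.neg.add hr.fourier_laplacian).add
    hw.fourier_laplacian
  filter_upwards [h4.ae_eq h5] with ξ hξ
  rw [symN_two_pi_smul]
  push_cast at hξ ⊢
  linear_combination hξ - 4 * (Real.pi : ℂ) ^ 2 * (inner ℝ ξ v : ℂ) ^ 2 * r ξ * Complex.I_sq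

theorem fourier_im_ae_eq {R S : 𝓢'(E3, ℂ)} {v : E3} {r s : E3 → ℂ}
    (h2 : ∂_{v} R = Δ S) (hr : Represents r (𝓕 R)) (hs : Represents s (𝓕 S)) :
    ∀ᵐ ξ, ((((2 * Real.pi * ‖ξ‖) ^ 2 : ℝ)) : ℂ) * s ξ =
      -(Complex.I * ((inner ℝ v ((2 * Real.pi) • ξ) : ℝ) : ℂ) * r ξ) := by
  have h4 := hr.fourier_lineDeriv v
  rw [h2] at h4
  filter_upwards [h4.ae_eq hs.fourier_laplacian] with ξ hξ
  rw [inner_two_pi_smul]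
  push_cast at hξ ⊢
  linear_combination hξ

/-! ### The two multipliers at low and high frequency. -/

/-- The multiplier `|η|² / (|η|² + |η|⁴ - (v · η)²)`. -/
noncomputable def mRe (v η : E3) : ℝ := ‖η‖ ^ 2 / symN v η

/-- The multiplier `(v · η) / (|η|² + |η|⁴ - (v · η)²)`. -/
noncomputable def mIm (v η : E3) : ℝ := inner ℝ v η / symN v η

/-- `∫_{|η| ≤ 1} |η|^{2a} m² < ∞` for all `a > a₀`. -/
def SmallBound (m : E3 → ℝ) (a₀ : ℝ) : Prop :=
  ∀ a, a₀ < a → IntegrableOn (fun η => ‖η‖ ^ (2 * a) * m η ^ 2) (Metric.closedBall 0 1)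

@[fun_prop]
theorem measurable_symN (v : E3) : Measurable (symN v) := (continuous_symN v).measurable

theorem continuous_inner_left' (v : E3) : Continuous (fun η : E3 => inner ℝ v η) := by fun_prop

@[fun_prop]
theorem measurable_mRe (v : E3) : Measurable (mRe v) := by unfold mRe; fun_prop

@[fun_prop]
theorem measurable_mIm (v : E3) : Measurable (mIm v) :=
  (continuous_inner_left' v).measurable.div (measurable_symN v)

theorem mRe_neg (v η : E3) : mRe v (-η) = mRe v η := by simp [mRe, symN]

theorem mIm_neg (v η : E3) : mIm v (-η) = -mIm v η := by simp [mIm, symN, neg_div]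

theorem norm_sq_mul_abs_mRe_le {v : E3} (hv : ‖v‖ ≤ 1) (η : E3) : ‖η‖ ^ 2 * |mRe v η| ≤ 1 := by
  rcases eq_or_ne η 0 with rfl | h0
  · simp
  have hN := symN_pos hv h0
  rw [mRe, abs_of_nonneg (by positivity), ← mul_div_assoc, div_le_one hN, ← pow_add]
  exact norm_pow_four_le_symN hv η

theorem abs_inner_le {v : E3} (hv : ‖v‖ ≤ 1) (η : E3) : |inner ℝ v η| ≤ ‖η‖ :=
  (abs_real_inner_le_norm v η).trans (mul_le_of_le_one_left (norm_nonneg _) hv)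

theorem norm_cube_mul_abs_mIm_le {v : E3} (hv : ‖v‖ ≤ 1) (η : E3) : ‖η‖ ^ 3 * |mIm v η| ≤ 1 := by
  rcases eq_or_ne η 0 with rfl | h0
  · simp
  have hN := symN_pos hv h0
  rw [mIm, abs_div, abs_of_pos hN, ← mul_div_assoc, div_le_one hN]
  calc ‖η‖ ^ 3 * |inner ℝ v η| ≤ ‖η‖ ^ 3 * ‖η‖ := by gcongr; exact abs_inner_le hv η
    _ = ‖η‖ ^ 4 := by ring
    _ ≤ _ := norm_pow_four_le_symN hv η

theorem norm_sq_mul_abs_mIm_le {v : E3} (hv : ‖v‖ ≤ 1) {η : E3} (hη : 1 ≤ ‖η‖) :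
    ‖η‖ ^ 2 * |mIm v η| ≤ 1 := by
  refine le_trans ?_ (norm_cube_mul_abs_mIm_le hv η)
  gcongr
  · norm_num

theorem abs_mRe_le {v : E3} (hv : ‖v‖ < 1) (η : E3) : |mRe v η| ≤ (1 - ‖v‖ ^ 2)⁻¹ := by
  have hv' : 0 < 1 - ‖v‖ ^ 2 := by nlinarith [norm_nonneg v]
  rcases eq_or_ne η 0 with rfl | h0
  · simp [mRe, hv'.le]
  have hN := symN_pos hv.le h0
  rw [mRe, abs_of_nonneg (by positivity), div_le_iff₀ hN, inv_mul_eq_div, le_div_iff₀ hv']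
  refine le_trans ?_ (le_symN v η)
  rw [mul_comm]
  gcongr
  linarith [pow_nonneg (norm_nonneg η) 4]

theorem norm_mul_abs_mIm_le {v : E3} (hv : ‖v‖ < 1) (η : E3) :
    ‖η‖ * |mIm v η| ≤ (1 - ‖v‖ ^ 2)⁻¹ := by
  refine le_trans ?_ (abs_mRe_le hv η)
  rw [mIm, mRe, abs_div, abs_div, ← mul_div_assoc, abs_of_nonneg (sq_nonneg ‖η‖)]
  gcongr
  rw [sq]
  gcongr
  exact abs_inner_le hv.le η

theorem smallBound_mRe_of_lt {v : E3} (hv : ‖v‖ < 1) : SmallBound (mRe v) (-(3 / 2)) := by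
  intro a ha
  have h := (integrableOn_norm_rpow (s := -(2 * a)) (by linarith) 1).mul_const
    ((1 - ‖v‖ ^ 2)⁻¹ ^ 2)
  refine h.mono' (Measurable.aestronglyMeasurable (by fun_prop))
    (Eventually.of_forall fun η => ?_)
  rw [Real.norm_of_nonneg (by positivity), neg_neg, ← sq_abs (mRe v η)]
  gcongr
  exact abs_mRe_le hv η

theorem smallBound_mIm_of_lt {v : E3} (hv : ‖v‖ < 1) : SmallBound (mIm v) (-(1 / 2)) := by
  intro a ha
  have h := (integrableOn_norm_rpow (s := -(2 * a - 2)) (by linarith) 1).mul_const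
    ((1 - ‖v‖ ^ 2)⁻¹ ^ 2)
  refine h.mono' (Measurable.aestronglyMeasurable (by fun_prop))
    (Eventually.of_forall fun η => ?_)
  rcases eq_or_ne η 0 with rfl | h0
  · simp only [mIm, inner_zero_right, zero_div]
    norm_num
    positivity
  have h0' := norm_pos_iff.2 h0
  rw [Real.norm_of_nonneg (by positivity), neg_neg, ← sq_abs (mIm v η)]
  calc ‖η‖ ^ (2 * a) * |mIm v η| ^ 2 = ‖η‖ ^ (2 * a - 2) * (‖η‖ * |mIm v η|) ^ 2 := by
        rw [mul_pow, ← mul_assoc, ← Real.rpow_natCast ‖η‖ 2, ← Real.rpow_add h0']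
        norm_num
    _ ≤ _ := by gcongr; exact norm_mul_abs_mIm_le hv η

/-- The integrand is `|η|^(2a+4) N⁻²`, so the threshold `2a + 4 > 3` is exactly `a > -1/2`. For
`mIm` the bound `|v·η| ≤ |η|` costs two powers and gives `a > 1/2`. -/
theorem smallBound_mRe_of_eq {v : E3} (hv : ‖v‖ = 1) : SmallBound (mRe v) (-(1 / 2)) := by
  intro a ha
  have h := integrableOn_norm_rpow_mul_symN_neg_two hv (σ := 2 * a + 4) (by linarith)
  refine h.congr_fun_ae (ae_restrict_of_ae ?_)
  filter_upwards [compl_mem_ae_iff.2 (measure_singleton (0 : E3))] with η hη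
  have h0' := norm_pos_iff.2 (show η ≠ 0 from hη)
  have hN := symN_pos hv.le (show η ≠ 0 from hη)
  rw [mRe, div_pow, Real.rpow_add h0', Real.rpow_neg hN.le, div_eq_mul_inv, mul_assoc, ← pow_mul]
  norm_cast

theorem smallBound_mIm_of_eq {v : E3} (hv : ‖v‖ = 1) : SmallBound (mIm v) (1 / 2) := by
  intro a ha
  have h := integrableOn_norm_rpow_mul_symN_neg_two hv (σ := 2 * a + 2) (by linarith)
  refine h.mono' (Measurable.aestronglyMeasurable (by fun_prop)) (ae_restrict_of_ae ?_)
  filter_upwards [compl_mem_ae_iff.2 (measure_singleton (0 : E3))] with η hη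
  have h0' := norm_pos_iff.2 (show η ≠ 0 from hη)
  have hN := symN_pos hv.le (show η ≠ 0 from hη)
  rw [Real.norm_of_nonneg (by positivity), mIm, div_pow, Real.rpow_add h0', Real.rpow_neg hN.le,
    div_eq_mul_inv, mul_assoc]
  norm_cast
  gcongr _ * (?_ * _)
  rw [← sq_abs]
  gcongr
  exact abs_inner_le hv.le η

/-- Arithmetic-geometric mean: `|m| ≤ |η|² m² + |η|⁻²`. The first term is the small-frequency bound
at `a = 1`, the second is locally integrable in dimension three. -/
theorem SmallBound.integrableOn {m : E3 → ℝ} {a₀ : ℝ} (h : SmallBound m a₀) (hm : Measurable m)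
    (ha : a₀ < 1) : IntegrableOn m (Metric.closedBall 0 1) := by
  refine ((h 1 ha).add (integrableOn_norm_rpow (s := 2) (by norm_num) 1)).mono'
    hm.aestronglyMeasurable (ae_restrict_of_ae ?_)
  filter_upwards [compl_mem_ae_iff.2 (measure_singleton (0 : E3))] with η hη
  have h0' := norm_pos_iff.2 (show η ≠ 0 from hη)
  simp only [Pi.add_apply, mul_one, Real.norm_eq_abs]
  rw [Real.rpow_neg h0'.le]
  norm_cast
  have h1 : (‖η‖ * |m η|) * ‖η‖⁻¹ = |m η| := by field_simp
  rw [← sq_abs (m η), ← mul_pow, ← inv_pow]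
  nlinarith [sq_nonneg (‖η‖ * |m η| - ‖η‖⁻¹), abs_nonneg (m η), sq_nonneg (‖η‖ * |m η|),
    sq_nonneg (‖η‖⁻¹)]

/-- The unit ball in the angular frequency variable. -/
def lowFreq : Set E3 := {ξ | 2 * Real.pi * ‖ξ‖ ≤ 1}

theorem measurableSet_lowFreq : MeasurableSet lowFreq :=
  (isClosed_le (by fun_prop) (by fun_prop)).measurableSet

theorem integrableOn_comp_two_pi_smul {F : E3 → ℝ}
    (hF : IntegrableOn F (Metric.closedBall 0 1)) :
    IntegrableOn (fun ξ => F ((2 * Real.pi) • ξ)) lowFreq := by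
  rw [← integrable_indicator_iff Metric.isClosed_closedBall.measurableSet] at hF
  have h := (integrable_comp_smul_iff volume ((Metric.closedBall (0 : E3) 1).indicator F)
    (R := 2 * Real.pi) (by positivity)).2 hF
  refine h.integrableOn.congr_fun (fun ξ hξ => ?_) measurableSet_lowFreq
  exact Set.indicator_of_mem (by simpa [norm_two_pi_smul] using (show 2 * Real.pi * ‖ξ‖ ≤ 1 from hξ)) F

section Multiplier

variable {m : E3 → ℝ} {w : E3 → ℂ} {A a₀ : ℝ}

theorem integrableOn_multiplier_mul (hm : Measurable m) (hs : SmallBound m a₀) (ha : a₀ < 1)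
    (hw : Continuous w) (hA : ∀ ξ, ‖w ξ‖ ≤ A) :
    IntegrableOn (fun ξ => (m ((2 * Real.pi) • ξ) : ℂ) * w ξ) lowFreq := by
  refine ((integrableOn_comp_two_pi_smul (hs.integrableOn hm ha)).norm.mul_const A).mono'
    (Measurable.aestronglyMeasurable ?_) (Eventually.of_forall fun ξ => ?_)
  · have := hw.measurable
    fun_prop
  · rw [norm_mul, Complex.norm_real]
    gcongr
    exact hA ξ

theorem one_add_norm_le_of_notMem {ξ : E3} (h : 1 ≤ 2 * Real.pi * ‖ξ‖) :
    1 + ‖ξ‖ ≤ 2 * (2 * Real.pi * ‖ξ‖) := by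
  have := Real.pi_gt_three
  nlinarith [norm_nonneg ξ]

theorem abs_multiplier_le (hl : ∀ η, 1 ≤ ‖η‖ → ‖η‖ ^ 2 * |m η| ≤ 1) {ξ : E3}
    (h : 1 ≤ 2 * Real.pi * ‖ξ‖) : |m ((2 * Real.pi) • ξ)| ≤ 4 * (1 + ‖ξ‖) ^ (-2 : ℝ) := by
  have h1 := hl ((2 * Real.pi) • ξ) (by rwa [norm_two_pi_smul])
  rw [norm_two_pi_smul] at h1
  have h2 := one_add_norm_le_of_notMem h
  rw [Real.rpow_neg (by positivity), ← div_eq_mul_inv, le_div_iff₀ (by positivity)]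
  norm_cast
  calc |m ((2 * Real.pi) • ξ)| * (1 + ‖ξ‖) ^ 2
      ≤ |m ((2 * Real.pi) • ξ)| * (2 * (2 * Real.pi * ‖ξ‖)) ^ 2 := by gcongr
    _ = 4 * ((2 * Real.pi * ‖ξ‖) ^ 2 * |m ((2 * Real.pi) • ξ)|) := by ring
    _ ≤ 4 := by linarith

/-- The product need not lie in a single Lebesgue space: it is integrable at low frequencies, and
`O(|ξ|⁻²)`, hence square integrable, at high ones. -/
theorem exists_represents_multiplier (hm : Measurable m) (hs : SmallBound m a₀) (ha : a₀ < 1)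
    (hl : ∀ η, 1 ≤ ‖η‖ → ‖η‖ ^ 2 * |m η| ≤ 1)
    (hw : Continuous w) (hA : ∀ ξ, ‖w ξ‖ ≤ A) :
    ∃ u : 𝓢'(E3, ℂ), Represents (fun ξ => (m ((2 * Real.pi) • ξ) : ℂ) * w ξ) u := by
  have hmeas : Measurable (fun ξ => (m ((2 * Real.pi) • ξ) : ℂ) * w ξ) := by
    have := hw.measurable
    fun_prop
  have h1 := (integrable_indicator_iff measurableSet_lowFreq).2
    (integrableOn_multiplier_mul hm hs ha hw hA)
  have h2 : MemLp (lowFreqᶜ.indicator fun ξ => (m ((2 * Real.pi) • ξ) : ℂ) * w ξ) 2 := by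
    refine memLp_one_add_norm_rpow_neg_two.of_le_mul (c := 4 * A)
      (hmeas.indicator measurableSet_lowFreq.compl).aestronglyMeasurable
      (Eventually.of_forall fun ξ => ?_)
    have hA0 : 0 ≤ A := (norm_nonneg _).trans (hA 0)
    by_cases hξ : ξ ∈ lowFreq
    · rw [Set.indicator_of_notMem (by simpa using hξ), norm_zero]
      positivity
    · rw [Set.indicator_of_mem (by simpa using hξ), norm_mul, Complex.norm_real,
        Real.norm_of_nonneg (r := (1 + ‖ξ‖) ^ (-2 : ℝ)) (by positivity), Real.norm_eq_abs]
      calc _ ≤ 4 * (1 + ‖ξ‖) ^ (-2 : ℝ) * A :=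
            mul_le_mul (abs_multiplier_le hl (not_le.1 hξ).le) (hA ξ) (norm_nonneg _)
              (by positivity)
        _ = _ := by ring
  obtain ⟨u, hu⟩ := exists_represents_add h1 h2
  refine ⟨u, hu.congr (Eventually.of_forall fun ξ => ?_)⟩
  exact congrFun (Set.indicator_self_add_compl lowFreq
    (fun ξ => (m ((2 * Real.pi) • ξ) : ℂ) * w ξ)) ξ

theorem integrable_weight_mul_norm_sq {b : ℝ}
    (hb : MemLp (fun ξ => (((1 + ‖ξ‖ ^ 2) ^ (b / 2) : ℝ) : ℂ) * w ξ) 2) :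
    Integrable (fun ξ : E3 => (1 + ‖ξ‖ ^ 2) ^ b * ‖w ξ‖ ^ 2) := by
  refine (hb.integrable_norm_pow (by norm_num)).congr (Eventually.of_forall fun ξ => ?_)
  simp only [norm_mul, Complex.norm_real]
  rw [mul_pow, Real.norm_of_nonneg (by positivity), ← Real.rpow_natCast, ← Real.rpow_mul (by positivity)]
  norm_num

/-- The two constants serve the two signs of `b`: the weights are comparable at high frequency, and
which direction of the comparison is needed depends on the sign. -/
theorem rpow_le_weight (b : ℝ) {ξ : E3} (h : 1 ≤ 2 * Real.pi * ‖ξ‖) :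
    (2 * Real.pi * ‖ξ‖) ^ (2 * b) ≤
      (((2 * Real.pi) ^ 2) ^ b + (1 / 2) ^ b) * (1 + ‖ξ‖ ^ 2) ^ b := by
  have hπ := Real.pi_gt_three
  have h1 : 1 ≤ (2 * Real.pi * ‖ξ‖) ^ 2 := one_le_pow₀ h
  have h0 : (2 * Real.pi * ‖ξ‖) ^ (2 * b) = ((2 * Real.pi * ‖ξ‖) ^ 2) ^ b := by
    rw [Real.rpow_mul (by positivity)]; norm_cast
  rw [h0, add_mul, ← Real.mul_rpow (by positivity) (by positivity),
    ← Real.mul_rpow (by positivity) (by positivity)]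
  rcases le_total 0 b with hb | hb
  · refine le_add_of_le_of_nonneg (Real.rpow_le_rpow (by positivity) ?_ hb) (by positivity)
    rw [mul_pow]
    gcongr
    linarith
  · refine le_add_of_nonneg_of_le (by positivity)
      (Real.rpow_le_rpow_of_nonpos (by positivity) ?_ hb)
    have h2 : ‖ξ‖ ^ 2 ≤ (2 * Real.pi * ‖ξ‖) ^ 2 :=
      pow_le_pow_left₀ (norm_nonneg _) (by nlinarith [norm_nonneg ξ]) 2
    linarith

theorem memHab_of_multiplier {u : 𝓢'(E3, ℂ)} {c : ℂ} {b a : ℝ} (hm : Measurable m)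
    (hs : SmallBound m a₀)
    (hl : ∀ η, 1 ≤ ‖η‖ → ‖η‖ ^ 2 * |m η| ≤ 1) (hw : Continuous w) (hA : ∀ ξ, ‖w ξ‖ ≤ A)
    (hb : MemLp (fun ξ => (((1 + ‖ξ‖ ^ 2) ^ (b / 2) : ℝ) : ℂ) * w ξ) 2)
    (hu : Represents (fun ξ => c * ((m ((2 * Real.pi) • ξ) : ℂ) * w ξ)) (𝓕 u)) (ha : a₀ < a) :
    MemHab a (b + 2) u := by
  have hmeas : Measurable (fun ξ => c * ((m ((2 * Real.pi) • ξ) : ℂ) * w ξ)) := by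
    have := hw.measurable
    fun_prop
  refine ⟨_, hu, ?_, ?_⟩
  · have h1 := (integrableOn_comp_two_pi_smul (hs a ha)).mul_const ((‖c‖ * A) ^ 2)
    refine h1.mono' (Measurable.aestronglyMeasurable (by fun_prop))
      (Eventually.of_forall fun ξ => ?_)
    rw [Real.norm_of_nonneg (by positivity), norm_two_pi_smul,
      mul_assoc (_ ^ (2 * a))]
    gcongr
    rw [norm_mul, norm_mul, Complex.norm_real, Real.norm_eq_abs, ← sq_abs (m _), ← mul_pow]
    refine pow_le_pow_left₀ (by positivity) ?_ 2
    calc _ = |m ((2 * Real.pi) • ξ)| * (‖c‖ * ‖w ξ‖) := by ring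
      _ ≤ _ := by gcongr; exact hA ξ
  · have h1 := ((integrable_weight_mul_norm_sq hb).const_mul
      (‖c‖ ^ 2 * (((2 * Real.pi) ^ 2) ^ b + (1 / 2) ^ b))).integrableOn
        (s := {ξ : E3 | 1 ≤ 2 * Real.pi * ‖ξ‖})
    refine h1.mono' (Measurable.aestronglyMeasurable (by fun_prop)) ?_
    filter_upwards [ae_restrict_mem
      (isClosed_le (by fun_prop) (by fun_prop) : IsClosed {ξ : E3 | 1 ≤ 2 * Real.pi * ‖ξ‖}).measurableSet]
      with ξ hξ
    have hξ : 1 ≤ 2 * Real.pi * ‖ξ‖ := hξ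
    have h2 := hl ((2 * Real.pi) • ξ) (by rwa [norm_two_pi_smul])
    rw [norm_two_pi_smul] at h2
    rw [Real.norm_of_nonneg (by positivity), norm_mul, norm_mul, Complex.norm_real,
      Real.norm_eq_abs]
    have h3 : (2 * Real.pi * ‖ξ‖) ^ (2 * (b + 2)) =
        (2 * Real.pi * ‖ξ‖) ^ (2 * b) * ((2 * Real.pi * ‖ξ‖) ^ 2) ^ 2 := by
      rw [mul_add, Real.rpow_add (by linarith), ← pow_mul]; norm_cast
    calc _ = (2 * Real.pi * ‖ξ‖) ^ (2 * b) *
          ((2 * Real.pi * ‖ξ‖) ^ 2 * |m ((2 * Real.pi) • ξ)|) ^ 2 * (‖c‖ ^ 2 * ‖w ξ‖ ^ 2) := by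
          rw [h3]; ring
      _ ≤ (((2 * Real.pi) ^ 2) ^ b + (1 / 2) ^ b) * (1 + ‖ξ‖ ^ 2) ^ b * 1 ^ 2 *
          (‖c‖ ^ 2 * ‖w ξ‖ ^ 2) := by
          gcongr
          exact rpow_le_weight b hξ
      _ = _ := by ring

end Multiplier

/-! ### Force, existence and uniqueness. -/

theorem continuous_fourier {f : E3 → ℂ} (hf : Integrable f) : Continuous (𝓕 f) :=
  VectorFourier.fourierIntegral_continuous Real.continuous_fourierChar
    (by exact continuous_inner) hf

theorem norm_fourier_le (f : E3 → ℂ) (ξ : E3) : ‖𝓕 f ξ‖ ≤ ∫ x, ‖f x‖ :=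
  VectorFourier.norm_fourierIntegral_le_integral_norm _ _ _ _ _

theorem fourier_neg_eq_conj (W : E3 → ℝ) (ξ : E3) :
    𝓕 (fun x => (W x : ℂ)) (-ξ) = (starRingEnd ℂ) (𝓕 (fun x => (W x : ℂ)) ξ) := by
  rw [Real.fourier_eq', Real.fourier_eq', ← integral_conj]
  refine integral_congr_ae (Eventually.of_forall fun x => ?_)
  simp only [smul_eq_mul, map_mul, ← Complex.exp_conj, Complex.conj_ofReal, Complex.conj_I]
  congr 2
  push_cast
  rw [inner_neg_right]
  push_cast
  ring

/-- Fourier transform of the real part of the profile. -/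
noncomputable def profileRe (v : E3) (W : E3 → ℝ) (ξ : E3) : ℂ :=
  -1 * ((mRe v ((2 * Real.pi) • ξ) : ℂ) * 𝓕 (fun x => (W x : ℂ)) ξ)

/-- Fourier transform of the imaginary part of the profile. -/
noncomputable def profileIm (v : E3) (W : E3 → ℝ) (ξ : E3) : ℂ :=
  Complex.I * ((mIm v ((2 * Real.pi) • ξ) : ℂ) * 𝓕 (fun x => (W x : ℂ)) ξ)

theorem profileRe_neg (v : E3) (W : E3 → ℝ) (ξ : E3) :
    profileRe v W (-ξ) = (starRingEnd ℂ) (profileRe v W ξ) := by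
  simp only [profileRe, smul_neg, mRe_neg, fourier_neg_eq_conj, map_mul, Complex.conj_ofReal,
    map_neg, map_one]

theorem profileIm_neg (v : E3) (W : E3 → ℝ) (ξ : E3) :
    profileIm v W (-ξ) = (starRingEnd ℂ) (profileIm v W ξ) := by
  simp only [profileIm, smul_neg, mIm_neg, fourier_neg_eq_conj, map_mul, Complex.conj_ofReal,
    Complex.conj_I]
  push_cast
  ring

section Force

variable {W : E3 → ℝ} {v : E3} {γ : 𝓢'(E3, ℂ)} {b a₀ : ℝ}

/-- At high frequency the density is `O(|ξ|⁻¹ |Ŵ|²)`, which the `H^b` norm controls precisely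
because `b ≥ -1/2`. At low frequency integrability of `mRe` and boundedness of `Ŵ` suffice. -/
theorem integrable_force_density (hW : Integrable W) (hv : ‖v‖ ≤ 1)
    (hs : SmallBound (mRe v) a₀) (ha : a₀ < 1) (hb : -(1 / 2) ≤ b)
    (hS : MemLp (fun ξ => (((1 + ‖ξ‖ ^ 2) ^ (b / 2) : ℝ) : ℂ) * 𝓕 (fun x => (W x : ℂ)) ξ) 2) :
    Integrable (fun ξ : E3 => ‖ξ‖ * |mRe v ((2 * Real.pi) • ξ)| * ‖𝓕 (fun x => (W x : ℂ)) ξ‖ ^ 2) := by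
  have hc := continuous_fourier (hW.ofReal (𝕜 := ℂ))
  have hA := norm_fourier_le (fun x => (W x : ℂ))
  set w := 𝓕 (fun x => (W x : ℂ))
  set A := ∫ x, ‖(W x : ℂ)‖
  have hA0 : 0 ≤ A := (norm_nonneg _).trans (hA 0)
  have hm : Measurable (fun ξ : E3 => ‖ξ‖ * |mRe v ((2 * Real.pi) • ξ)| * ‖w ξ‖ ^ 2) := by
    have := hc.measurable
    have h2 : Measurable fun x => mRe v ((2 * Real.pi) • x) := by fun_prop
    exact (measurable_norm.mul h2.abs).mul (this.norm.pow_const 2)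
  rw [← integrableOn_univ, ← Set.union_compl_self lowFreq]
  refine IntegrableOn.union ?_ ?_
  · have h1 := (integrableOn_comp_two_pi_smul (hs.integrableOn (measurable_mRe v) ha)).norm.mul_const
      (A ^ 2)
    refine h1.mono' hm.aestronglyMeasurable ?_
    filter_upwards [ae_restrict_mem measurableSet_lowFreq] with ξ hξ
    have hξ' : 2 * Real.pi * ‖ξ‖ ≤ 1 := hξ
    have hξ1 : ‖ξ‖ ≤ 1 := by nlinarith [Real.pi_gt_three, norm_nonneg ξ]
    rw [Real.norm_of_nonneg (by positivity), Real.norm_eq_abs]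
    gcongr
    · exact mul_le_of_le_one_left (abs_nonneg _) hξ1
    · exact hA ξ
  · have h1 := ((integrable_weight_mul_norm_sq hS).const_mul 2).integrableOn (s := lowFreqᶜ)
    refine h1.mono' hm.aestronglyMeasurable ?_
    filter_upwards [ae_restrict_mem measurableSet_lowFreq.compl] with ξ hξ
    have hξ' : 1 ≤ 2 * Real.pi * ‖ξ‖ := (not_le.1 (show ¬2 * Real.pi * ‖ξ‖ ≤ 1 from hξ)).le
    have h2 := norm_sq_mul_abs_mRe_le hv ((2 * Real.pi) • ξ)
    rw [norm_two_pi_smul] at h2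
    rw [Real.norm_of_nonneg (by positivity), ← mul_assoc]
    refine mul_le_mul_of_nonneg_right ?_ (by positivity)
    have h0 : 0 < ‖ξ‖ := by
      by_contra h
      have : ‖ξ‖ = 0 := le_antisymm (not_lt.1 h) (norm_nonneg _)
      rw [this] at hξ'; norm_num at hξ'
    have hπ := Real.pi_gt_three
    have h3 : ‖ξ‖ * |mRe v ((2 * Real.pi) • ξ)| ≤ (2 * Real.pi)⁻¹ * (2 * Real.pi * ‖ξ‖)⁻¹ := by
      rw [← mul_inv, ← one_div, le_div_iff₀ (by positivity)]
      calc _ = (2 * Real.pi * ‖ξ‖) ^ 2 * |mRe v ((2 * Real.pi) • ξ)| := by ring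
        _ ≤ 1 := h2
    have h4 : (2 * Real.pi * ‖ξ‖)⁻¹ ≤ 2 * (1 + ‖ξ‖ ^ 2) ^ b := by
      have h5 : (1 + ‖ξ‖ ^ 2) ^ (-(1 / 2) : ℝ) ≤ (1 + ‖ξ‖ ^ 2) ^ b :=
        Real.rpow_le_rpow_of_exponent_le (by nlinarith [sq_nonneg ‖ξ‖]) hb
      have h6 : (2 * (2 * Real.pi * ‖ξ‖))⁻¹ ≤ (1 + ‖ξ‖ ^ 2) ^ (-(1 / 2) : ℝ) := by
        rw [Real.rpow_neg (by positivity), ← Real.sqrt_eq_rpow]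
        refine inv_anti₀ (Real.sqrt_pos.2 (by positivity)) ?_
        rw [Real.sqrt_le_left (by positivity)]
        nlinarith [one_add_norm_le_of_notMem hξ', norm_nonneg ξ]
      have h7 : (2 * Real.pi * ‖ξ‖)⁻¹ = 2 * (2 * (2 * Real.pi * ‖ξ‖))⁻¹ := by field_simp
      rw [h7]; linarith
    have h8 : (2 * Real.pi)⁻¹ ≤ 1 := inv_le_one_of_one_le₀ (by linarith)
    calc _ ≤ (2 * Real.pi)⁻¹ * (2 * Real.pi * ‖ξ‖)⁻¹ := h3
      _ ≤ 1 * (2 * Real.pi * ‖ξ‖)⁻¹ := by gcongr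
      _ ≤ _ := by linarith

/-- The phases of the two translates cancel, so the pairing is independent of `X`; what remains is
an odd integrable function of `ξ`. -/
theorem isForce_zero_of_represents (hW : Integrable W) (hv : ‖v‖ ≤ 1)
    (hs : SmallBound (mRe v) a₀) (ha : a₀ < 1) (hb : -(1 / 2) ≤ b)
    (hS : MemLp (fun ξ => (((1 + ‖ξ‖ ^ 2) ^ (b / 2) : ℝ) : ℂ) * 𝓕 (fun x => (W x : ℂ)) ξ) 2)
    (hγ : Represents (profileRe v W) (𝓕 (reDist γ))) (X : E3) :
    IsForce (ofIntegrable W hW) X (translate X γ) 0 := by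
  intro m
  have hw := (represents_ofIntegrable W hW).fourier_of_integrable (hW.ofReal (𝕜 := ℂ))
  refine ⟨_, _, (hw.fourier_translate X).fourier_lineDeriv m, by
    rw [reDist_translate]; exact hγ.fourier_translate X, ?_⟩
  have e : ∀ ξ : E3, 2 * Real.pi * Complex.I * ((inner ℝ ξ m : ℝ) : ℂ) *
      (Complex.exp (-(2 * Real.pi * Complex.I * ((inner ℝ X ξ : ℝ) : ℂ))) *
        𝓕 (fun x => (W x : ℂ)) ξ) * (starRingEnd ℂ) (Complex.exp (-(2 * Real.pi * Complex.I *
          ((inner ℝ X ξ : ℝ) : ℂ))) * profileRe v W ξ) =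
      -(2 * Real.pi * Complex.I) * ((inner ℝ ξ m * mRe v ((2 * Real.pi) • ξ) *
        ‖𝓕 (fun x => (W x : ℂ)) ξ‖ ^ 2 : ℝ) : ℂ) := by
    intro ξ
    have h1 : Complex.exp (-(2 * Real.pi * Complex.I * ((inner ℝ X ξ : ℝ) : ℂ))) *
        (starRingEnd ℂ) (Complex.exp (-(2 * Real.pi * Complex.I * ((inner ℝ X ξ : ℝ) : ℂ)))) = 1 := by
      rw [← Complex.exp_conj, ← Complex.exp_add]
      simp only [map_neg, map_mul, Complex.conj_ofNat, Complex.conj_I, Complex.conj_ofReal]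
      rw [← Complex.exp_zero]
      congr 1
      ring
    have h2 := Complex.mul_conj' (𝓕 (fun x => (W x : ℂ)) ξ)
    simp only [profileRe, map_mul, map_neg, map_one, Complex.conj_ofReal]
    push_cast
    rw [← h2]
    linear_combination (-(2 * Real.pi * Complex.I * ((inner ℝ ξ m : ℝ) : ℂ)) *
      𝓕 (fun x => (W x : ℂ)) ξ * (starRingEnd ℂ) (𝓕 (fun x => (W x : ℂ)) ξ) *
      (mRe v ((2 * Real.pi) • ξ) : ℂ)) * h1
  simp only [e]
  have hint : Integrable (fun ξ : E3 => inner ℝ ξ m * mRe v ((2 * Real.pi) • ξ) *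
        ‖𝓕 (fun x => (W x : ℂ)) ξ‖ ^ 2) := by
    refine ((integrable_force_density hW hv hs ha hb hS).mul_const ‖m‖).mono' ?_
      (Eventually.of_forall fun ξ => ?_)
    · have h1 := (continuous_fourier (hW.ofReal (𝕜 := ℂ))).measurable
      have h2 : Measurable fun x => mRe v ((2 * Real.pi) • x) := by fun_prop
      have h3 : Continuous fun ξ : E3 => inner ℝ ξ m := by fun_prop
      exact ((h3.measurable.mul h2).mul (h1.norm.pow_const 2)).aestronglyMeasurable
    · rw [norm_mul, norm_mul, norm_pow, norm_norm, Real.norm_eq_abs, Real.norm_eq_abs]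
      calc _ ≤ (‖ξ‖ * ‖m‖) * |mRe v ((2 * Real.pi) • ξ)| * ‖𝓕 (fun x => (W x : ℂ)) ξ‖ ^ 2 := by
            gcongr; exact abs_real_inner_le_norm ξ m
        _ = _ := by ring
  refine ⟨hint.ofReal.const_mul _, ?_⟩
  rw [integral_const_mul, integral_complex_ofReal]
  have hz : ∫ ξ : E3, inner ℝ ξ m * mRe v ((2 * Real.pi) • ξ) *
        ‖𝓕 (fun x => (W x : ℂ)) ξ‖ ^ 2 = 0 := by
    have h := integral_neg_eq_self (fun ξ : E3 => inner ℝ ξ m * mRe v ((2 * Real.pi) • ξ) *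
        ‖𝓕 (fun x => (W x : ℂ)) ξ‖ ^ 2) volume
    simp only [inner_neg_left, smul_neg, mRe_neg, fourier_neg_eq_conj, RCLike.norm_conj, neg_mul,
      integral_neg] at h
    linarith
  rw [hz]
  simp

end Force

section Existence

variable {W : E3 → ℝ} {v : E3} {b r q : ℝ}

theorem symN_two_pi_smul_ne_zero (hv : ‖v‖ ≤ 1) {ξ : E3} (hξ : ξ ≠ 0) :
    (symN v ((2 * Real.pi) • ξ) : ℂ) ≠ 0 := by
  have h : (2 * Real.pi) • ξ ≠ 0 := smul_ne_zero Real.two_pi_pos.ne' hξ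
  exact Complex.ofReal_ne_zero.2 (symN_pos hv h).ne'

theorem profileRe_eq (hv : ‖v‖ ≤ 1) {ξ : E3} (hξ : ξ ≠ 0) {z : ℂ}
    (h : (symN v ((2 * Real.pi) • ξ) : ℂ) * z =
      -((((2 * Real.pi * ‖ξ‖) ^ 2 : ℝ)) : ℂ) * 𝓕 (fun x => (W x : ℂ)) ξ) :
    z = profileRe v W ξ := by
  have hN := symN_two_pi_smul_ne_zero hv hξ
  rw [profileRe, mRe, norm_two_pi_smul]
  push_cast at h ⊢
  field_simp
  linear_combination h

theorem profileIm_eq {ξ : E3} (hξ : ξ ≠ 0) {z : ℂ}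
    (h : ((((2 * Real.pi * ‖ξ‖) ^ 2 : ℝ)) : ℂ) * z =
      -(Complex.I * ((inner ℝ v ((2 * Real.pi) • ξ) : ℝ) : ℂ) * profileRe v W ξ)) :
    z = profileIm v W ξ := by
  have h2 : ((((2 * Real.pi * ‖ξ‖) ^ 2 : ℝ)) : ℂ) ≠ 0 := by
    have : 0 < ‖ξ‖ := norm_pos_iff.2 hξ
    exact_mod_cast (by positivity : (2 * Real.pi * ‖ξ‖) ^ 2 ≠ 0)
  refine mul_left_cancel₀ h2 ?_
  rw [h, profileRe, profileIm, mIm, mRe, norm_two_pi_smul]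
  push_cast
  ring

theorem fourier_eqs_of_profile (hv : ‖v‖ ≤ 1) (hW : Integrable W) {R S : 𝓢'(E3, ℂ)}
    (hR : Represents (profileRe v W) (𝓕 R)) (hS : Represents (profileIm v W) (𝓕 S)) :
    ∂_{v} S = -Δ R + R + ofIntegrable W hW ∧ ∂_{v} R = Δ S := by
  have hw := (represents_ofIntegrable W hW).fourier_of_integrable (hW.ofReal (𝕜 := ℂ))
  have key : ∀ ξ : E3, ξ ≠ 0 → (symN v ((2 * Real.pi) • ξ) : ℂ) ≠ 0 :=
    fun ξ hξ => symN_two_pi_smul_ne_zero hv hξ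
  constructor
  · refine fourier_inj ((hS.fourier_lineDeriv v).ext
      (Represents.congr (g := fun ξ => -(-((((2 * Real.pi * ‖ξ‖) ^ 2 : ℝ)) : ℂ) * profileRe v W ξ) +
        profileRe v W ξ + 𝓕 (fun x => (W x : ℂ)) ξ) ?_ ?_))
    · rw [fourier_add', fourier_add', fourier_neg']
      exact (hR.fourier_laplacian.neg.add hR).add hw
    · filter_upwards [compl_mem_ae_iff.2 (measure_singleton (0 : E3))] with ξ hξ
      have hN := key ξ hξ
      simp only [profileRe, profileIm, mRe, mIm, norm_two_pi_smul, inner_two_pi_smul]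
      have hN' := symN_two_pi_smul v ξ
      set N := symN v ((2 * Real.pi) • ξ)
      have hN2 : (N : ℂ) = (2 * Real.pi * ‖ξ‖) ^ 2 + (2 * Real.pi * ‖ξ‖) ^ 4 -
        (2 * Real.pi * inner ℝ ξ v) ^ 2 := by rw [hN']; push_cast; ring
      push_cast
      field_simp
      rw [hN2]
      linear_combination (-4 * (Real.pi : ℂ) ^ 2 * (inner ℝ ξ v : ℂ) ^ 2 *
        𝓕 (fun x => (W x : ℂ)) ξ) * Complex.I_sq
  · refine fourier_inj ((hR.fourier_lineDeriv v).ext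
      (hS.fourier_laplacian.congr (Eventually.of_forall fun ξ => ?_)))
    simp only [profileRe, profileIm, mRe, mIm, norm_two_pi_smul, inner_two_pi_smul]
    push_cast
    ring

/-- The explicit transforms are part of the conclusion because uniqueness and decay are both read
off from them. -/
theorem exists_travelingWave (hv : ‖v‖ ≤ 1) (hb : -(1 / 2) ≤ b)
    (hr : SmallBound (mRe v) r) (hr1 : r < 1) (hq : SmallBound (mIm v) q) (hq1 : q < 1)
    (hW : Integrable W) (hS : TemperedDistribution.MemSobolev b 2 (ofIntegrable W hW)) :
    ∃ γ : 𝓢'(E3, ℂ), (IsTravelingWave (ofIntegrable W hW) v γ ∧ Regular r q (b + 2) γ) ∧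
      Represents (profileRe v W) (𝓕 (reDist γ)) ∧ Represents (profileIm v W) (𝓕 (imDist γ)) := by
  have hc := continuous_fourier (hW.ofReal (𝕜 := ℂ))
  have hA := norm_fourier_le (fun x => (W x : ℂ))
  have hWr := represents_ofIntegrable W hW
  have hw := hWr.fourier_of_integrable (hW.ofReal (𝕜 := ℂ))
  have hM := memLp_of_memSobolev hw hS
  have hlr : ∀ η : E3, 1 ≤ ‖η‖ → ‖η‖ ^ 2 * |mRe v η| ≤ 1 := fun η _ => norm_sq_mul_abs_mRe_le hv η
  have hlq : ∀ η : E3, 1 ≤ ‖η‖ → ‖η‖ ^ 2 * |mIm v η| ≤ 1 := fun η h => norm_sq_mul_abs_mIm_le hv h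
  obtain ⟨u, hu⟩ := exists_represents_multiplier (measurable_mRe v) hr hr1 hlr hc hA
  obtain ⟨y, hy⟩ := exists_represents_multiplier (measurable_mIm v) hq hq1 hlq hc hA
  have hR : Represents (profileRe v W) (𝓕 (𝓕⁻ ((-1 : ℂ) • u) : 𝓢'(E3, ℂ))) := by
    rw [FourierTransform.fourier_fourierInv_eq]; exact hu.smul (-1)
  have hI : Represents (profileIm v W) (𝓕 (𝓕⁻ (Complex.I • y) : 𝓢'(E3, ℂ))) := by
    rw [FourierTransform.fourier_fourierInv_eq]; exact hy.smul Complex.I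
  set R : 𝓢'(E3, ℂ) := 𝓕⁻ ((-1 : ℂ) • u)
  set S : 𝓢'(E3, ℂ) := 𝓕⁻ (Complex.I • y)
  have hRc := hR.conjDist_eq_self (profileRe_neg v W)
  have hSc := hI.conjDist_eq_self (profileIm_neg v W)
  have e1 := reDist_add_smul_I hRc hSc
  have e2 := imDist_add_smul_I hRc hSc
  refine ⟨R + Complex.I • S, ⟨isTravelingWave_iff.2 ⟨fun t => ?_, ?_⟩, ?_, ?_⟩, ?_, ?_⟩
  · exact isForce_zero_of_represents hW hv hr hr1 hb hM (by rw [e1]; exact hR) _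
  · exact (fieldEq_iff hWr.conjDist_eq_self_of_real hRc hSc).2 (fourier_eqs_of_profile hv hW hR hI)
  · intro a ha
    rw [e1]
    exact memHab_of_multiplier (measurable_mRe v) hr hlr hc hA hM hR ha
  · intro a ha
    rw [e2]
    exact memHab_of_multiplier (measurable_mIm v) hq hlq hc hA hM hI ha
  · rwa [e1]
  · rwa [e2]

theorem profile_eqs_of_isTravelingWave (hW : Integrable W) {γ : 𝓢'(E3, ℂ)}
    (h : IsTravelingWave (ofIntegrable W hW) v γ) :
    ∂_{v} (imDist γ) = -Δ (reDist γ) + reDist γ + ofIntegrable W hW ∧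
      ∂_{v} (reDist γ) = Δ (imDist γ) := by
  have h1 := (isTravelingWave_iff.1 h).2
  rw [← reDist_add_imDist γ] at h1
  exact (fieldEq_iff (represents_ofIntegrable W hW).conjDist_eq_self_of_real (conjDist_reDist γ)
    (conjDist_imDist γ)).1 h1

/-- Regularity enters through the fact that both Fourier transforms are functions: the algebraic
equations determine them off the origin, and a part concentrated at the origin, such as an additive
imaginary constant in `γ'`, is excluded. -/
theorem eq_of_isTravelingWave (hv : ‖v‖ ≤ 1) (hW : Integrable W) {γ γ' : 𝓢'(E3, ℂ)} {s : ℝ}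
    (hre : Represents (profileRe v W) (𝓕 (reDist γ)))
    (him : Represents (profileIm v W) (𝓕 (imDist γ)))
    (h : IsTravelingWave (ofIntegrable W hW) v γ') (hreg : Regular r q s γ') : γ' = γ := by
  have hw := (represents_ofIntegrable W hW).fourier_of_integrable (hW.ofReal (𝕜 := ℂ))
  obtain ⟨h1, h2⟩ := profile_eqs_of_isTravelingWave hW h
  -- Any exponent above the threshold would do.
  obtain ⟨gr, hgr, -⟩ := hreg.1 (r + 1) (by linarith)
  obtain ⟨gi, hgi, -⟩ := hreg.2 (q + 1) (by linarith)
  have e1 : gr =ᵐ[volume] profileRe v W := by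
    filter_upwards [symN_mul_fourier_re_ae_eq h1 h2 hw hgr,
      compl_mem_ae_iff.2 (measure_singleton (0 : E3))] with ξ h3 hξ
    exact profileRe_eq hv hξ h3
  have e2 : gi =ᵐ[volume] profileIm v W := by
    filter_upwards [fourier_im_ae_eq h2 (hgr.congr e1) hgi,
      compl_mem_ae_iff.2 (measure_singleton (0 : E3))] with ξ h3 hξ
    exact profileIm_eq hξ h3
  have e3 : reDist γ' = reDist γ := fourier_inj ((hgr.congr e1).ext hre)
  have e4 : imDist γ' = imDist γ := fourier_inj ((hgi.congr e2).ext him)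
  rw [← reDist_add_imDist γ', e3, e4, reDist_add_imDist]

end Existence

/-! ### A calculus of finite differences for symbols. -/

/-- Discrete symbol estimates: `Sym h δ n A f η` bounds the `k`-th differences of `f` with step `h`
by `A δ ^ k` on the points `η, η + h, …, η + n h`, for all `k ≤ n`. -/
def Sym (h : E3) (δ : ℝ) : ℕ → ℝ → (E3 → ℝ) → E3 → Prop
  | 0, A, f, η => |f η| ≤ A
  | n + 1, A, f, η => Sym h δ n A f η ∧ Sym h δ n A f (η + h) ∧ Sym h δ n (A * δ) (fwdDiff h f) η

namespace Sym

variable {h : E3} {δ : ℝ} {n : ℕ} {A B : ℝ} {f g : E3 → ℝ} {η : E3}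

theorem mono (hδ : 0 ≤ δ) (hf : Sym h δ n A f η) (hAB : A ≤ B) : Sym h δ n B f η := by
  induction n generalizing A B f η with
  | zero => exact le_trans hf hAB
  | succ n ih => exact ⟨ih hf.1 hAB, ih hf.2.1 hAB, ih hf.2.2 (by gcongr)⟩

theorem abs_iterate_fwdDiff_le (hf : Sym h δ n A f η) {k : ℕ} (hk : k ≤ n) :
    |(fwdDiff h)^[k] f η| ≤ A * δ ^ k := by
  induction n generalizing A f η k with
  | zero =>
    obtain rfl : k = 0 := by omega
    simpa [Sym] using hf
  | succ n ih =>
    rcases k with _ | k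
    · exact ih hf.1 (Nat.zero_le _)
    · have := ih hf.2.2 (k := k) (by omega)
      rw [Function.iterate_succ_apply]
      calc _ ≤ A * δ * δ ^ k := this
        _ = _ := by ring

/-- Only the points `η + j h` matter, so identities that hold where a denominator is nonzero can be
used although they fail elsewhere. -/
theorem congr_points (hf : Sym h δ n A f η) (hfg : ∀ j ≤ n, f (η + j • h) = g (η + j • h)) :
    Sym h δ n A g η := by
  induction n generalizing A f g η with
  | zero =>
    have := hfg 0 le_rfl
    simp only [zero_smul, add_zero] at this
    simpa [Sym, ← this] using hf
  | succ n ih =>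
    refine ⟨ih hf.1 fun j hj => hfg j (by omega), ih hf.2.1 fun j hj => ?_,
      ih hf.2.2 fun j hj => ?_⟩
    · have := hfg (j + 1) (by omega)
      rwa [add_smul, one_smul, add_comm (j • h), ← add_assoc] at this
    · have h1 := hfg (j + 1) (by omega)
      rw [add_smul, one_smul, ← add_assoc] at h1
      simp only [fwdDiff, h1, hfg j (by omega)]

theorem shift (hf : Sym h δ n A f (η + h)) : Sym h δ n A (fun x => f (x + h)) η := by
  induction n generalizing A f η with
  | zero => exact hf
  | succ n ih => exact ⟨ih hf.1, ih hf.2.1, ih (f := fwdDiff h f) hf.2.2⟩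

theorem add (hf : Sym h δ n A f η) (hg : Sym h δ n B g η) :
    Sym h δ n (A + B) (fun x => f x + g x) η := by
  induction n generalizing A B f g η with
  | zero => exact (abs_add_le _ _).trans (add_le_add hf hg)
  | succ n ih =>
    refine ⟨ih hf.1 hg.1, ih hf.2.1 hg.2.1, ?_⟩
    have := ih hf.2.2 hg.2.2
    rw [← add_mul] at this
    convert this using 2 with x
    simp only [fwdDiff]; ring

theorem neg (hf : Sym h δ n A f η) : Sym h δ n A (fun x => -f x) η := by
  induction n generalizing A f η with
  | zero => simpa [Sym] using hf
  | succ n ih =>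
    refine ⟨ih hf.1, ih hf.2.1, ?_⟩
    convert ih hf.2.2 using 2 with x
    simp only [fwdDiff]; ring

/-- Discrete Leibniz rule `Δ(fg) = f(· + h) Δg + Δf · g`: two products at each order, hence the
factor `2 ^ n`. -/
theorem mul (hδ : 0 ≤ δ) (hA : 0 ≤ A) (hB : 0 ≤ B) (hf : Sym h δ n A f η)
    (hg : Sym h δ n B g η) : Sym h δ n (2 ^ n * (A * B)) (fun x => f x * g x) η := by
  induction n generalizing A B f g η with
  | zero =>
    simp only [Sym, abs_mul, pow_zero, one_mul] at *
    gcongr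
  | succ n ih =>
    have hle : 2 ^ n * (A * B) ≤ 2 ^ (n + 1) * (A * B) := by
      gcongr
      · norm_num
      · omega
    refine ⟨(ih hA hB hf.1 hg.1).mono hδ hle, (ih hA hB hf.2.1 hg.2.1).mono hδ hle, ?_⟩
    have h1 := (ih hA (mul_nonneg hB hδ) hf.2.1.shift hg.2.2).add
      (ih (mul_nonneg hA hδ) hB hf.2.2 hg.1)
    have e : 2 ^ n * (A * (B * δ)) + 2 ^ n * (A * δ * B) = 2 ^ (n + 1) * (A * B) * δ := by ring
    rw [e] at h1
    convert h1 using 2 with x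
    simp only [fwdDiff]; ring

theorem const {c : ℝ} (hδ : 0 ≤ δ) (hc : |c| ≤ A) : Sym h δ n A (fun _ => c) η := by
  induction n generalizing A c η with
  | zero => exact hc
  | succ n ih =>
    have hA : 0 ≤ A := (abs_nonneg c).trans hc
    refine ⟨ih hc, ih hc, ?_⟩
    have e : fwdDiff h (fun _ : E3 => c) = fun _ => 0 := by
      ext x; simp [fwdDiff]
    rw [e]
    exact ih (by rw [abs_zero]; positivity)

theorem inner {u : E3} (hu : ‖u‖ ≤ 1) (hδ : 0 ≤ δ) (h1 : ‖η‖ + n * ‖h‖ ≤ A) (h2 : ‖h‖ ≤ A * δ) :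
    Sym h δ n A (fun x => inner ℝ u x) η := by
  induction n generalizing η with
  | zero =>
    refine (abs_inner_le hu η).trans ?_
    simpa using h1
  | succ n ih =>
    push_cast at h1
    refine ⟨ih ?_, ih ?_, ?_⟩
    · nlinarith [norm_nonneg h]
    · nlinarith [norm_nonneg h, norm_add_le η h]
    · have e : fwdDiff h (fun x : E3 => Inner.inner ℝ u x) = fun _ => Inner.inner ℝ u h := by
        ext x; simp [fwdDiff, inner_add_right]
      rw [e]
      exact const hδ ((abs_inner_le hu h).trans h2)

/-- The constant in the reciprocal estimate `Sym.inv`. -/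
def invConst (K L : ℝ) : ℕ → ℝ
  | 0 => L
  | n + 1 => invConst K L n + 4 ^ n * K * invConst K L n ^ 2

theorem invConst_nonneg {K L : ℝ} (hK : 0 ≤ K) (hL : 0 ≤ L) (n : ℕ) : 0 ≤ invConst K L n := by
  induction n with
  | zero => exact hL
  | succ n ih => unfold invConst; positivity

/-- Induction on the identity `Δ(1/f) = -Δf · (1/f) · (1/f(· + h))`. Its two products cost `2 ^ n`
each, which is the `4 ^ n` in `invConst`. The lower bound on `|f|` is required only at the points
that the differences see. -/
theorem inv {K L w : ℝ} (hδ : 0 ≤ δ) (hK : 0 ≤ K) (hL : 0 ≤ L) (hw : 0 < w)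
    (hf : Sym h δ n (K * w) f η) (hl : ∀ j ≤ n, w ≤ L * |f (η + j • h)|) :
    Sym h δ n (invConst K L n / w) (fun x => (f x)⁻¹) η := by
  induction n generalizing η with
  | zero =>
    have h0 := hl 0 le_rfl
    simp only [zero_smul, add_zero] at h0
    have hf0 : 0 < |f η| := by
      by_contra hcon
      have : |f η| = 0 := le_antisymm (not_lt.1 hcon) (abs_nonneg _)
      rw [this] at h0; linarith
    show |(f η)⁻¹| ≤ L / w
    rw [abs_inv, inv_eq_one_div, div_le_div_iff₀ hf0 hw]
    linarith
  | succ n ih =>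
    have hB := invConst_nonneg hK hL n
    have hl' : ∀ j ≤ n, w ≤ L * |f (η + h + j • h)| := fun j hj => by
      have := hl (j + 1) (by omega)
      rwa [add_smul, one_smul, add_comm (j • h), ← add_assoc] at this
    have i1 := ih hf.1 fun j hj => hl j (by omega)
    have i2 := ih hf.2.1 hl'
    have hle : invConst K L n / w ≤ invConst K L (n + 1) / w := by
      gcongr
      rw [invConst]
      exact le_add_of_nonneg_right (by positivity)
    refine ⟨i1.mono hδ hle, i2.mono hδ hle, ?_⟩
    have hBw : 0 ≤ invConst K L n / w := by positivity
    have m1 := (mul hδ (by positivity) (by positivity) hf.2.2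
      (mul hδ hBw hBw i1 i2.shift)).neg
    refine (m1.mono hδ (B := invConst K L (n + 1) / w * δ) ?_).congr_points fun j hj => ?_
    · have e : 2 ^ n * (K * w * δ * (2 ^ n * (invConst K L n / w * (invConst K L n / w)))) =
          4 ^ n * K * invConst K L n ^ 2 / w * δ := by
        rw [show (4 : ℝ) ^ n = 2 ^ n * 2 ^ n by rw [← mul_pow]; norm_num]
        field_simp
      rw [e]
      gcongr
      rw [invConst]
      exact le_add_of_nonneg_left hB
    · have hne : ∀ j ≤ n + 1, f (η + j • h) ≠ 0 := fun j hj hz => by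
        have := hl j hj
        rw [hz, abs_zero, mul_zero] at this
        linarith
      have n1 := hne j (by omega)
      have n2 := hne (j + 1) (by omega)
      rw [add_smul, one_smul, ← add_assoc] at n2
      simp only [fwdDiff]
      field_simp
      ring

end Sym

theorem sym_norm_sq {h η : E3} {δ A : ℝ} {n : ℕ} (hδ : 0 ≤ δ) (h1 : ‖η‖ + n * ‖h‖ ≤ A)
    (h2 : ‖h‖ ≤ A * δ) : Sym h δ n (3 * 2 ^ n * A ^ 2) (fun x => ‖x‖ ^ 2) η := by
  have hA : 0 ≤ A := le_trans (by positivity) h1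
  set b := EuclideanSpace.basisFun (Fin 3) ℝ
  have hi : ∀ i, Sym h δ n (2 ^ n * (A * A))
      (fun x => inner ℝ (b i) x * inner ℝ (b i) x) η := fun i =>
    (Sym.inner (b.norm_eq_one i).le hδ h1 h2).mul hδ hA hA
      (Sym.inner (b.norm_eq_one i).le hδ h1 h2)
  have := ((hi 0).add (hi 1)).add (hi 2)
  convert this using 2 with x
  · ring
  · rw [norm_sq_eq_sum b]; ring

theorem sym_symN {v h η : E3} {δ A : ℝ} {n : ℕ} (hv : ‖v‖ ≤ 1) (hδ : 0 ≤ δ)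
    (h1 : ‖η‖ + n * ‖h‖ ≤ A) (h2 : ‖h‖ ≤ A * δ) :
    Sym h δ n (9 * 2 ^ (3 * n) * (A ^ 2 + A ^ 4)) (symN v) η := by
  have hA : 0 ≤ A := le_trans (by positivity) h1
  have s1 := sym_norm_sq hδ h1 h2
  have s2 := s1.mul hδ (by positivity) (by positivity) s1
  have s3 := (Sym.inner hv hδ h1 h2).mul hδ hA hA (Sym.inner hv hδ h1 h2)
  have s4 := (s1.add s2).add s3.neg
  have e : symN v = fun x => ‖x‖ ^ 2 + ‖x‖ ^ 2 * ‖x‖ ^ 2 + -(inner ℝ v x * inner ℝ v x) := by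
    ext x; unfold symN; ring
  rw [e]
  refine s4.mono hδ ?_
  have p1 : (1 : ℝ) ≤ 2 ^ n := one_le_pow₀ (by norm_num)
  have e8 : (2 : ℝ) ^ (3 * n) = 2 ^ n * 2 ^ n * 2 ^ n := by rw [← pow_add, ← pow_add]; congr 1; omega
  rw [e8]
  set t : ℝ := 2 ^ n
  have p2 : t ≤ t * t * t := by nlinarith [mul_nonneg (sub_nonneg.2 p1) (sub_nonneg.2 p1)]
  have hA2 : 0 ≤ A ^ 2 := by positivity
  calc _ = 4 * t * A ^ 2 + 9 * (t * t * t) * A ^ 4 := by ring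
    _ ≤ 9 * (t * t * t) * A ^ 2 + 9 * (t * t * t) * A ^ 4 := by
        gcongr
        nlinarith
    _ = _ := by ring

/-- Symbol estimates for the multipliers away from the origin. -/
theorem exists_fwdDiff_multiplier_le {L : ℝ} (hL : 0 ≤ L) :
    ∃ C, 0 ≤ C ∧ ∀ v : E3, ‖v‖ ≤ 1 → ∀ η h : E3, η ≠ 0 → 6 * ‖h‖ ≤ ‖η‖ →
      (∀ j ≤ 3, ‖η‖ ^ 2 + ‖η‖ ^ 4 ≤ L * symN v (η + j • h)) → ∀ k ≤ 3,
        |(fwdDiff h)^[k] (mRe v) η| ≤ C * (‖h‖ / ‖η‖) ^ k * (1 + ‖η‖ ^ 2)⁻¹ ∧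
        |(fwdDiff h)^[k] (mIm v) η| ≤ C * (‖h‖ / ‖η‖) ^ k * (‖η‖ * (1 + ‖η‖ ^ 2))⁻¹ := by
  -- This is `sym_symN` at `n = 3` with `A = 2|η|`; the factor `16` absorbs `(2ρ)² + (2ρ)⁴ ≤ 16 (ρ²
  -- + ρ⁴)`.
  set K : ℝ := 9 * 2 ^ 9 * 16 with hK
  have hB := Sym.invConst_nonneg (K := K) (L := L) (by norm_num [hK]) hL 3
  set B := Sym.invConst K L 3
  refine ⟨8 * (96 * B), by positivity, fun v hv η h hη h6 hl k hk => ?_⟩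
  have hη' : 0 < ‖η‖ := norm_pos_iff.2 hη
  set ρ := ‖η‖ with hρ
  have hδ : 0 ≤ ‖h‖ / ρ := by positivity
  have h1 : ‖η‖ + (3 : ℕ) * ‖h‖ ≤ 2 * ρ := by push_cast; linarith [norm_nonneg h]
  have h2 : ‖h‖ ≤ 2 * ρ * (‖h‖ / ρ) := by
    rw [mul_assoc, mul_div_cancel₀ _ hη'.ne']; linarith [norm_nonneg h]
  have hw : 0 < ρ ^ 2 + ρ ^ 4 := by positivity
  have s1 : Sym h (‖h‖ / ρ) 3 (K * (ρ ^ 2 + ρ ^ 4)) (symN v) η := by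
    refine (sym_symN hv hδ h1 h2).mono hδ ?_
    rw [hK]
    have : (2 * ρ) ^ 2 + (2 * ρ) ^ 4 ≤ 16 * (ρ ^ 2 + ρ ^ 4) := by nlinarith [sq_nonneg ρ]
    calc _ ≤ 9 * 2 ^ (3 * 3) * (16 * (ρ ^ 2 + ρ ^ 4)) := by gcongr
      _ = _ := by ring
  have s2 := s1.inv hδ (by norm_num [hK]) hL hw fun j hj =>
    (hl j hj).trans (by gcongr; exact le_abs_self _)
  have s3 := (sym_norm_sq hδ h1 h2).mul hδ (by positivity) (by positivity) s2
  have s4 := (Sym.inner hv hδ h1 h2).mul hδ (by positivity) (by positivity) s2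
  have e1 : mRe v = fun x => ‖x‖ ^ 2 * (symN v x)⁻¹ := by ext x; rw [mRe, div_eq_mul_inv]
  have e2 : mIm v = fun x => inner ℝ v x * (symN v x)⁻¹ := by ext x; rw [mIm, div_eq_mul_inv]
  rw [e1, e2]
  have hp : 0 ≤ (‖h‖ / ρ) ^ k := by positivity
  constructor
  · refine (s3.abs_iterate_fwdDiff_le hk).trans (le_of_eq ?_)
    show 2 ^ 3 * (3 * 2 ^ 3 * (2 * ρ) ^ 2 * (B / (ρ ^ 2 + ρ ^ 4))) * (‖h‖ / ρ) ^ k = _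
    have e3 : ρ ^ 2 + ρ ^ 4 = ρ ^ 2 * (1 + ρ ^ 2) := by ring
    rw [e3]
    generalize (‖h‖ / ρ) ^ k = P
    field_simp
    ring
  · refine (s4.abs_iterate_fwdDiff_le hk).trans ?_
    show 2 ^ 3 * (2 * ρ * (B / (ρ ^ 2 + ρ ^ 4))) * (‖h‖ / ρ) ^ k ≤ _
    have e3 : 2 ^ 3 * (2 * ρ * (B / (ρ ^ 2 + ρ ^ 4))) * (‖h‖ / ρ) ^ k =
        8 * (2 * B) * (‖h‖ / ρ) ^ k * (ρ * (1 + ρ ^ 2))⁻¹ := by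
      have e3 : ρ ^ 2 + ρ ^ 4 = ρ ^ 2 * (1 + ρ ^ 2) := by ring
      rw [e3]
      generalize (‖h‖ / ρ) ^ k = P
      field_simp
      ring
    rw [e3]
    gcongr
    norm_num

/-! ### Decay of Fourier transforms from third differences -/

theorem integrable_fwdDiff {g : E3 → ℂ} (hg : Integrable g) (h : E3) :
    Integrable (fwdDiff h g) := (hg.comp_add_right h).sub hg

theorem integrable_phase_smul {g : E3 → ℂ} (hg : Integrable g) {c : E3 → ℝ} (hc : Continuous c) :
    Integrable (fun ξ => Complex.exp ((c ξ : ℂ) * Complex.I) • g ξ) := by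
  have hm : Continuous (fun ξ => Complex.exp ((c ξ : ℂ) * Complex.I)) := by fun_prop
  refine (integrable_norm_iff (hm.aestronglyMeasurable.smul hg.aestronglyMeasurable)).1 ?_
  refine hg.norm.congr (ae_of_all _ fun ξ => ?_)
  show ‖g ξ‖ = ‖Complex.exp ((c ξ : ℂ) * Complex.I) • g ξ‖
  rw [norm_smul, Complex.norm_exp_ofReal_mul_I, one_mul]

/-- Shifting by `h` multiplies the phase by `exp (-iπ) = -1`, so the shifted and the original term
add up instead of cancelling. -/
theorem fourierInv_fwdDiff {g : E3 → ℂ} (hg : Integrable g) {h x : E3}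
    (hx : inner ℝ h x = (1 / 2 : ℝ)) : 𝓕⁻ (fwdDiff h g) x = (-2 : ℂ) * 𝓕⁻ g x := by
  have e1 : 𝓕⁻ (fun ξ => g (ξ + h)) x = -𝓕⁻ g x := by
    rw [Real.fourierInv_eq', Real.fourierInv_eq', ← integral_neg]
    rw [← integral_add_right_eq_self (fun ξ => -(Complex.exp (↑(2 * Real.pi * inner ℝ ξ x) * Complex.I) • g ξ)) h]
    congr 1
    ext ξ
    rw [inner_add_left, hx, ← neg_smul]
    congr 1
    have : ((2 * Real.pi * (inner ℝ ξ x + 1 / 2) : ℝ) : ℂ) * Complex.I =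
        ((2 * Real.pi * inner ℝ ξ x : ℝ) : ℂ) * Complex.I + Real.pi * Complex.I := by
      push_cast; ring
    rw [this, Complex.exp_add, Complex.exp_pi_mul_I]
    ring
  have e2 : fwdDiff h g = fun ξ => g (ξ + h) - g ξ := rfl
  have e3 : 𝓕⁻ (fwdDiff h g) x = 𝓕⁻ (fun ξ => g (ξ + h)) x - 𝓕⁻ g x := by
    rw [e2, Real.fourierInv_eq', Real.fourierInv_eq', Real.fourierInv_eq', ← integral_sub]
    · congr 1; ext ξ; rw [smul_sub]
    · exact integrable_phase_smul (hg.comp_add_right h) (by fun_prop)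
    · exact integrable_phase_smul hg (by fun_prop)
  rw [e3, e1]; ring

theorem norm_fourierInv_le (g : E3 → ℂ) (x : E3) : ‖𝓕⁻ g x‖ ≤ ∫ ξ, ‖g ξ‖ := by
  rw [Real.fourierInv_eq_fourier_neg]; exact norm_fourier_le g (-x)

theorem one_le_jb (x : E3) : 1 ≤ jb x := by
  unfold jb; exact Real.one_le_sqrt.2 (by nlinarith [sq_nonneg ‖x‖])

theorem jb_le {x : E3} {R : ℝ} (hR : 1 ≤ R) (hx : ‖x‖ ≤ R) : jb x ≤ 2 * R := by
  unfold jb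
  refine Real.sqrt_le_iff.2 ⟨by linarith, by nlinarith [norm_nonneg x]⟩

/-- For large `|x|` the step `h = x / (2|x|²)` gives `8 |𝓕⁻ g x| ≤ ‖Δ_h³ g‖₁ ≤ C |h|^κ`, and `|h|`
is comparable to `1/|x|`. Bounded `x` are covered by the `L¹` norm of `g`. -/
theorem exists_decay_of_fwdDiff {g : E3 → ℂ} (hg : Integrable g) {κ C h₀ : ℝ} (hκ : 0 ≤ κ)
    (hh : 0 < h₀) (hC : ∀ h : E3, 0 < ‖h‖ → ‖h‖ ≤ h₀ →
      ∫ ξ, ‖(fwdDiff h)^[3] g ξ‖ ≤ C * ‖h‖ ^ κ) :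
    ∃ C', ∀ x, ‖𝓕⁻ g x‖ ≤ C' * jb x ^ (-κ) := by
  set R : ℝ := max 1 (1 / (2 * h₀)) with hR
  have hR1 : 1 ≤ R := le_max_left _ _
  set I : ℝ := ∫ ξ, ‖g ξ‖
  have hI : 0 ≤ I := integral_nonneg fun _ => norm_nonneg _
  refine ⟨max (|C|) (I * (2 * R) ^ κ), fun x => ?_⟩
  have hj := one_le_jb x
  have hj0 : 0 < jb x := by linarith
  rcases le_total ‖x‖ R with hx | hx
  · have h1 := jb_le hR1 hx
    calc ‖𝓕⁻ g x‖ ≤ I := norm_fourierInv_le g x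
      _ = I * (jb x ^ κ) * jb x ^ (-κ) := by
          rw [mul_assoc, ← Real.rpow_add hj0]; simp
      _ ≤ I * (2 * R) ^ κ * jb x ^ (-κ) := by gcongr
      _ ≤ _ := by gcongr; exact le_max_right _ _
  · have hx1 : 1 ≤ ‖x‖ := hR1.trans hx
    have hx0 : 0 < ‖x‖ := by linarith
    set h : E3 := (1 / (2 * ‖x‖ ^ 2)) • x with hdef
    have hn : ‖h‖ = 1 / (2 * ‖x‖) := by
      rw [hdef, norm_smul, Real.norm_of_nonneg (by positivity)]; field_simp
    have hin : inner ℝ h x = (1 / 2 : ℝ) := by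
      rw [hdef, real_inner_smul_left, real_inner_self_eq_norm_sq]; field_simp
    have hle : ‖h‖ ≤ h₀ := by
      have := (le_max_right 1 (1 / (2 * h₀))).trans hx
      rw [hn, div_le_iff₀ (by positivity)]
      rw [div_le_iff₀ (by positivity)] at this
      linarith
    have key := hC h (by rw [hn]; positivity) hle
    have e : 𝓕⁻ ((fwdDiff h)^[3] g) x = (-8 : ℂ) * 𝓕⁻ g x := by
      have i1 := integrable_fwdDiff hg h
      have i2 := integrable_fwdDiff i1 h
      show 𝓕⁻ (fwdDiff h (fwdDiff h (fwdDiff h g))) x = _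
      rw [fourierInv_fwdDiff i2 hin, fourierInv_fwdDiff i1 hin, fourierInv_fwdDiff hg hin]
      ring
    have h3 := norm_fourierInv_le ((fwdDiff h)^[3] g) x
    rw [e, norm_mul] at h3
    have h4 : ‖(-8 : ℂ)‖ = 8 := by simp
    rw [h4] at h3
    have h5 : ‖h‖ ^ κ ≤ jb x ^ (-κ) := by
      rw [Real.rpow_neg hj0.le, ← Real.inv_rpow hj0.le]
      refine Real.rpow_le_rpow (norm_nonneg _) ?_ hκ
      rw [hn, one_div]
      exact inv_anti₀ hj0 (jb_le hx1 le_rfl)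
    have h6 : C * ‖h‖ ^ κ ≤ |C| * jb x ^ (-κ) :=
      (mul_le_mul_of_nonneg_right (le_abs_self C) (by positivity)).trans (by gcongr)
    have h7 : |C| * jb x ^ (-κ) ≤ max (|C|) (I * (2 * R) ^ κ) * jb x ^ (-κ) := by
      gcongr; exact le_max_left _ _
    linarith [norm_nonneg (𝓕⁻ g x)]

/-! ### Differences of the Fourier transform of a decaying function -/

theorem fwdDiff_fourier {f : E3 → ℂ} (hf : Integrable f) (h : E3) :
    fwdDiff h (𝓕 f) =
      𝓕 (fun x => (Complex.exp (Complex.I * ((-2 * Real.pi * inner ℝ x h : ℝ) : ℂ)) - 1) * f x) := by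
  ext ξ
  have hi : ∀ η : E3, Integrable
      (fun x => Complex.exp (((-2 * Real.pi * inner ℝ x η : ℝ) : ℂ) * Complex.I) • f x) := fun η =>
    integrable_phase_smul hf (by fun_prop)
  rw [fwdDiff, Real.fourier_eq', Real.fourier_eq', Real.fourier_eq', ← integral_sub (hi _) (hi _)]
  congr 1
  ext x
  have : ((-2 * Real.pi * inner ℝ x (ξ + h) : ℝ) : ℂ) * Complex.I =
      ((-2 * Real.pi * inner ℝ x ξ : ℝ) : ℂ) * Complex.I +
        Complex.I * ((-2 * Real.pi * inner ℝ x h : ℝ) : ℂ) := by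
    rw [inner_add_right]; push_cast; ring
  rw [this, Complex.exp_add]
  simp only [smul_eq_mul]
  ring

theorem norm_phase_sub_one_le (x h : E3) :
    ‖Complex.exp (Complex.I * ((-2 * Real.pi * inner ℝ x h : ℝ) : ℂ)) - 1‖ ≤
      2 * Real.pi * ‖h‖ * (1 + ‖x‖) := by
  refine (Real.norm_exp_I_mul_ofReal_sub_one_le).trans ?_
  have := abs_real_inner_le_norm x h
  have hp := Real.pi_pos
  rw [Real.norm_eq_abs, abs_mul, abs_mul, abs_of_pos hp]
  norm_num
  nlinarith [norm_nonneg x, norm_nonneg h, mul_nonneg hp.le (norm_nonneg h)]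

theorem iterate_fwdDiff_fourier {f : E3 → ℂ} {h : E3} (l : ℕ)
    (hl : ∀ i ≤ l, Integrable (fun x =>
      (Complex.exp (Complex.I * ((-2 * Real.pi * inner ℝ x h : ℝ) : ℂ)) - 1) ^ i * f x)) :
    (fwdDiff h)^[l] (𝓕 f) = 𝓕 (fun x =>
      (Complex.exp (Complex.I * ((-2 * Real.pi * inner ℝ x h : ℝ) : ℂ)) - 1) ^ l * f x) := by
  induction l with
  | zero => simp
  | succ l ih =>
    rw [Function.iterate_succ_apply', ih fun i hi => hl i (by omega), fwdDiff_fourier (hl l (by omega))]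
    congr 1
    ext x
    ring

/-- A difference in frequency is multiplication of `f` by `exp(-2πi x·h) - 1`, of size at most `2π
|h| (1 + |x|)`. Three differences cost the weight `(1 + |x|)³`; the sup bound comes from `L¹`, the
other from Plancherel. -/
theorem fourier_diff_bounds {f : E3 → ℂ} (h1 : Integrable (fun x => (1 + ‖x‖) ^ 3 * ‖f x‖))
    (h2 : Integrable (fun x => ((1 + ‖x‖) ^ 3 * ‖f x‖) ^ 2)) (hf : AEStronglyMeasurable f) :
    ∃ A, 0 ≤ A ∧ ∀ h : E3, ∀ l ≤ 3,
      (∀ ξ, ‖(fwdDiff h)^[l] (𝓕 f) ξ‖ ≤ A * ‖h‖ ^ l) ∧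
      Integrable (fun ξ => ‖(fwdDiff h)^[l] (𝓕 f) ξ‖ ^ 2) ∧
      ∫ ξ, ‖(fwdDiff h)^[l] (𝓕 f) ξ‖ ^ 2 ≤ A * (‖h‖ ^ l) ^ 2 := by
  set I₁ := ∫ x, (1 + ‖x‖) ^ 3 * ‖f x‖
  set I₂ := ∫ x, ((1 + ‖x‖) ^ 3 * ‖f x‖) ^ 2
  have hI1 : 0 ≤ I₁ := integral_nonneg fun _ => by positivity
  have hI2 : 0 ≤ I₂ := integral_nonneg fun _ => by positivity
  have hp := Real.two_pi_pos
  have hp1 : 1 ≤ 2 * Real.pi := by linarith [Real.pi_gt_three]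
  -- The power `6` covers both `(2π)^l` and its square for `l ≤ 3`.
  refine ⟨(2 * Real.pi) ^ 6 * (I₁ + I₂), by positivity, fun h l hl => ?_⟩
  set F : ℕ → E3 → ℂ := fun i x =>
      (Complex.exp (Complex.I * ((-2 * Real.pi * inner ℝ x h : ℝ) : ℂ)) - 1) ^ i * f x with hF
  have hm : ∀ i, AEStronglyMeasurable (F i) := fun i =>
    (Continuous.aestronglyMeasurable (by fun_prop)).mul hf
  have hb : ∀ i ≤ 3, ∀ x, ‖F i x‖ ≤ (2 * Real.pi * ‖h‖) ^ i * ((1 + ‖x‖) ^ 3 * ‖f x‖) := by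
    intro i hi x
    simp only [hF]
    rw [norm_mul, norm_pow, ← mul_assoc]
    gcongr
    calc _ ≤ (2 * Real.pi * ‖h‖ * (1 + ‖x‖)) ^ i := by gcongr; exact norm_phase_sub_one_le x h
      _ = (2 * Real.pi * ‖h‖) ^ i * (1 + ‖x‖) ^ i := mul_pow _ _ _
      _ ≤ _ := by gcongr; linarith [norm_nonneg x]
  have hi : ∀ i ≤ 3, Integrable (F i) := fun i hi' =>
    Integrable.mono' (h1.const_mul _) (hm i) (ae_of_all _ (hb i hi'))
  rw [iterate_fwdDiff_fourier l fun i hil => hi i (by omega)]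
  have hle : (2 * Real.pi) ^ l ≤ (2 * Real.pi) ^ 6 := by exact pow_le_pow_right₀ hp1 (by omega)
  have hle2 : ((2 * Real.pi) ^ l) ^ 2 ≤ (2 * Real.pi) ^ 6 := by
    rw [← pow_mul]; exact pow_le_pow_right₀ hp1 (by omega)
  have hL2 : MemLp (F l) 2 := by
    refine (memLp_two_iff_integrable_sq_norm (hm l)).2 ?_
    refine Integrable.mono' (h2.const_mul (((2 * Real.pi * ‖h‖) ^ l) ^ 2)) ((hm l).norm.pow 2)
      (ae_of_all _ fun x => ?_)
    rw [Real.norm_of_nonneg (by positivity), ← mul_pow]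
    have := hb l hl x
    gcongr
  obtain ⟨hP1, hP2⟩ := memLp_fourier_of_memLp (hi l hl) hL2
  have hint : ∫ ξ, ‖𝓕 (F l) ξ‖ ^ 2 = ∫ x, ‖F l x‖ ^ 2 := by
    have e1 := hP1.eLpNorm_eq_integral_rpow_norm (by norm_num) (by norm_num)
    have e2 := hL2.eLpNorm_eq_integral_rpow_norm (by norm_num) (by norm_num)
    rw [e1, e2, ENNReal.ofReal_eq_ofReal_iff (by positivity) (by positivity)] at hP2
    simp only [ENNReal.toReal_ofNat, Real.rpow_ofNat] at hP2
    exact (Real.rpow_left_inj (by positivity) (by positivity) (by norm_num)).1 hP2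
  refine ⟨fun ξ => ?_, (memLp_two_iff_integrable_sq_norm hP1.aestronglyMeasurable).1 hP1, ?_⟩
  · calc _ ≤ ∫ x, ‖F l x‖ := norm_fourier_le _ ξ
      _ ≤ ∫ x, (2 * Real.pi * ‖h‖) ^ l * ((1 + ‖x‖) ^ 3 * ‖f x‖) :=
          integral_mono (hi l hl).norm (h1.const_mul _) (hb l hl)
      _ = (2 * Real.pi) ^ l * I₁ * ‖h‖ ^ l := by rw [integral_const_mul, mul_pow]; ring
      _ ≤ _ := by gcongr; linarith
  · show ∫ ξ, ‖𝓕 (F l) ξ‖ ^ 2 ≤ _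
    rw [hint]
    calc _ ≤ ∫ x, ((2 * Real.pi * ‖h‖) ^ l) ^ 2 * ((1 + ‖x‖) ^ 3 * ‖f x‖) ^ 2 := by
          refine integral_mono_of_nonneg (ae_of_all _ fun _ => by positivity) (h2.const_mul _)
            (ae_of_all _ fun x => ?_)
          show ‖F l x‖ ^ 2 ≤ ((2 * Real.pi * ‖h‖) ^ l) ^ 2 * ((1 + ‖x‖) ^ 3 * ‖f x‖) ^ 2
          rw [← mul_pow]
          exact pow_le_pow_left₀ (norm_nonneg _) (hb l hl x) 2
      _ = ((2 * Real.pi) ^ l) ^ 2 * I₂ * (‖h‖ ^ l) ^ 2 := by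
          rw [integral_const_mul, mul_pow]; ring
      _ ≤ _ := by gcongr; linarith

theorem weighted_of_fastDecaying {W : E3 → ℝ} (hW : Integrable W) (hd : FastDecaying W) :
    Integrable (fun x => (1 + ‖x‖) ^ 3 * ‖(W x : ℂ)‖) ∧
    Integrable (fun x => ((1 + ‖x‖) ^ 3 * ‖(W x : ℂ)‖) ^ 2) := by
  have hj : ∀ x : E3, (1 + ‖x‖) ^ 2 ≤ 2 * jb x ^ 2 := fun x => by
    rw [jb, Real.sq_sqrt (by positivity)]; nlinarith [sq_nonneg (1 - ‖x‖)]
  have hm : AEStronglyMeasurable (fun x => (1 + ‖x‖) ^ 3 * ‖(W x : ℂ)‖) :=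
    (Continuous.aestronglyMeasurable (by fun_prop)).mul
      (Complex.continuous_ofReal.comp_aestronglyMeasurable hW.aestronglyMeasurable).norm
  have hb : ∀ x, (1 + ‖x‖) ^ 5 * ‖(W x : ℂ)‖ ≤ 8 * ‖jb x ^ 6 * W x‖ := fun x => by
    have h1 := one_le_jb x
    rw [Complex.norm_real, norm_mul, Real.norm_of_nonneg (r := jb x ^ 6) (by positivity), ← mul_assoc]
    gcongr
    calc (1 + ‖x‖) ^ 5 ≤ (1 + ‖x‖) ^ 6 := pow_le_pow_right₀ (by linarith [norm_nonneg x]) (by norm_num)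
      _ = ((1 + ‖x‖) ^ 2) ^ 3 := by ring
      _ ≤ (2 * jb x ^ 2) ^ 3 := by gcongr; exact hj x
      _ = _ := by ring
  have hL : MemLp (fun x => (1 + ‖x‖) ^ 3 * ‖(W x : ℂ)‖) 2 := by
    refine (hd.const_mul 8).mono hm (ae_of_all _ fun x => ?_)
    rw [Real.norm_of_nonneg (by positivity), norm_mul, Real.norm_ofNat]
    refine le_trans ?_ (hb x)
    gcongr
    · linarith [norm_nonneg x]
    · norm_num
  refine ⟨?_, (memLp_two_iff_integrable_sq hm).1 hL⟩
  -- Cauchy–Schwarz: five powers of the weight stay in `L²`, and `(1 + |x|)⁻²` is square integrable,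
  -- which leaves three powers for the `L¹` bound.
  have hprod := memLp_one_add_norm_rpow_neg_two.integrable_mul (hd.norm.const_mul 8) 
  refine Integrable.mono' hprod hm (ae_of_all _ fun x => ?_)
  rw [Real.norm_of_nonneg (by positivity)]
  have h0 : 0 < 1 + ‖x‖ := by positivity
  show _ ≤ (1 + ‖x‖) ^ (-2 : ℝ) * (8 * ‖jb x ^ 6 * W x‖)
  calc (1 + ‖x‖) ^ 3 * ‖(W x : ℂ)‖ = (1 + ‖x‖) ^ (-2 : ℝ) * ((1 + ‖x‖) ^ 5 * ‖(W x : ℂ)‖) := by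
        rw [Real.rpow_neg h0.le, Real.rpow_ofNat]; field_simp
    _ ≤ _ := mul_le_mul_of_nonneg_left (hb x) (by positivity)

/-! ### Multipliers with controlled differences -/

/-- Bounds on the differences of `m` up to order three, in terms of translates of the sum of an
integrable and a square integrable function. -/
def DiffBound (m : E3 → ℝ) (κ : ℝ) : Prop :=
  ∃ Ψ₁ Ψ₂ : E3 → ℝ, ∃ C h₀ : ℝ, Integrable Ψ₁ ∧ MemLp Ψ₂ 2 ∧ (∀ η, 0 ≤ Ψ₁ η) ∧ (∀ η, 0 ≤ Ψ₂ η) ∧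
    0 ≤ C ∧ 0 < h₀ ∧ ∀ h : E3, 0 < ‖h‖ → ‖h‖ ≤ h₀ → ∀ᵐ η, ∀ k ≤ 3,
      |(fwdDiff h)^[k] m η| ≤ C * ‖h‖ ^ (κ - 3 + k) *
        ∑ j ∈ Finset.range 4, (Ψ₁ (η + j • h) + Ψ₂ (η + j • h))

theorem iterate_fwdDiff_comp_smul (m : E3 → ℝ) (c : ℝ) (h η : E3) (k : ℕ) :
    (fwdDiff h)^[k] (fun x => m (c • x)) η = (fwdDiff (c • h))^[k] m (c • η) := by
  induction k generalizing η with
  | zero => rfl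
  | succ k ih =>
    simp only [Function.iterate_succ_apply', fwdDiff, ih, smul_add]

theorem quasiMeasurePreserving_smul {c : ℝ} (hc : c ≠ 0) :
    Measure.QuasiMeasurePreserving (fun η : E3 => c • η) :=
  ⟨by fun_prop, by
    rw [Measure.map_addHaar_smul _ hc]
    exact Measure.smul_absolutelyContinuous⟩

theorem DiffBound.comp_smul {m : E3 → ℝ} {κ : ℝ} (hm : DiffBound m κ) {c : ℝ} (hc : 0 < c) :
    DiffBound (fun η => m (c • η)) κ := by
  obtain ⟨Ψ₁, Ψ₂, C, h₀, i1, i2, p1, p2, hC, hh, H⟩ := hm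
  refine ⟨fun η => Ψ₁ (c • η), fun η => Ψ₂ (c • η),
    -- The sum dominates `c ^ (κ - 3 + k)` for every `k ≤ 3`, whatever the size of `c`.
    C * (c ^ (κ - 3) + c ^ (κ - 2) + c ^ (κ - 1) + c ^ κ), h₀ / c,
    i1.comp_smul hc.ne', ?_, fun _ => p1 _, fun _ => p2 _, by positivity, by positivity, ?_⟩
  · have hm2 : AEStronglyMeasurable (fun η : E3 => Ψ₂ (c • η)) :=
      i2.aestronglyMeasurable.comp_quasiMeasurePreserving (quasiMeasurePreserving_smul hc.ne')
    exact (memLp_two_iff_integrable_sq hm2).2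
      (((memLp_two_iff_integrable_sq i2.aestronglyMeasurable).1 i2).comp_smul hc.ne')
  · intro h h0 hle
    have hn : ‖c • h‖ = c * ‖h‖ := by rw [norm_smul, Real.norm_of_nonneg hc.le]
    have := (quasiMeasurePreserving_smul hc.ne').ae (H (c • h) (by rw [hn]; positivity) (by
      rw [hn, mul_comm]; exact (le_div_iff₀ hc).1 hle))
    filter_upwards [this] with η hη k hk
    rw [iterate_fwdDiff_comp_smul]
    refine (hη k hk).trans ?_
    simp only [smul_add, smul_comm _ c]
    refine mul_le_mul_of_nonneg_right ?_
      (Finset.sum_nonneg fun j _ => add_nonneg (p1 _) (p2 _))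
    rw [hn, Real.mul_rpow hc.le h0.le, ← mul_assoc]
    refine mul_le_mul_of_nonneg_right ?_ (by positivity)
    refine mul_le_mul_of_nonneg_left ?_ hC
    have q : ∀ s : ℝ, 0 ≤ c ^ s := fun s => Real.rpow_nonneg hc.le s
    have q0 := q (κ - 3); have q1 := q (κ - 2); have q2 := q (κ - 1); have q3 := q κ
    interval_cases k
    · have : κ - 3 + ((0 : ℕ) : ℝ) = κ - 3 := by push_cast; ring
      rw [this]; linarith
    · have : κ - 3 + ((1 : ℕ) : ℝ) = κ - 2 := by push_cast; ring
      rw [this]; linarith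
    · have : κ - 3 + ((2 : ℕ) : ℝ) = κ - 1 := by push_cast; ring
      rw [this]; linarith
    · have : κ - 3 + ((3 : ℕ) : ℝ) = κ := by push_cast; ring
      rw [this]; linarith

theorem norm_fwdDiff_mul_le (m : E3 → ℝ) (w : E3 → ℂ) (h ξ : E3) :
    ‖(fwdDiff h)^[3] (fun x => (m x : ℂ) * w x) ξ‖ ≤ 3 * ∑ k ∈ Finset.range 4,
      |(fwdDiff h)^[k] m ξ| * ‖(fwdDiff h)^[3 - k] w (ξ + k • h)‖ := by
  have e : (fwdDiff h)^[3] (fun x => (m x : ℂ) * w x) ξ =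
      (m ξ : ℂ) * (fwdDiff h)^[3] w ξ + 3 * (((fwdDiff h)^[1] m ξ : ℝ) : ℂ) * (fwdDiff h)^[2] w (ξ + h)
      + 3 * (((fwdDiff h)^[2] m ξ : ℝ) : ℂ) * (fwdDiff h)^[1] w (ξ + h + h)
      + (((fwdDiff h)^[3] m ξ : ℝ) : ℂ) * w (ξ + h + h + h) := by
    simp only [Function.iterate_succ_apply', Function.iterate_zero, id, fwdDiff]
    push_cast
    ring
  rw [e]
  simp only [Finset.sum_range_succ, Finset.sum_range_zero, zero_add, zero_smul, add_zero]
  have e2 : ξ + 2 • h = ξ + h + h := by rw [two_smul, add_assoc]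
  have e3 : ξ + 3 • h = ξ + h + h + h := by
    rw [succ_nsmul, two_smul]; abel
  rw [one_smul, e2, e3]
  have n3 : ‖(3 : ℂ)‖ = 3 := by simp
  refine (norm_add_le _ _).trans ?_
  refine (add_le_add_left ((norm_add_le _ _).trans (add_le_add_left (norm_add_le _ _) _)) _).trans ?_
  simp only [norm_mul, n3, Complex.norm_real, Real.norm_eq_abs]
  show |m ξ| * ‖(fwdDiff h)^[3] w ξ‖ + 3 * |(fwdDiff h)^[1] m ξ| * ‖(fwdDiff h)^[2] w (ξ + h)‖
      + 3 * |(fwdDiff h)^[2] m ξ| * ‖(fwdDiff h)^[1] w (ξ + h + h)‖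
      + |(fwdDiff h)^[3] m ξ| * ‖w (ξ + h + h + h)‖ ≤ 3 * (|m ξ| * ‖(fwdDiff h)^[3] w ξ‖ +
       |(fwdDiff h)^[1] m ξ| * ‖(fwdDiff h)^[2] w (ξ + h)‖
      + |(fwdDiff h)^[2] m ξ| * ‖(fwdDiff h)^[1] w (ξ + h + h)‖
      + |(fwdDiff h)^[3] m ξ| * ‖w (ξ + h + h + h)‖)
  have t0 : 0 ≤ |m ξ| * ‖(fwdDiff h)^[3] w ξ‖ := by positivity
  have t3 : 0 ≤ |(fwdDiff h)^[3] m ξ| * ‖w (ξ + h + h + h)‖ := by positivity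
  linarith

theorem integral_add_add {f g k : E3 → ℝ} (hf : Integrable f) (hg : Integrable g)
    (hk : Integrable k) :
    ∫ x, (f x + (g x + k x)) = (∫ x, f x) + ((∫ x, g x) + ∫ x, k x) := by
  rw [← integral_add hg hk]
  exact integral_add hf (hg.add hk)

/-- In the Leibniz expansion the factor `|h|^(κ-3+k)` from `Δ^k m` meets `|h|^(3-k)` from `Δ^(3-k)
w`, so every term is of order `|h|^κ`. The integrable part of the majorant is paired with the sup
bound on `w`, the square integrable part with its `L²` bound. -/
theorem integral_fwdDiff_mul_le {m : E3 → ℝ} {κ : ℝ} (hm : DiffBound m κ) {w : E3 → ℂ} {A : ℝ}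
    (hw : ∀ h : E3, ∀ l ≤ 3,
      (∀ ξ, ‖(fwdDiff h)^[l] w ξ‖ ≤ A * ‖h‖ ^ l) ∧
      Integrable (fun ξ => ‖(fwdDiff h)^[l] w ξ‖ ^ 2) ∧
      ∫ ξ, ‖(fwdDiff h)^[l] w ξ‖ ^ 2 ≤ A * (‖h‖ ^ l) ^ 2) :
    ∃ C h₀, 0 < h₀ ∧ ∀ h : E3, 0 < ‖h‖ → ‖h‖ ≤ h₀ →
      ∫ ξ, ‖(fwdDiff h)^[3] (fun x => (m x : ℂ) * w x) ξ‖ ≤ C * ‖h‖ ^ κ := by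
  obtain ⟨Ψ₁, Ψ₂, C, h₀, i1, i2, p1, p2, hC, hh, H⟩ := hm
  have i2' := (memLp_two_iff_integrable_sq i2.aestronglyMeasurable).1 i2
  set I₁ := ∫ η, Ψ₁ η
  set I₂ := ∫ η, Ψ₂ η ^ 2
  refine ⟨3 * (16 * (C * (A * I₁ + (I₂ + A)))), h₀, hh, fun h h0 hle => ?_⟩
  set Q : ℕ → ℕ → E3 → ℝ := fun k j ξ => C * ‖h‖ ^ (κ - 3 + k) *
    ((A * ‖h‖ ^ (3 - k)) * Ψ₁ (ξ + j • h) + (‖h‖ ^ (3 - k) * Ψ₂ (ξ + j • h) ^ 2 +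
      (‖h‖ ^ (3 - k))⁻¹ * ‖(fwdDiff h)^[3 - k] w (ξ + k • h)‖ ^ 2)) with hQ
  have a1 : ∀ k j : ℕ, Integrable (fun ξ => Ψ₁ (ξ + j • h)) := fun k j => i1.comp_add_right _
  have a2 : ∀ k j : ℕ, Integrable (fun ξ => Ψ₂ (ξ + j • h) ^ 2) := fun k j =>
    i2'.comp_add_right _
  have a3 : ∀ k : ℕ, Integrable (fun ξ => ‖(fwdDiff h)^[3 - k] w (ξ + k • h)‖ ^ 2) := fun k =>
    (hw h (3 - k) (by omega)).2.1.comp_add_right (k • h)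
  have hQi : ∀ k j, Integrable (Q k j) := fun k j =>
    (((a1 k j).const_mul _).add (((a2 k j).const_mul _).add ((a3 k).const_mul _))).const_mul _
  have hQb : ∀ k ≤ 3, ∀ j, ∫ ξ, Q k j ξ ≤ C * (A * I₁ + (I₂ + A)) * ‖h‖ ^ κ := by
    intro k hk j
    have e : ∫ ξ, Q k j ξ = C * ‖h‖ ^ (κ - 3 + k) * ((A * ‖h‖ ^ (3 - k)) * I₁ +
        (‖h‖ ^ (3 - k) * I₂ +
        (‖h‖ ^ (3 - k))⁻¹ * ∫ ξ, ‖(fwdDiff h)^[3 - k] w ξ‖ ^ 2)) := by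
      simp only [hQ]
      rw [integral_const_mul, integral_add_add ((a1 k j).const_mul _)
        ((a2 k j).const_mul _) ((a3 k).const_mul _),
        integral_const_mul, integral_const_mul, integral_const_mul,
        integral_add_right_eq_self Ψ₁, integral_add_right_eq_self (fun η => Ψ₂ η ^ 2),
        integral_add_right_eq_self (fun ξ => ‖(fwdDiff h)^[3 - k] w ξ‖ ^ 2)]
    rw [e]
    have hp : 0 < ‖h‖ ^ (3 - k) := by positivity
    have e2 : ‖h‖ ^ κ = ‖h‖ ^ (κ - 3 + k) * ‖h‖ ^ (3 - k) := by
      rw [← Real.rpow_natCast, ← Real.rpow_add h0, Nat.cast_sub hk]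
      congr 1; push_cast; ring
    calc _ ≤ C * ‖h‖ ^ (κ - 3 + k) * ((A * ‖h‖ ^ (3 - k)) * I₁ + (‖h‖ ^ (3 - k) * I₂ +
        (‖h‖ ^ (3 - k))⁻¹ * (A * (‖h‖ ^ (3 - k)) ^ 2))) := by
          gcongr; exact (hw h (3 - k) (by omega)).2.2
      _ = _ := by rw [e2]; field_simp
  have hpt : ∀ᵐ ξ, ‖(fwdDiff h)^[3] (fun x => (m x : ℂ) * w x) ξ‖ ≤
      3 * ∑ k ∈ Finset.range 4, ∑ j ∈ Finset.range 4, Q k j ξ := by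
    filter_upwards [H h h0 hle] with ξ hξ
    refine (norm_fwdDiff_mul_le m w h ξ).trans ?_
    gcongr with k hk
    have hk3 : k ≤ 3 := by have := Finset.mem_range.1 hk; omega
    refine (mul_le_mul_of_nonneg_right (hξ k hk3) (norm_nonneg _)).trans ?_
    rw [mul_assoc, Finset.sum_mul, Finset.mul_sum]
    gcongr with j hj
    simp only [hQ]
    gcongr
    obtain ⟨b1, -, -⟩ := hw h (3 - k) (by omega)
    have hp : 0 < ‖h‖ ^ (3 - k) := by positivity
    have hΨ := p2 (ξ + j • h)
    have hΨ1 := p1 (ξ + j • h)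
    have b2 := b1 (ξ + k • h)
    set T := ‖(fwdDiff h)^[3 - k] w (ξ + k • h)‖
    have hT : 0 ≤ T := norm_nonneg _
    set q := ‖h‖ ^ (3 - k)
    set P := Ψ₂ (ξ + j • h)
    -- Young's inequality with weight `q = |h|^(3-k)`: since `∫ T²` is `O(q²)`, both resulting terms
    -- are `O(q)` after integration.
    have b3 : P * T ≤ q * P ^ 2 + q⁻¹ * T ^ 2 := by
      have : q * P ^ 2 + q⁻¹ * T ^ 2 - P * T = q⁻¹ * ((q * P - T / 2) ^ 2 + 3 / 4 * T ^ 2) := by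
        field_simp; ring
      have : 0 ≤ q * P ^ 2 + q⁻¹ * T ^ 2 - P * T := by rw [this]; positivity
      linarith
    rw [add_mul]
    have b4 := mul_le_mul_of_nonneg_left b2 hΨ1
    linarith
  have hsi : Integrable (fun ξ => 3 * ∑ k ∈ Finset.range 4, ∑ j ∈ Finset.range 4, Q k j ξ) :=
    (integrable_finsetSum _ fun k _ => integrable_finsetSum _ fun j _ => hQi k j).const_mul _
  refine (integral_mono_of_nonneg (ae_of_all _ fun _ => norm_nonneg _) hsi hpt).trans ?_
  rw [integral_const_mul, integral_finsetSum _ fun k _ =>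
    integrable_finsetSum _ fun j _ => hQi k j]
  calc _ ≤ 3 * ∑ k ∈ Finset.range 4, ∑ j ∈ Finset.range 4,
        C * (A * I₁ + (I₂ + A)) * ‖h‖ ^ κ := by
        gcongr with k hk
        rw [integral_finsetSum _ fun j _ => hQi k j]
        gcongr with j hj
        exact hQb k (by have := Finset.mem_range.1 hk; omega) j
    _ = _ := by simp; ring


theorem integrable_multiplier_mul_fourier {m : E3 → ℝ} {a₀ : ℝ} (hm : Measurable m)
    (hs : SmallBound m a₀) (ha : a₀ < 1) (hl : ∀ η, 1 ≤ ‖η‖ → ‖η‖ ^ 2 * |m η| ≤ 1)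
    {f : E3 → ℂ} (hf : Integrable f) (h2 : MemLp f 2) :
    Integrable (fun ξ => (m ((2 * Real.pi) • ξ) : ℂ) * 𝓕 f ξ) := by
  have hw := continuous_fourier hf
  have hlow := integrableOn_multiplier_mul hm hs ha hw (norm_fourier_le f)
  have hprod : Integrable (fun ξ => (1 + ‖ξ‖) ^ (-2 : ℝ) * (4 * ‖𝓕 f ξ‖)) :=
    memLp_one_add_norm_rpow_neg_two.integrable_mul
      ((memLp_fourier_of_memLp hf h2).1.norm.const_mul 4)
  have hhigh : IntegrableOn (fun ξ => (m ((2 * Real.pi) • ξ) : ℂ) * 𝓕 f ξ) lowFreqᶜ := by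
    refine hprod.integrableOn.mono' (Measurable.aestronglyMeasurable ?_)
      ((ae_restrict_iff' measurableSet_lowFreq.compl).2 (ae_of_all _ fun ξ hξ => ?_))
    · have := hw.measurable
      fun_prop
    · rw [norm_mul, Complex.norm_real, Real.norm_eq_abs]
      have := abs_multiplier_le hl (ξ := ξ) (not_le.1 (show ¬ 2 * Real.pi * ‖ξ‖ ≤ 1 from hξ)).le
      calc _ ≤ 4 * (1 + ‖ξ‖) ^ (-2 : ℝ) * ‖𝓕 f ξ‖ := by gcongr
        _ = _ := by ring
  rw [← integrableOn_univ, ← Set.union_compl_self lowFreq]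
  exact hlow.union hhigh

theorem exists_decay_multiplier {m : E3 → ℝ} {κ : ℝ} (hD : DiffBound m κ) (hκ : 0 ≤ κ)
    {W : E3 → ℝ} (hW : Integrable W) (hd : FastDecaying W)
    (hi : Integrable (fun ξ => (m ((2 * Real.pi) • ξ) : ℂ) * 𝓕 (fun x => (W x : ℂ)) ξ)) :
    ∃ C, ∀ x, ‖𝓕⁻ (fun ξ => (m ((2 * Real.pi) • ξ) : ℂ) * 𝓕 (fun x => (W x : ℂ)) ξ) x‖ ≤
      C * jb x ^ (-κ) := by
  obtain ⟨h1, h2⟩ := weighted_of_fastDecaying hW hd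
  obtain ⟨A, -, hw⟩ := fourier_diff_bounds h1 h2 hW.ofReal.aestronglyMeasurable
  obtain ⟨C, h₀, hh, H⟩ := integral_fwdDiff_mul_le (hD.comp_smul Real.two_pi_pos) hw
  exact exists_decay_of_fwdDiff hi hκ hh H

theorem memLp_two_of_fastDecaying {W : E3 → ℝ} (hW : Integrable W) (hd : FastDecaying W) :
    MemLp (fun x => (W x : ℂ)) 2 := by
  refine hd.mono hW.ofReal.aestronglyMeasurable (ae_of_all _ fun x => ?_)
  rw [Complex.norm_real, norm_mul, norm_pow]
  have h1 : 1 ≤ ‖jb x‖ := (one_le_jb x).trans (le_abs_self _)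
  exact le_mul_of_one_le_left (norm_nonneg _) (one_le_pow₀ h1)

/-! ### Difference bounds for the two multipliers. -/

theorem abs_iterate_fwdDiff_le_sum (m : E3 → ℝ) (h η : E3) {k : ℕ} (hk : k ≤ 3) :
    |(fwdDiff h)^[k] m η| ≤ 8 * ∑ j ∈ Finset.range 4, |m (η + j • h)| := by
  have e2 : η + 2 • h = η + h + h := by rw [two_smul, add_assoc]
  have e3 : η + 3 • h = η + h + h + h := by rw [succ_nsmul, two_smul]; abel
  simp only [Finset.sum_range_succ, Finset.sum_range_zero, zero_add, zero_smul, add_zero, one_smul,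
    e2, e3]
  have a0 := abs_nonneg (m η)
  have a1 := abs_nonneg (m (η + h))
  have a2 := abs_nonneg (m (η + h + h))
  have a3 := abs_nonneg (m (η + h + h + h))
  have b0 := le_abs_self (m η); have c0 := neg_abs_le (m η)
  have b1 := le_abs_self (m (η + h)); have c1 := neg_abs_le (m (η + h))
  have b2 := le_abs_self (m (η + h + h)); have c2 := neg_abs_le (m (η + h + h))
  have b3 := le_abs_self (m (η + h + h + h)); have c3 := neg_abs_le (m (η + h + h + h))
  interval_cases k <;>
    simp only [Function.iterate_succ_apply', Function.iterate_zero, id, fwdDiff] <;>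
    rw [abs_le] <;> constructor <;> linarith

theorem abs_iterate_fwdDiff_three_le (m : E3 → ℝ) (h η : E3) :
    |(fwdDiff h)^[3] m η| ≤
      2 * ∑ j ∈ Finset.range 3, |m (η + (j + 1) • h) - m (η + j • h)| := by
  have e2 : η + 2 • h = η + h + h := by rw [two_smul, add_assoc]
  have e3 : η + 3 • h = η + h + h + h := by rw [succ_nsmul, two_smul]; abel
  simp only [Finset.sum_range_succ, Finset.sum_range_zero, zero_add, zero_smul, add_zero, one_smul,
    e2, Nat.reduceAdd, e3]
  have b0 := le_abs_self (m (η + h) - m η); have c0 := neg_abs_le (m (η + h) - m η)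
  have b1 := le_abs_self (m (η + h + h) - m (η + h))
  have c1 := neg_abs_le (m (η + h + h) - m (η + h))
  have b2 := le_abs_self (m (η + h + h + h) - m (η + h + h))
  have c2 := neg_abs_le (m (η + h + h + h) - m (η + h + h))
  have a0 := abs_nonneg (m (η + h) - m η)
  have a2 := abs_nonneg (m (η + h + h + h) - m (η + h + h))
  simp only [Function.iterate_succ_apply', Function.iterate_zero, id, fwdDiff]
  rw [abs_le]
  constructor <;> linarith

theorem norm_add_nsmul_le (h η : E3) {j : ℕ} (hj : j ≤ 3) : ‖η + j • h‖ ≤ ‖η‖ + 3 * ‖h‖ := by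
  refine (norm_add_le _ _).trans ?_
  have : ‖j • h‖ ≤ j * ‖h‖ := norm_nsmul_le
  have hj' : (j : ℝ) ≤ 3 := by exact_mod_cast hj
  nlinarith [norm_nonneg h]

theorem half_norm_le_norm_add_nsmul {h η : E3} (h6 : 6 * ‖h‖ ≤ ‖η‖) {j : ℕ} (hj : j ≤ 3) :
    ‖η‖ / 2 ≤ ‖η + j • h‖ := by
  have h1 : ‖j • h‖ ≤ j * ‖h‖ := norm_nsmul_le
  have h2 : ‖η‖ ≤ ‖η + j • h‖ + ‖j • h‖ := by
    have := norm_sub_le (η + j • h) (j • h)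
    rwa [add_sub_cancel_right] at this
  have hj' : (j : ℝ) ≤ 3 := by exact_mod_cast hj
  nlinarith [norm_nonneg h]

theorem ae_add_nsmul_ne_zero (h : E3) : ∀ᵐ η : E3, ∀ j ≤ 3, η + j • h ≠ 0 := by
  have : ∀ j : ℕ, ∀ᵐ η : E3, η + j • h ≠ 0 := fun j => by
    filter_upwards [compl_mem_ae_iff.2 (measure_singleton (-(j • h) : E3))] with η hη h0
    exact hη (eq_neg_of_add_eq_zero_left h0)
  filter_upwards [ae_all_iff.2 this] with η hη j _ using hη j

theorem one_add_norm_sq_inv_le (η : E3) : (1 + ‖η‖ ^ 2)⁻¹ ≤ 2 * (1 + ‖η‖) ^ (-2 : ℝ) := by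
  rw [Real.rpow_neg (by positivity), Real.rpow_ofNat, ← div_eq_mul_inv, inv_eq_one_div,
    div_le_div_iff₀ (by positivity) (by positivity)]
  nlinarith [sq_nonneg (‖η‖ - 1)]

theorem norm_sq_add_pow_four_le {h η : E3} (h6 : 6 * ‖h‖ ≤ ‖η‖) {j : ℕ} (hj : j ≤ 3) :
    ‖η‖ ^ 2 + ‖η‖ ^ 4 ≤ 16 * (‖η + j • h‖ ^ 2 + ‖η + j • h‖ ^ 4) := by
  have h1 := half_norm_le_norm_add_nsmul h6 hj
  have h2 : (‖η‖ / 2) ^ 2 ≤ ‖η + j • h‖ ^ 2 := by gcongr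
  have h3 : (‖η‖ / 2) ^ 4 ≤ ‖η + j • h‖ ^ 4 := by gcongr
  nlinarith [sq_nonneg ‖η‖]

/-- For symbols of size `|η|^(-d)` at the origin. Where `6|h| ≤ |η|` the symbol estimates apply, and
for `|η| ≤ 1` the surplus `|h|^(d+ε)` is traded for `|η|^(d+ε)`, leaving the integrable
`|η|^(-(3-ε))`. Where `|η| < 6|h|` the points `η + j h` lie within `9|h|` of the origin and the size
of `m` alone gives the required power of `|h|`. -/
theorem diffBound_of_homogeneous {m : E3 → ℝ} {d : ℕ} (hd : d ≤ 1) {C : ℝ} (hC : 0 ≤ C)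
    (h1 : ∀ η h : E3, η ≠ 0 → 6 * ‖h‖ ≤ ‖η‖ → ∀ k ≤ 3,
      |(fwdDiff h)^[k] m η| ≤ C * (‖h‖ / ‖η‖) ^ k * (‖η‖ ^ d * (1 + ‖η‖ ^ 2))⁻¹)
    (h2 : ∀ η : E3, η ≠ 0 → |m η| ≤ C * (‖η‖ ^ d)⁻¹) {ε : ℝ} (hε : 0 < ε) (hε1 : ε ≤ 1) :
    DiffBound m (3 - d - ε) := by
  set Ψ₁ : E3 → ℝ := (Metric.closedBall 0 2).indicator (fun η => ‖η‖ ^ (-(3 - ε))) with hΨ1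
  set Ψ₂ : E3 → ℝ := fun η => (1 + ‖η‖) ^ (-2 : ℝ) with hΨ2
  have p1 : ∀ η, 0 ≤ Ψ₁ η := fun η => Set.indicator_nonneg (fun _ _ => by positivity) η
  have p2 : ∀ η, 0 ≤ Ψ₂ η := fun η => by positivity
  -- With `|h| ≤ 1/6` the radius `9|h|` stays below `2`, inside the ball supporting `Ψ₁`.
  refine ⟨Ψ₁, Ψ₂, 8 * C * 9 ^ 3, 1 / 6,
    (integrable_indicator_iff Metric.isClosed_closedBall.measurableSet).2
      (integrableOn_norm_rpow (by linarith) 2), memLp_one_add_norm_rpow_neg_two, p1, p2,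
      by positivity, by norm_num, fun h h0 hle => ?_⟩
  have hd' : (d : ℝ) ≤ 1 := by exact_mod_cast hd
  have hd0 : (0 : ℝ) ≤ d := by positivity
  filter_upwards [ae_add_nsmul_ne_zero h] with η hη k hk
  have hk' : (k : ℝ) ≤ 3 := by exact_mod_cast hk
  have e0 : (3 : ℝ) - d - ε - 3 + k = k - (d + ε) := by ring
  rw [e0]
  have hH : 0 < ‖h‖ ^ ((k : ℝ) - (d + ε)) := by positivity
  have hterm : ∀ j ∈ Finset.range 4, Ψ₁ (η + j • h) + Ψ₂ (η + j • h) ≤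
      ∑ j ∈ Finset.range 4, (Ψ₁ (η + j • h) + Ψ₂ (η + j • h)) := fun j hj =>
    Finset.single_le_sum (f := fun j : ℕ => Ψ₁ (η + j • h) + Ψ₂ (η + j • h))
      (fun i _ => add_nonneg (p1 _) (p2 _)) hj
  have hη0 : η ≠ 0 := by simpa using hη 0 (by omega)
  have hηp := norm_pos_iff.2 hη0
  rcases le_or_gt (6 * ‖h‖) ‖η‖ with h6 | h6
  · have hb := h1 η h hη0 h6 k hk
    have ht := hterm 0 (by simp)
    rw [zero_smul, add_zero] at ht
    suffices hs : (‖h‖ / ‖η‖) ^ k * (‖η‖ ^ d * (1 + ‖η‖ ^ 2))⁻¹ ≤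
        2 * (‖h‖ ^ ((k : ℝ) - (d + ε)) * (Ψ₁ η + Ψ₂ η)) by
      calc _ ≤ C * ((‖h‖ / ‖η‖) ^ k * (‖η‖ ^ d * (1 + ‖η‖ ^ 2))⁻¹) := by rw [← mul_assoc]; exact hb
        _ ≤ C * (2 * (‖h‖ ^ ((k : ℝ) - (d + ε)) * (Ψ₁ η + Ψ₂ η))) := by gcongr
        _ = 2 * C * ‖h‖ ^ ((k : ℝ) - (d + ε)) * (Ψ₁ η + Ψ₂ η) := by ring
        _ ≤ _ := mul_le_mul (mul_le_mul_of_nonneg_right (by linarith) hH.le) ht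
            (add_nonneg (p1 _) (p2 _)) (by positivity)
    have hsplit : ‖h‖ ^ k = ‖h‖ ^ ((k : ℝ) - (d + ε)) * ‖h‖ ^ (d + ε) := by
      rw [← Real.rpow_add h0, ← Real.rpow_natCast]; congr 1; ring
    rcases le_or_gt ‖η‖ 1 with hs | hs
    · have e1 : Ψ₁ η = ‖η‖ ^ (-(3 - ε)) := Set.indicator_of_mem (by simp; linarith) _
      have e2 : ‖h‖ ^ ((d : ℝ) + ε) ≤ ‖η‖ ^ ((d : ℝ) + ε) := by gcongr; linarith
      have e3 : (‖η‖ ^ k)⁻¹ * (‖η‖ ^ d)⁻¹ * ‖η‖ ^ ((d : ℝ) + ε) ≤ ‖η‖ ^ (-(3 - ε)) := by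
        rw [← Real.rpow_natCast, ← Real.rpow_natCast, ← Real.rpow_neg hηp.le, ← Real.rpow_neg hηp.le,
          ← Real.rpow_add hηp, ← Real.rpow_add hηp]
        exact Real.rpow_le_rpow_of_exponent_ge hηp hs (by linarith)
      have e4 : (1 + ‖η‖ ^ 2)⁻¹ ≤ 1 := inv_le_one_of_one_le₀ (by nlinarith)
      calc (‖h‖ / ‖η‖) ^ k * (‖η‖ ^ d * (1 + ‖η‖ ^ 2))⁻¹
          ≤ (‖h‖ / ‖η‖) ^ k * ((‖η‖ ^ d)⁻¹ * 1) := by rw [mul_inv]; gcongr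
        _ = ‖h‖ ^ ((k : ℝ) - (d + ε)) * ((‖η‖ ^ k)⁻¹ * (‖η‖ ^ d)⁻¹ * ‖h‖ ^ ((d : ℝ) + ε)) := by
            rw [div_pow, hsplit]; ring
        _ ≤ ‖h‖ ^ ((k : ℝ) - (d + ε)) * ((‖η‖ ^ k)⁻¹ * (‖η‖ ^ d)⁻¹ * ‖η‖ ^ ((d : ℝ) + ε)) := by gcongr
        _ ≤ ‖h‖ ^ ((k : ℝ) - (d + ε)) * (Ψ₁ η + Ψ₂ η) := by
            rw [e1]; gcongr; exact e3.trans (le_add_of_nonneg_right (p2 η))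
        _ ≤ _ := by
            have := mul_nonneg hH.le (add_nonneg (p1 η) (p2 η))
            linarith
    · have e1 : ‖h‖ ^ ((d : ℝ) + ε) ≤ 1 := Real.rpow_le_one h0.le (by linarith) (by positivity)
      have e2 : (‖η‖ ^ d * (1 + ‖η‖ ^ 2))⁻¹ ≤ 2 * Ψ₂ η := by
        refine le_trans ?_ (one_add_norm_sq_inv_le η)
        refine inv_anti₀ (by positivity) (le_mul_of_one_le_left (by positivity) (one_le_pow₀ hs.le))
      calc (‖h‖ / ‖η‖) ^ k * (‖η‖ ^ d * (1 + ‖η‖ ^ 2))⁻¹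
          ≤ ‖h‖ ^ k * (2 * Ψ₂ η) := by gcongr; exact div_le_self h0.le hs.le
        _ = 2 * (‖h‖ ^ ((k : ℝ) - (d + ε)) * ‖h‖ ^ ((d : ℝ) + ε) * Ψ₂ η) := by rw [hsplit]; ring
        _ ≤ 2 * (‖h‖ ^ ((k : ℝ) - (d + ε)) * 1 * Ψ₂ η) := by gcongr
        _ ≤ _ := by rw [mul_one]; gcongr; exact le_add_of_nonneg_left (p1 η)
  · refine (abs_iterate_fwdDiff_le_sum m h η hk).trans ?_
    rw [Finset.mul_sum, Finset.mul_sum]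
    refine Finset.sum_le_sum fun j hj => ?_
    have hj3 : j ≤ 3 := by have := Finset.mem_range.1 hj; omega
    have hn := norm_add_nsmul_le h η hj3
    have hy := norm_pos_iff.2 (hη j hj3)
    have hb := h2 _ (hη j hj3)
    have q2 := p2 (η + j • h)
    have e1 : Ψ₁ (η + j • h) = ‖η + j • h‖ ^ (-(3 - ε)) :=
      Set.indicator_of_mem (by simp only [Metric.mem_closedBall, dist_zero_right]; linarith) _
    set y := ‖η + j • h‖
    have hy9 : y ≤ 9 * ‖h‖ := by linarith
    have e2 : (y ^ d)⁻¹ = y ^ (3 - (d + ε)) * y ^ (-(3 - ε)) := by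
      rw [← Real.rpow_natCast, ← Real.rpow_neg hy.le, ← Real.rpow_add hy]; congr 1; ring
    have e3 : y ^ (3 - (d + ε)) ≤ 9 ^ 3 * ‖h‖ ^ ((k : ℝ) - (d + ε)) := by
      calc y ^ (3 - (d + ε)) ≤ (9 * ‖h‖) ^ (3 - (d + ε)) := by gcongr; linarith
        _ = 9 ^ (3 - (d + ε)) * ‖h‖ ^ (3 - (d + ε)) := Real.mul_rpow (by norm_num) h0.le
        _ ≤ 9 ^ (3 : ℝ) * ‖h‖ ^ ((k : ℝ) - (d + ε)) := by
            exact mul_le_mul (Real.rpow_le_rpow_of_exponent_le (by norm_num) (by linarith))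
              (Real.rpow_le_rpow_of_exponent_ge h0 (by linarith) (by linarith))
              (by positivity) (by positivity)
        _ = _ := by norm_num
    calc 8 * |m (η + j • h)| ≤ 8 * (C * (y ^ (3 - (d + ε)) * y ^ (-(3 - ε)))) := by
          rw [← e2]; gcongr
      _ ≤ 8 * (C * (9 ^ 3 * ‖h‖ ^ ((k : ℝ) - (d + ε)) * y ^ (-(3 - ε)))) := by gcongr
      _ = 8 * C * 9 ^ 3 * ‖h‖ ^ ((k : ℝ) - (d + ε)) * y ^ (-(3 - ε)) := by ring
      _ ≤ _ := by rw [e1]; gcongr; linarith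

theorem diffBound_of_lt {v : E3} (hv : ‖v‖ < 1) {ε : ℝ} (hε : 0 < ε) (hε1 : ε ≤ 1) :
    DiffBound (mRe v) (3 - ε) ∧ DiffBound (mIm v) (2 - ε) := by
  have hc : 0 < 1 - ‖v‖ ^ 2 := by nlinarith [norm_nonneg v]
  -- The factor `16 = 2⁴` accounts for `|η + j h| ≥ |η|/2`.
  obtain ⟨C, hC, H⟩ := exists_fwdDiff_multiplier_le (L := 16 * (1 - ‖v‖ ^ 2)⁻¹) (by positivity)
  have hlow : ∀ η h : E3, 6 * ‖h‖ ≤ ‖η‖ → ∀ j ≤ 3,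
      ‖η‖ ^ 2 + ‖η‖ ^ 4 ≤ 16 * (1 - ‖v‖ ^ 2)⁻¹ * symN v (η + j • h) := fun η h h6 j hj => by
    refine (norm_sq_add_pow_four_le h6 hj).trans ?_
    rw [mul_assoc]
    gcongr
    rw [← div_eq_inv_mul, le_div_iff₀ hc, mul_comm]
    exact le_symN v _
  set D := C + (1 - ‖v‖ ^ 2)⁻¹
  have hCD : C ≤ D := le_add_of_nonneg_right (by positivity)
  have hcD : (1 - ‖v‖ ^ 2)⁻¹ ≤ D := le_add_of_nonneg_left hC
  have hD : 0 ≤ D := hC.trans hCD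
  constructor
  · have := diffBound_of_homogeneous (m := mRe v) (d := 0) (by norm_num) hD
      (fun η h hη h6 k hk => ((H v hv.le η h hη h6 (hlow η h h6) k hk).1).trans (by
        rw [pow_zero, one_mul]; gcongr))
      (fun η hη => (abs_mRe_le hv η).trans (by simpa using hcD)) hε hε1
    simpa using this
  · have := diffBound_of_homogeneous (m := mIm v) (d := 1) (by norm_num) hD
      (fun η h hη h6 k hk => ((H v hv.le η h hη h6 (hlow η h h6) k hk).2).trans (by
        rw [pow_one]; gcongr))
      (fun η hη => by
        have h0 := norm_pos_iff.2 hη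
        rw [pow_one, ← div_eq_mul_inv, le_div_iff₀ h0, mul_comm]
        exact (norm_mul_abs_mIm_le hv η).trans hcD) hε hε1
    convert this using 1
    push_cast; ring

/-- As `κ ≤ 1`, the power `|h|^(κ-3+k)` is at least `1` for `k ≤ 2`, so only the third difference
requires cancellation. Near the origin it is a combination of first differences, controlled by the
Hölder hypothesis `h4`; away from it the symbol estimate applies. The majorant near the origin is
the integrable power `N^(-13/12)`. -/
theorem diffBound_of_critical {m : E3 → ℝ} {v : E3} (hv : ‖v‖ = 1) {κ C : ℝ} (hκ1 : κ ≤ 1)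
    (hC : 1 ≤ C)
    (h1 : ∀ η h : E3, 1 ≤ ‖η‖ → 6 * ‖h‖ ≤ ‖η‖ →
      |(fwdDiff h)^[3] m η| ≤ C * ‖h‖ ^ 3 * (1 + ‖η‖ ^ 2)⁻¹)
    (h2 : ∀ η : E3, 1 ≤ ‖η‖ → ‖η‖ ^ 2 * |m η| ≤ 1)
    (h3 : ∀ η : E3, η ≠ 0 → ‖η‖ ≤ 2 → |m η| ≤ C * symN v η ^ (-(13 / 12) : ℝ))
    (h4 : ∀ x y : E3, x ≠ 0 → y ≠ 0 → ‖x‖ ≤ 2 → ‖y‖ ≤ 2 → |m x - m y| ≤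
      C * ‖x - y‖ ^ κ * (symN v x ^ (-(13 / 12) : ℝ) + symN v y ^ (-(13 / 12) : ℝ))) :
    DiffBound m κ := by
  set Ψ₁ : E3 → ℝ := (Metric.closedBall 0 2).indicator (fun η => symN v η ^ (-(13 / 12) : ℝ)) with hΨ1
  set Ψ₂ : E3 → ℝ := fun η => (1 + ‖η‖) ^ (-2 : ℝ) with hΨ2
  have p1 : ∀ η, 0 ≤ Ψ₁ η := fun η =>
    Set.indicator_nonneg (fun _ _ => Real.rpow_nonneg (symN_nonneg hv.le _) _) η
  have p2 : ∀ η, 0 ≤ Ψ₂ η := fun η => by positivity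
  have e1 : ∀ {η : E3}, ‖η‖ ≤ 2 → Ψ₁ η = symN v η ^ (-(13 / 12) : ℝ) := fun {η} h =>
    Set.indicator_of_mem (by simpa using h) _
  have hm : ∀ η, η ≠ 0 → |m η| ≤ 4 * C * (Ψ₁ η + Ψ₂ η) := fun η hη => by
    rcases le_total ‖η‖ 1 with hs | hs
    · have := h3 η hη (by linarith)
      rw [← e1 (by linarith)] at this
      nlinarith [p1 η, p2 η, mul_nonneg (zero_le_one.trans hC) (p1 η),
        mul_nonneg (zero_le_one.trans hC) (p2 η)]
    · have hb : |m η| ≤ 4 * Ψ₂ η := by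
        simp only [hΨ2]
        rw [Real.rpow_neg (by positivity), Real.rpow_ofNat, ← div_eq_mul_inv,
          le_div_iff₀ (by positivity)]
        calc |m η| * (1 + ‖η‖) ^ 2 ≤ |m η| * (2 * ‖η‖) ^ 2 := by gcongr; linarith
          _ = 4 * (‖η‖ ^ 2 * |m η|) := by ring
          _ ≤ 4 := by linarith [h2 η hs]
      nlinarith [p1 η, p2 η, mul_nonneg (sub_nonneg.2 hC) (p2 η),
        mul_nonneg (zero_le_one.trans hC) (p1 η)]
  refine ⟨Ψ₁, Ψ₂, 32 * C, 1 / 6,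
    (integrable_indicator_iff Metric.isClosed_closedBall.measurableSet).2
      (integrableOn_symN_rpow hv 2), memLp_one_add_norm_rpow_neg_two, p1, p2,
      by positivity, by norm_num, fun h h0 hle => ?_⟩
  filter_upwards [ae_add_nsmul_ne_zero h] with η hη k hk
  have hterm : ∀ j ∈ Finset.range 4, Ψ₁ (η + j • h) + Ψ₂ (η + j • h) ≤
      ∑ j ∈ Finset.range 4, (Ψ₁ (η + j • h) + Ψ₂ (η + j • h)) := fun j hj =>
    Finset.single_le_sum (f := fun j : ℕ => Ψ₁ (η + j • h) + Ψ₂ (η + j • h))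
      (fun i _ => add_nonneg (p1 _) (p2 _)) hj
  have hS : 0 ≤ ∑ j ∈ Finset.range 4, (Ψ₁ (η + j • h) + Ψ₂ (η + j • h)) :=
    Finset.sum_nonneg fun j _ => add_nonneg (p1 _) (p2 _)
  set S := ∑ j ∈ Finset.range 4, (Ψ₁ (η + j • h) + Ψ₂ (η + j • h)) with hSdef
  rcases (Nat.lt_or_eq_of_le hk) with hk2 | rfl
  · have hk' : (k : ℝ) ≤ 2 := by exact_mod_cast Nat.lt_succ_iff.1 hk2
    have hH : 1 ≤ ‖h‖ ^ (κ - 3 + k) :=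
      Real.one_le_rpow_of_pos_of_le_one_of_nonpos h0 (by linarith) (by linarith)
    calc _ ≤ 8 * ∑ j ∈ Finset.range 4, |m (η + j • h)| := abs_iterate_fwdDiff_le_sum m h η hk
      _ ≤ 8 * ∑ j ∈ Finset.range 4, 4 * C * (Ψ₁ (η + j • h) + Ψ₂ (η + j • h)) := by
          gcongr with j hj
          exact hm _ (hη j (by have := Finset.mem_range.1 hj; omega))
      _ = 32 * C * 1 * S := by rw [← Finset.mul_sum]; ring
      _ ≤ _ := by gcongr
  · have e0 : κ - 3 + ((3 : ℕ) : ℝ) = κ := by push_cast; ring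
    rw [e0]
    rcases le_total 1 ‖η‖ with hs | hs
    · have ht := hterm 0 (by simp)
      rw [zero_smul, add_zero] at ht
      have hH : ‖h‖ ^ 3 ≤ ‖h‖ ^ κ := by
        rw [← Real.rpow_natCast]
        exact Real.rpow_le_rpow_of_exponent_ge h0 (by linarith) (by push_cast; linarith)
      calc _ ≤ C * ‖h‖ ^ 3 * (1 + ‖η‖ ^ 2)⁻¹ := h1 η h hs (by linarith)
        _ ≤ C * ‖h‖ ^ κ * (2 * Ψ₂ η) := by gcongr; exact one_add_norm_sq_inv_le η
        _ = 2 * C * ‖h‖ ^ κ * Ψ₂ η := by ring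
        _ ≤ 32 * C * ‖h‖ ^ κ * S :=
          mul_le_mul (mul_le_mul_of_nonneg_right (by linarith) (by positivity))
            (by linarith [p1 η]) (p2 η) (by positivity)
    · have hball : ∀ j ≤ 3, ‖η + j • h‖ ≤ 2 := fun j hj => by
        linarith [norm_add_nsmul_le h η hj]
      have hPS : ∀ j ≤ 3, symN v (η + j • h) ^ (-(13 / 12) : ℝ) ≤ S := fun j hj => by
        rw [← e1 (hball j hj)]
        linarith [hterm j (Finset.mem_range.2 (by omega)), p2 (η + j • h)]
      refine (abs_iterate_fwdDiff_three_le m h η).trans ?_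
      calc _ ≤ 2 * ∑ j ∈ Finset.range 3, C * ‖h‖ ^ κ * (S + S) := by
            gcongr with j hj
            have hj2 : j < 3 := Finset.mem_range.1 hj
            have := h4 _ _ (hη (j + 1) (by omega)) (hη j (by omega)) (hball (j + 1) (by omega))
              (hball j (by omega))
            have e : η + (j + 1) • h - (η + j • h) = h := by rw [succ_nsmul]; abel
            rw [e] at this
            refine this.trans ?_
            gcongr
            · exact hPS _ (by omega)
            · exact hPS _ (by omega)
        _ = 12 * C * ‖h‖ ^ κ * S := by simp; ring
        _ ≤ _ := by gcongr; norm_num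

/-- For `‖v‖ = 1` the square root of `symN v` is Lipschitz on bounded sets. -/
theorem abs_sqrt_symN_sub_le {v : E3} (hv : ‖v‖ = 1) {x y : E3} (hx : x ≠ 0)
    (hx2 : ‖x‖ ≤ 2) (hy2 : ‖y‖ ≤ 2) :
    |Real.sqrt (symN v x) - Real.sqrt (symN v y)| ≤ 5 * ‖x - y‖ := by
  -- With `P` the projection orthogonal to `v`, `√N` is the Euclidean length of `(|P z|, |z|²)`. On
  -- the ball of radius `2` these components have Lipschitz constants `1` and `4`, hence the `5`.
  set P : E3 → E3 := fun z => z - (inner ℝ v z : ℝ) • v with hP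
  have hPn : ∀ z, ‖P z‖ ^ 2 = ‖z‖ ^ 2 - (inner ℝ v z) ^ 2 := fun z => by
    simp only [hP]
    rw [norm_sub_sq_real, norm_smul, inner_smul_right, real_inner_comm v z, hv, mul_one,
      Real.norm_eq_abs, sq_abs]
    ring
  have hPs : ∀ z w, P z - P w = P (z - w) := fun z w => by
    simp only [hP, inner_sub_right, sub_smul]; abel
  have hP1 : ∀ z, ‖P z‖ ≤ ‖z‖ := fun z => by
    have := hPn z
    nlinarith [norm_nonneg z, norm_nonneg (P z), sq_nonneg (inner ℝ v z)]
  have hN : ∀ z, symN v z = ‖P z‖ ^ 2 + (‖z‖ ^ 2) ^ 2 := fun z => by rw [hPn, symN]; ring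
  have hs := Real.sq_sqrt (symN_nonneg hv.le x)
  have ht := Real.sq_sqrt (symN_nonneg hv.le y)
  have hs1 : ‖P x‖ ≤ Real.sqrt (symN v x) := Real.le_sqrt_of_sq_le (by rw [hN]; nlinarith)
  have ht1 : ‖P y‖ ≤ Real.sqrt (symN v y) := Real.le_sqrt_of_sq_le (by rw [hN]; nlinarith)
  have hs2 : ‖x‖ ^ 2 ≤ Real.sqrt (symN v x) := Real.le_sqrt_of_sq_le (by rw [hN]; nlinarith)
  have ht2 : ‖y‖ ^ 2 ≤ Real.sqrt (symN v y) := Real.le_sqrt_of_sq_le (by rw [hN]; nlinarith)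
  have hs0 : 0 < Real.sqrt (symN v x) := Real.sqrt_pos.2 (symN_pos hv.le hx)
  have ht0 := Real.sqrt_nonneg (symN v y)
  set s := Real.sqrt (symN v x)
  set t := Real.sqrt (symN v y)
  have d1 : |‖P x‖ - ‖P y‖| ≤ ‖x - y‖ :=
    (abs_norm_sub_norm_le _ _).trans (by rw [hPs]; exact hP1 _)
  have d2 : |‖x‖ - ‖y‖| ≤ ‖x - y‖ := abs_norm_sub_norm_le _ _
  have d3 : |‖x‖ ^ 2 - ‖y‖ ^ 2| ≤ 4 * ‖x - y‖ := by
    rw [sq_sub_sq, abs_mul, abs_of_nonneg (by positivity : 0 ≤ ‖x‖ + ‖y‖)]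
    have : ‖x‖ + ‖y‖ ≤ 4 := by linarith
    gcongr
  have key : |s - t| * (s + t) ≤ 5 * ‖x - y‖ * (s + t) := by
    have e : (s - t) * (s + t) = (‖P x‖ - ‖P y‖) * (‖P x‖ + ‖P y‖) +
        (‖x‖ ^ 2 - ‖y‖ ^ 2) * (‖x‖ ^ 2 + ‖y‖ ^ 2) := by
      linear_combination hs - ht + hN x - hN y
    rw [← abs_of_nonneg (by positivity : 0 ≤ s + t), ← abs_mul, e]
    refine (abs_add_le _ _).trans ?_
    rw [abs_mul, abs_mul, abs_of_nonneg (by positivity : 0 ≤ s + t),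
      abs_of_nonneg (by positivity : 0 ≤ ‖P x‖ + ‖P y‖),
      abs_of_nonneg (by positivity : 0 ≤ ‖x‖ ^ 2 + ‖y‖ ^ 2)]
    calc _ ≤ ‖x - y‖ * (s + t) + 4 * ‖x - y‖ * (s + t) := by gcongr
      _ = _ := by ring
  exact le_of_mul_le_mul_right key (by positivity)

theorem rpow_symN_bounds {v : E3} (hv : ‖v‖ = 1) {x : E3} (hx : x ≠ 0) (hx2 : ‖x‖ ≤ 2) :
    (symN v x)⁻¹ ≤ 20 * symN v x ^ (-(13 / 12) : ℝ) ∧ symN v x ≤ 20 := by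
  have hN := symN_pos hv.le hx
  have h20 : symN v x ≤ 20 := by
    have : symN v x ≤ ‖x‖ ^ 2 + ‖x‖ ^ 4 := by rw [symN]; nlinarith [sq_nonneg (inner ℝ v x)]
    have h2 : ‖x‖ ^ 2 ≤ 2 ^ 2 := by gcongr
    have h4 : ‖x‖ ^ 4 ≤ 2 ^ 4 := by gcongr
    linarith
  refine ⟨?_, h20⟩
  have e : (symN v x)⁻¹ = symN v x ^ (1 / 12 : ℝ) * symN v x ^ (-(13 / 12) : ℝ) := by
    rw [← Real.rpow_add hN, ← Real.rpow_neg_one]; norm_num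
  rw [e]
  gcongr
  calc symN v x ^ (1 / 12 : ℝ) ≤ 20 ^ (1 / 12 : ℝ) := by gcongr
    _ ≤ 20 ^ (1 : ℝ) := Real.rpow_le_rpow_of_exponent_le (by norm_num) (by norm_num)
    _ = 20 := by norm_num

/-- Since `|y|² ≤ √N(y)`, the numerator cancels one of the roots lost in differencing `1/N`, and the
Lipschitz bound costs only `1/N`. -/
theorem abs_mRe_sub_le {v : E3} (hv : ‖v‖ = 1) {x y : E3} (hx : x ≠ 0) (hy : y ≠ 0)
    (hx2 : ‖x‖ ≤ 2) (hy2 : ‖y‖ ≤ 2) :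
    |mRe v x - mRe v y| ≤ 12 * ‖x - y‖ * ((symN v x)⁻¹ + (symN v y)⁻¹) := by
  have hL := abs_sqrt_symN_sub_le hv hx hx2 hy2
  have hs := Real.sq_sqrt (symN_nonneg hv.le x)
  have ht := Real.sq_sqrt (symN_nonneg hv.le y)
  have ht2 : ‖y‖ ^ 2 ≤ Real.sqrt (symN v y) :=
    Real.le_sqrt_of_sq_le (by nlinarith [norm_pow_four_le_symN hv.le y])
  have hs0 : 0 < Real.sqrt (symN v x) := Real.sqrt_pos.2 (symN_pos hv.le hx)
  have ht0 : 0 < Real.sqrt (symN v y) := Real.sqrt_pos.2 (symN_pos hv.le hy)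
  rw [mRe, mRe, ← hs, ← ht]
  set s := Real.sqrt (symN v x)
  set t := Real.sqrt (symN v y)
  have d2 : |‖x‖ - ‖y‖| ≤ ‖x - y‖ := abs_norm_sub_norm_le _ _
  have d3 : |‖x‖ ^ 2 - ‖y‖ ^ 2| ≤ 4 * ‖x - y‖ := by
    rw [sq_sub_sq, abs_mul, abs_of_nonneg (by positivity : 0 ≤ ‖x‖ + ‖y‖)]
    have : ‖x‖ + ‖y‖ ≤ 4 := by linarith
    gcongr
  have e : ‖x‖ ^ 2 / s ^ 2 - ‖y‖ ^ 2 / t ^ 2 =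
      ((‖x‖ ^ 2 - ‖y‖ ^ 2) * t ^ 2 + ‖y‖ ^ 2 * ((t - s) * (t + s))) / (s ^ 2 * t ^ 2) := by
    field_simp; ring
  rw [e, abs_div, abs_of_pos (by positivity : 0 < s ^ 2 * t ^ 2), div_le_iff₀ (by positivity)]
  rw [abs_sub_comm] at hL
  calc _ ≤ |(‖x‖ ^ 2 - ‖y‖ ^ 2)| * t ^ 2 + ‖y‖ ^ 2 * (|t - s| * (t + s)) := by
        refine (abs_add_le _ _).trans ?_
        rw [abs_mul, abs_mul, abs_mul, abs_of_nonneg (by positivity : 0 ≤ t ^ 2),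
          abs_of_nonneg (by positivity : 0 ≤ ‖y‖ ^ 2), abs_of_nonneg (by positivity : 0 ≤ t + s)]
    _ ≤ 4 * ‖x - y‖ * t ^ 2 + t * (5 * ‖x - y‖ * (t + s)) := by gcongr
    _ ≤ 12 * ‖x - y‖ * (t ^ 2 + s ^ 2) := by
        nlinarith [mul_nonneg (norm_nonneg (x - y)) (sq_nonneg (t - s)),
          mul_nonneg (norm_nonneg (x - y)) (sq_nonneg s)]
    _ = _ := by field_simp

/-- With `σ = N(x)^(1/4)` there are two bounds on the difference: the Lipschitz bound `13 |x-y| /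
σ⁵` and the size bound `2/σ³`. Their geometric mean with weights `2/3` and `1/3` gives `|x-y|^(2/3)
σ^(-13/3)`, and `σ^(-13/3) = N^(-13/12)`. -/
theorem abs_mIm_sub_le_of_le {v : E3} (hv : ‖v‖ = 1) {x y : E3} (hx : x ≠ 0) (hy : y ≠ 0)
    (hx2 : ‖x‖ ≤ 2) (hy2 : ‖y‖ ≤ 2) (hxy : symN v x ≤ symN v y) :
    |mIm v x - mIm v y| ≤ 7 * ‖x - y‖ ^ (2 / 3 : ℝ) * symN v x ^ (-(13 / 12) : ℝ) := by
  have hNx := symN_pos hv.le hx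
  have hNy := symN_pos hv.le hy
  have h20 := (rpow_symN_bounds hv hx hx2).2
  obtain ⟨σ, hσ, eσ⟩ : ∃ σ, 0 < σ ∧ symN v x = σ ^ 4 :=
    ⟨symN v x ^ (1 / 4 : ℝ), by positivity, by
      rw [← Real.rpow_natCast, ← Real.rpow_mul hNx.le]; norm_num⟩
  obtain ⟨τ, hτ, eτ⟩ : ∃ τ, 0 < τ ∧ symN v y = τ ^ 4 :=
    ⟨symN v y ^ (1 / 4 : ℝ), by positivity, by
      rw [← Real.rpow_natCast, ← Real.rpow_mul hNy.le]; norm_num⟩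
  have hL := abs_sqrt_symN_sub_le hv hx hx2 hy2
  have q : ∀ r : ℝ, r ^ 4 = (r ^ 2) ^ 2 := fun r => by ring
  rw [eσ, eτ, q, q, Real.sqrt_sq (by positivity), Real.sqrt_sq (by positivity), abs_sub_comm] at hL
  have hστ : σ ≤ τ := by
    rw [eσ, eτ] at hxy
    exact (pow_le_pow_iff_left₀ hσ.le hτ.le (by norm_num)).1 hxy
  have hσ3 : σ ≤ 3 := by
    by_contra hcon
    have h3 : 3 < σ := not_le.1 hcon
    have : (3 : ℝ) ^ 4 < σ ^ 4 := by gcongr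
    linarith
  have hxσ : ‖x‖ ≤ σ := by
    have := norm_pow_four_le_symN hv.le x
    rw [eσ] at this
    exact (pow_le_pow_iff_left₀ (norm_nonneg _) hσ.le (by norm_num)).1 this
  have hyτ : ‖y‖ ≤ τ := by
    have := norm_pow_four_le_symN hv.le y
    rw [eτ] at this
    exact (pow_le_pow_iff_left₀ (norm_nonneg _) hτ.le (by norm_num)).1 this
  have hu : |inner ℝ v x| ≤ σ := (abs_inner_le hv.le x).trans hxσ
  have hw : |inner ℝ v y| ≤ τ := (abs_inner_le hv.le y).trans hyτ
  have huw : |inner ℝ v x - inner ℝ v y| ≤ ‖x - y‖ := by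
    rw [← inner_sub_right]; exact abs_inner_le hv.le _
  have hδ := norm_nonneg (x - y)
  have hrpow : symN v x ^ (-(13 / 12) : ℝ) = (σ ^ (13 / 3 : ℝ))⁻¹ := by
    rw [eσ, ← Real.rpow_natCast, ← Real.rpow_mul hσ.le, ← Real.rpow_neg hσ.le]; norm_num
  rw [hrpow, mIm, mIm, eσ, eτ]
  set u : ℝ := inner ℝ v x
  set w : ℝ := inner ℝ v y
  set δ := ‖x - y‖
  have b1 : |u / σ ^ 4 - w / τ ^ 4| ≤ 13 * δ / σ ^ 5 := by
    have e : u / σ ^ 4 - w / τ ^ 4 =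
        ((u - w) * τ ^ 4 + w * ((τ ^ 2 - σ ^ 2) * (τ ^ 2 + σ ^ 2))) / (σ ^ 4 * τ ^ 4) := by
      field_simp; ring
    rw [e, abs_div, abs_of_pos (by positivity : 0 < σ ^ 4 * τ ^ 4),
      div_le_div_iff₀ (by positivity) (by positivity)]
    have h1 : |(u - w) * τ ^ 4 + w * ((τ ^ 2 - σ ^ 2) * (τ ^ 2 + σ ^ 2))| ≤
        δ * τ ^ 4 + τ * (5 * δ * (τ ^ 2 + τ ^ 2)) := by
      refine (abs_add_le _ _).trans ?_
      rw [abs_mul, abs_mul, abs_mul, abs_of_nonneg (by positivity : 0 ≤ τ ^ 4),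
        abs_of_nonneg (by positivity : 0 ≤ τ ^ 2 + σ ^ 2)]
      gcongr
    calc _ ≤ (δ * τ ^ 4 + τ * (5 * δ * (τ ^ 2 + τ ^ 2))) * σ ^ 5 := by gcongr
      _ = δ * (τ ^ 4 * σ ^ 4) * σ + 10 * δ * (τ ^ 3 * σ ^ 4) * σ := by ring
      _ ≤ δ * (τ ^ 4 * σ ^ 4) * 3 + 10 * δ * (τ ^ 3 * σ ^ 4) * τ := by gcongr
      _ = _ := by ring
  have b2 : |u / σ ^ 4 - w / τ ^ 4| ≤ 2 / σ ^ 3 := by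
    refine (abs_sub _ _).trans ?_
    rw [abs_div, abs_div, abs_of_pos (by positivity : 0 < σ ^ 4),
      abs_of_pos (by positivity : 0 < τ ^ 4)]
    calc _ ≤ σ / σ ^ 4 + τ / τ ^ 4 := by gcongr
      _ = 1 / σ ^ 3 + 1 / τ ^ 3 := by field_simp
      _ ≤ 1 / σ ^ 3 + 1 / σ ^ 3 := by gcongr
      _ = _ := by ring
  set D := |u / σ ^ 4 - w / τ ^ 4|
  have hD : 0 ≤ D := abs_nonneg _
  -- The constant is `13² · 2 = 338`, rounded up to `343 = 7³`.
  have b3 : D ^ 3 ≤ 343 * δ ^ 2 / σ ^ 13 := by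
    calc D ^ 3 = D ^ 2 * D := by ring
      _ ≤ (13 * δ / σ ^ 5) ^ 2 * (2 / σ ^ 3) := by gcongr
      _ = 338 * δ ^ 2 / σ ^ 13 := by field_simp; ring
      _ ≤ _ := by gcongr; norm_num
  refine (pow_le_pow_iff_left₀ hD (by positivity) (by norm_num : (3 : ℕ) ≠ 0)).1 (b3.trans (le_of_eq ?_))
  rw [mul_pow, mul_pow, inv_pow, ← Real.rpow_natCast (δ ^ (2 / 3 : ℝ)), ← Real.rpow_mul hδ,
    ← Real.rpow_natCast (σ ^ (13 / 3 : ℝ)), ← Real.rpow_mul hσ.le]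
  norm_num [div_eq_mul_inv]

theorem abs_mIm_sub_le {v : E3} (hv : ‖v‖ = 1) {x y : E3} (hx : x ≠ 0) (hy : y ≠ 0)
    (hx2 : ‖x‖ ≤ 2) (hy2 : ‖y‖ ≤ 2) :
    |mIm v x - mIm v y| ≤ 7 * ‖x - y‖ ^ (2 / 3 : ℝ) *
      (symN v x ^ (-(13 / 12) : ℝ) + symN v y ^ (-(13 / 12) : ℝ)) := by
  have px : 0 ≤ symN v x ^ (-(13 / 12) : ℝ) := Real.rpow_nonneg (symN_nonneg hv.le _) _
  have py : 0 ≤ symN v y ^ (-(13 / 12) : ℝ) := Real.rpow_nonneg (symN_nonneg hv.le _) _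
  rcases le_total (symN v x) (symN v y) with h | h
  · refine (abs_mIm_sub_le_of_le hv hx hy hx2 hy2 h).trans ?_
    gcongr; linarith
  · rw [abs_sub_comm, norm_sub_rev]
    refine (abs_mIm_sub_le_of_le hv hy hx hy2 hx2 h).trans ?_
    gcongr; linarith

theorem diffBound_of_eq {v : E3} (hv : ‖v‖ = 1) :
    DiffBound (mRe v) 1 ∧ DiffBound (mIm v) (2 / 3) := by
  -- For `|η| ≥ 1`, `|η|² + |η|⁴ ≤ 2|η|⁴ ≤ 2 · 16 |η + j h|⁴`, and the symbol dominates the fourth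
  -- power. The constant `240 = 12 · 20` below combines `abs_mRe_sub_le` with `rpow_symN_bounds`.
  obtain ⟨C, hC, H⟩ := exists_fwdDiff_multiplier_le (L := 32) (by norm_num)
  have hlow : ∀ η h : E3, 1 ≤ ‖η‖ → 6 * ‖h‖ ≤ ‖η‖ → ∀ j ≤ 3,
      ‖η‖ ^ 2 + ‖η‖ ^ 4 ≤ 32 * symN v (η + j • h) := fun η h h1 h6 j hj => by
    have h2 := half_norm_le_norm_add_nsmul h6 hj
    have h3 : (‖η‖ / 2) ^ 4 ≤ ‖η + j • h‖ ^ 4 := by gcongr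
    have h4 := norm_pow_four_le_symN hv.le (η + j • h)
    have h5 : ‖η‖ ^ 2 ≤ ‖η‖ ^ 4 := pow_le_pow_right₀ h1 (by norm_num)
    linarith
  have hp : ∀ η h : E3, 1 ≤ ‖η‖ → C * (‖h‖ / ‖η‖) ^ 3 ≤ (C + 240) * ‖h‖ ^ 3 := fun η h h1 => by
    have : ‖h‖ / ‖η‖ ≤ ‖h‖ := div_le_self (norm_nonneg _) h1
    gcongr; linarith
  have hne : ∀ η : E3, 1 ≤ ‖η‖ → η ≠ 0 := fun η h h0 => by
    rw [h0, norm_zero] at h; linarith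
  constructor
  · refine diffBound_of_critical (C := C + 240) hv le_rfl (by linarith) (fun η h h1 h6 => ?_)
      (fun η _ => norm_sq_mul_abs_mRe_le hv.le η) (fun η hη h2 => ?_) fun x y hx hy hx2 hy2 => ?_
    · refine ((H v hv.le η h (hne η h1) h6 (hlow η h h1 h6) 3 le_rfl).1).trans ?_
      exact mul_le_mul_of_nonneg_right (hp η h h1) (by positivity)
    · rw [mRe, abs_of_nonneg (div_nonneg (by positivity) (symN_nonneg hv.le η)), div_eq_mul_inv]
      have hp := Real.rpow_nonneg (symN_nonneg hv.le η) (-(13 / 12))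
      have hN := symN_pos hv.le hη
      calc ‖η‖ ^ 2 * (symN v η)⁻¹ ≤ 2 ^ 2 * (20 * symN v η ^ (-(13 / 12) : ℝ)) := by
            gcongr; exact (rpow_symN_bounds hv hη h2).1
        _ ≤ _ := by nlinarith
    · refine (abs_mRe_sub_le hv hx hy hx2 hy2).trans ?_
      rw [Real.rpow_one]
      have px : 0 ≤ symN v x ^ (-(13 / 12) : ℝ) := Real.rpow_nonneg (symN_nonneg hv.le _) _
      have py : 0 ≤ symN v y ^ (-(13 / 12) : ℝ) := Real.rpow_nonneg (symN_nonneg hv.le _) _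
      calc _ ≤ 12 * ‖x - y‖ * (20 * symN v x ^ (-(13 / 12) : ℝ) +
            20 * symN v y ^ (-(13 / 12) : ℝ)) := by
            gcongr
            · exact (rpow_symN_bounds hv hx hx2).1
            · exact (rpow_symN_bounds hv hy hy2).1
        _ = 240 * ‖x - y‖ * (symN v x ^ (-(13 / 12) : ℝ) + symN v y ^ (-(13 / 12) : ℝ)) := by ring
        _ ≤ _ := by gcongr; linarith
  · refine diffBound_of_critical (C := C + 240) hv (by norm_num) (by linarith)
      (fun η h h1 h6 => ?_)
      (fun η h1 => norm_sq_mul_abs_mIm_le hv.le h1) (fun η hη h2 => ?_)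
      fun x y hx hy hx2 hy2 => ?_
    · refine ((H v hv.le η h (hne η h1) h6 (hlow η h h1 h6) 3 le_rfl).2).trans ?_
      have : (‖η‖ * (1 + ‖η‖ ^ 2))⁻¹ ≤ (1 + ‖η‖ ^ 2)⁻¹ :=
        inv_anti₀ (by positivity) (le_mul_of_one_le_left (by positivity) h1)
      exact mul_le_mul (hp η h h1) this (by positivity) (by positivity)
    · rw [mIm, abs_div, abs_of_nonneg (symN_nonneg hv.le η), div_eq_mul_inv]
      have hp := Real.rpow_nonneg (symN_nonneg hv.le η) (-(13 / 12))
      have hN := symN_pos hv.le hη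
      have hi := (abs_inner_le hv.le η).trans h2
      calc |inner ℝ v η| * (symN v η)⁻¹ ≤ 2 * (20 * symN v η ^ (-(13 / 12) : ℝ)) := by
            gcongr; exact (rpow_symN_bounds hv hη h2).1
        _ ≤ _ := by nlinarith
    · refine (abs_mIm_sub_le hv hx hy hx2 hy2).trans ?_
      have px : 0 ≤ symN v x ^ (-(13 / 12) : ℝ) := Real.rpow_nonneg (symN_nonneg hv.le _) _
      have py : 0 ≤ symN v y ^ (-(13 / 12) : ℝ) := Real.rpow_nonneg (symN_nonneg hv.le _) _
      gcongr
      linarith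

/-! ### Continuity and decay of the profile. -/

theorem fourierInv_const_mul (c : ℂ) (g : E3 → ℂ) (x : E3) :
    𝓕⁻ (fun ξ => c * g ξ) x = c * 𝓕⁻ g x := by
  rw [Real.fourierInv_eq', Real.fourierInv_eq', ← integral_const_mul]
  congr 1; ext ξ
  simp only [smul_eq_mul]; ring

theorem fourierInv_im_eq_zero {g : E3 → ℂ} (hg : ∀ ξ, g (-ξ) = (starRingEnd ℂ) (g ξ)) (x : E3) :
    (𝓕⁻ g x).im = 0 := by
  rw [← Complex.conj_eq_iff_im, Real.fourierInv_eq', ← integral_conj,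
    ← integral_neg_eq_self]
  congr 1; ext ξ
  simp only [smul_eq_mul, map_mul, hg, Complex.conj_conj, ← Complex.exp_conj, inner_neg_left,
    Complex.conj_ofReal, Complex.conj_I]
  congr 2
  push_cast; ring

theorem continuous_fourierInv {g : E3 → ℂ} (hg : Integrable g) : Continuous (𝓕⁻ g) := by
  have : 𝓕⁻ g = fun x => 𝓕 g (-x) := by ext x; rw [Real.fourierInv_eq_fourier_neg]
  rw [this]
  exact (continuous_fourier hg).comp continuous_neg

/-- Both transforms are integrable, so the profile is an inverse Fourier integral, hence continuous.
By Hermitian symmetry the two inverse transforms are real-valued, so they are the real and imaginary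
parts of the profile and can be estimated separately. -/
theorem decays_of_diffBound {v : E3} (hv : ‖v‖ ≤ 1) {r s p q : ℝ} (hr : SmallBound (mRe v) r)
    (hr1 : r < 1) (hs : SmallBound (mIm v) s) (hs1 : s < 1)
    (hp : ∀ ε : ℝ, 0 < ε → ∃ κ, 0 ≤ κ ∧ p - ε ≤ κ ∧ DiffBound (mRe v) κ)
    (hq : ∀ ε : ℝ, 0 < ε → ∃ κ, 0 ≤ κ ∧ q - ε ≤ κ ∧ DiffBound (mIm v) κ)
    {W : E3 → ℝ} (hW : Integrable W) (hd : FastDecaying W) {γ : 𝓢'(E3, ℂ)}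
    (hre : Represents (profileRe v W) (𝓕 (reDist γ)))
    (him : Represents (profileIm v W) (𝓕 (imDist γ))) : Decays p q γ := by
  have h2 := memLp_two_of_fastDecaying hW hd
  have i1 := integrable_multiplier_mul_fourier (measurable_mRe v) hr hr1
    (fun η _ => norm_sq_mul_abs_mRe_le hv η) hW.ofReal h2
  have i2 := integrable_multiplier_mul_fourier (measurable_mIm v) hs hs1
    (fun η h => norm_sq_mul_abs_mIm_le hv h) hW.ofReal h2
  have j1 : Integrable (profileRe v W) := i1.const_mul _
  have j2 : Integrable (profileIm v W) := i2.const_mul _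
  have e1 : ∀ x, 𝓕⁻ (profileRe v W) x = -1 * 𝓕⁻ (fun ξ => (mRe v ((2 * Real.pi) • ξ) : ℂ) *
      𝓕 (fun x => (W x : ℂ)) ξ) x := fun x => fourierInv_const_mul _ _ x
  have e2 : ∀ x, 𝓕⁻ (profileIm v W) x = Complex.I * 𝓕⁻ (fun ξ => (mIm v ((2 * Real.pi) • ξ) : ℂ) *
      𝓕 (fun x => (W x : ℂ)) ξ) x := fun x => fourierInv_const_mul _ _ x
  have z1 := fourierInv_im_eq_zero (profileRe_neg v W)
  have z2 := fourierInv_im_eq_zero (profileIm_neg v W)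
  refine ⟨fun x => 𝓕⁻ (profileRe v W) x + Complex.I * 𝓕⁻ (profileIm v W) x,
    (continuous_fourierInv j1).add (continuous_const.mul (continuous_fourierInv j2)), ?_, ?_⟩
  · have := (hre.fourierInv_of_integrable j1).add ((him.fourierInv_of_integrable j2).smul Complex.I)
    rwa [reDist_add_imDist] at this
  · intro ε hε
    obtain ⟨κ₁, k1, l1, d1⟩ := hp ε hε
    obtain ⟨κ₂, k2, l2, d2⟩ := hq ε hε
    obtain ⟨C₁, b1⟩ := exists_decay_multiplier d1 k1 hW hd i1
    obtain ⟨C₂, b2⟩ := exists_decay_multiplier d2 k2 hW hd i2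
    have hmono : ∀ (C κ t : ℝ), t ≤ κ → ∀ x : E3,
        C * jb x ^ (-κ) ≤ (|C₁| + |C₂| + |C|) * jb x ^ (-t) := fun C κ t hle x => by
      have h1 := one_le_jb x
      have h0 : 0 ≤ jb x := by linarith
      calc C * jb x ^ (-κ) ≤ (|C₁| + |C₂| + |C|) * jb x ^ (-κ) := by
            have := le_abs_self C; have := abs_nonneg C₁; have := abs_nonneg C₂
            gcongr; linarith
        _ ≤ _ := mul_le_mul_of_nonneg_left
            (Real.rpow_le_rpow_of_exponent_le h1 (by linarith)) (by positivity)
    refine ⟨|C₁| + |C₂| + max (|C₁|) (|C₂|), fun x => ?_⟩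
    have hjp : ∀ t : ℝ, 0 ≤ jb x ^ t := fun t => Real.rpow_nonneg (by linarith [one_le_jb x]) t
    have r1 : (𝓕⁻ (profileRe v W) x + Complex.I * 𝓕⁻ (profileIm v W) x).re =
        (𝓕⁻ (profileRe v W) x).re := by simp [z2 x]
    have r2 : (𝓕⁻ (profileRe v W) x + Complex.I * 𝓕⁻ (profileIm v W) x).im =
        (𝓕⁻ (profileIm v W) x).re := by simp [z1 x]
    simp only [r1, r2]
    constructor
    · refine (Complex.abs_re_le_norm _).trans ?_
      rw [e1, norm_mul, norm_neg, norm_one, one_mul]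
      refine (b1 x).trans ((hmono C₁ κ₁ (p - ε) l1 x).trans ?_)
      rw [show -(p - ε) = -p + ε by ring]
      exact mul_le_mul_of_nonneg_right (by linarith [le_max_left (|C₁|) (|C₂|)]) (hjp _)
    · refine (Complex.abs_re_le_norm _).trans ?_
      rw [e2, norm_mul, Complex.norm_I, one_mul]
      refine (b2 x).trans ((hmono C₂ κ₂ (q - ε) l2 x).trans ?_)
      rw [show -(q - ε) = -q + ε by ring]
      exact mul_le_mul_of_nonneg_right (by linarith [le_max_right (|C₁|) (|C₂|)]) (hjp _)

theorem decays_of_lt {v : E3} (hv : ‖v‖ < 1) {W : E3 → ℝ} (hW : Integrable W)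
    (hd : FastDecaying W) {γ : 𝓢'(E3, ℂ)} (hre : Represents (profileRe v W) (𝓕 (reDist γ)))
    (him : Represents (profileIm v W) (𝓕 (imDist γ))) : Decays 3 2 γ := by
  have H : ∀ ε : ℝ, 0 < ε → 0 < min ε 1 ∧ min ε 1 ≤ 1 ∧ min ε 1 ≤ ε := fun ε hε =>
    ⟨lt_min hε one_pos, min_le_right _ _, min_le_left _ _⟩
  refine decays_of_diffBound hv.le (smallBound_mRe_of_lt hv) (by norm_num)
    (smallBound_mIm_of_lt hv) (by norm_num) (fun ε hε => ?_) (fun ε hε => ?_) hW hd hre him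
  · obtain ⟨h1, h2, h3⟩ := H ε hε
    exact ⟨3 - min ε 1, by linarith, by linarith, (diffBound_of_lt hv h1 h2).1⟩
  · obtain ⟨h1, h2, h3⟩ := H ε hε
    exact ⟨2 - min ε 1, by linarith, by linarith, (diffBound_of_lt hv h1 h2).2⟩

theorem decays_of_eq {v : E3} (hv : ‖v‖ = 1) {W : E3 → ℝ} (hW : Integrable W)
    (hd : FastDecaying W) {γ : 𝓢'(E3, ℂ)} (hre : Represents (profileRe v W) (𝓕 (reDist γ)))
    (him : Represents (profileIm v W) (𝓕 (imDist γ))) : Decays 1 (2 / 3) γ :=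
  decays_of_diffBound hv.le (smallBound_mRe_of_eq hv) (by norm_num)
    (smallBound_mIm_of_eq hv) (by norm_num)
    (fun ε hε => ⟨1, by norm_num, by linarith, (diffBound_of_eq hv).1⟩)
    (fun ε hε => ⟨2 / 3, by norm_num, by linarith, (diffBound_of_eq hv).2⟩) hW hd hre him

/-! ### Resonance -/

/-- On `[t₀, t₀ + ε]` the integrand is at least `(Mε)⁻²`, which contributes `1/(M²ε)`, unbounded as
`ε → 0`. The half-open interval leaves room to the right of `t₀`. -/
theorem lintegral_inv_sq_eq_top {φ : ℝ → ℝ} {a b t₀ L : ℝ} (ht : t₀ ∈ Set.Ico a b)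
    (hL : ∀ t ∈ Set.Icc a b, |φ t| ≤ L * |t - t₀|) :
    ∫⁻ t in Set.Icc a b, ((ENNReal.ofReal |φ t|)⁻¹) ^ 2 = ⊤ := by
  obtain ⟨M, hM, hLM⟩ : ∃ M : ℝ, 0 < M ∧ L ≤ M := ⟨max L 1, by positivity, le_max_left _ _⟩
  have hb : 0 < b - t₀ := sub_pos.2 ht.2
  have key : ∀ ε : ℝ, 0 < ε → ε ≤ b - t₀ → ENNReal.ofReal ((M ^ 2 * ε)⁻¹) ≤
      ∫⁻ t in Set.Icc a b, ((ENNReal.ofReal |φ t|)⁻¹) ^ 2 := fun ε hε hle => by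
    calc ENNReal.ofReal ((M ^ 2 * ε)⁻¹) = ENNReal.ofReal ((M * ε)⁻¹ ^ 2) * volume (Set.Icc t₀ (t₀ + ε)) := by
          rw [Real.volume_Icc, ← ENNReal.ofReal_mul (by positivity)]
          congr 1
          field_simp; ring
      _ = ∫⁻ t in Set.Icc t₀ (t₀ + ε), ENNReal.ofReal ((M * ε)⁻¹ ^ 2) := by rw [setLIntegral_const]
      _ ≤ ∫⁻ t in Set.Icc t₀ (t₀ + ε), ((ENNReal.ofReal |φ t|)⁻¹) ^ 2 := by
          refine setLIntegral_mono' measurableSet_Icc fun t htt => ?_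
          rw [ENNReal.ofReal_pow (by positivity), ENNReal.ofReal_inv_of_pos (by positivity)]
          gcongr
          refine (hL t ⟨ht.1.trans htt.1, by linarith [htt.2]⟩).trans ?_
          rw [abs_of_nonneg (by linarith [htt.1])]
          have h1 : 0 ≤ t - t₀ := by linarith [htt.1]
          have h2 : t - t₀ ≤ ε := by linarith [htt.2]
          gcongr
      _ ≤ _ := lintegral_mono_set (Set.Icc_subset_Icc ht.1 (by linarith))
  by_contra hne
  set I := ∫⁻ t in Set.Icc a b, ((ENNReal.ofReal |φ t|)⁻¹) ^ 2
  set ε := min (b - t₀) (M ^ 2 * (I.toReal + 1))⁻¹ with hεdef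
  have hI : 0 ≤ I.toReal := ENNReal.toReal_nonneg
  have hε : 0 < ε := lt_min hb (by positivity)
  have h1 := key ε hε (min_le_left _ _)
  rw [ENNReal.ofReal_le_iff_le_toReal hne] at h1
  have h2 : ε ≤ (M ^ 2 * (I.toReal + 1))⁻¹ := min_le_right _ _
  have h3 : I.toReal + 1 ≤ (M ^ 2 * ε)⁻¹ := by
    rw [le_inv_comm₀ (by positivity) (by positivity)]
    calc M ^ 2 * ε ≤ M ^ 2 * (M ^ 2 * (I.toReal + 1))⁻¹ := by gcongr
      _ = _ := by field_simp
  linarith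

theorem lintegral_comp_smul_le {F : E3 → ENNReal} (hF : Measurable F) {t : ℝ} (ht : 1 / 2 ≤ t) :
    ∫⁻ ω, F (t • ω) ≤ 8 * ∫⁻ ω, F ω := by
  have ht0 : 0 < t := by linarith
  have h1 : ∫⁻ ω, F (t • ω) = ∫⁻ ω, F ω ∂(Measure.map (fun ω : E3 => t • ω) volume) :=
    (lintegral_map hF (by fun_prop)).symm
  rw [h1, Measure.map_addHaar_smul _ ht0.ne', lintegral_smul_measure, smul_eq_mul]
  gcongr
  rw [abs_of_pos (by positivity)]
  refine (ENNReal.ofReal_le_ofReal (q := 8) ?_).trans (by simp)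
  rw [finrank_euclideanSpace_fin]
  calc (t ^ 3)⁻¹ ≤ ((1 / 2 : ℝ) ^ 3)⁻¹ := by gcongr
    _ = 8 := by norm_num

/-- Along a ray the symbol is `t² (A + t² B)` with `B > 0`. At `ξ` the bracket equals `(t² - 1) B`,
so it changes sign between `1 - θ` and `1 + θ`; this persists for nearby `ω`, and the intermediate
value theorem gives a zero, where the bracket factors with `t - t₀`. -/
theorem exists_symN_zero_on_rays {v ξ : E3} (hξ : ξ ≠ 0) (h0 : symN v ((2 * Real.pi) • ξ) = 0)
    {θ : ℝ} (hθ : 0 < θ) (hθ1 : θ ≤ 1 / 2) :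
    ∀ᶠ ω in 𝓝 ξ, ∃ t₀ ∈ Set.Ico (1 - θ) (1 + θ), ∃ L : ℝ, ∀ t ∈ Set.Icc (1 - θ) (1 + θ),
      |symN v ((2 * Real.pi) • t • ω)| ≤ L * |t - t₀| := by
  set A : E3 → ℝ := fun ω => (2 * Real.pi * ‖ω‖) ^ 2 - (2 * Real.pi * inner ℝ v ω) ^ 2 with hA
  set B : E3 → ℝ := fun ω => (2 * Real.pi * ‖ω‖) ^ 4 with hB
  have hN : ∀ (t : ℝ) (ω : E3), symN v ((2 * Real.pi) • t • ω) = t ^ 2 * (A ω + t ^ 2 * B ω) := by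
    intro t ω
    rw [symN_two_pi_smul, norm_smul, real_inner_smul_left, real_inner_comm v ω, Real.norm_eq_abs,
      show 2 * Real.pi * (|t| * ‖ω‖) = |t| * (2 * Real.pi * ‖ω‖) by ring, mul_pow |t|, mul_pow |t|, sq_abs,
      show |t| ^ 4 = t ^ 4 by rw [show (4 : ℕ) = 2 * 2 from rfl, pow_mul, sq_abs, pow_mul]]
    ring
  have hAB : A ξ + B ξ = 0 := by
    have := hN 1 ξ
    rw [one_smul, h0] at this
    linarith
  have hBp : 0 < B ξ := by
    have := norm_pos_iff.2 hξ
    have := Real.pi_pos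
    simp only [hB]; positivity
  have c1 : Continuous A := by simp only [hA]; fun_prop
  have c2 : Continuous B := by simp only [hB]; fun_prop
  have n1 : ∀ᶠ ω in 𝓝 ξ, A ω + (1 - θ) ^ 2 * B ω < 0 :=
    (c1.add (continuous_const.mul c2)).continuousAt.eventually_lt_const (by
      show A ξ + (1 - θ) ^ 2 * B ξ < 0
      nlinarith [mul_pos hθ hBp])
  have n2 : ∀ᶠ ω in 𝓝 ξ, 0 < A ω + (1 + θ) ^ 2 * B ω :=
    (c1.add (continuous_const.mul c2)).continuousAt.eventually_const_lt (by
      show 0 < A ξ + (1 + θ) ^ 2 * B ξ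
      nlinarith [mul_pos hθ hBp])
  filter_upwards [n1, n2] with ω h1 h2
  obtain ⟨t₀, ht₀, hz⟩ := intermediate_value_Ico (by linarith : 1 - θ ≤ 1 + θ)
    (f := fun t => A ω + t ^ 2 * B ω) (by fun_prop) (show (0 : ℝ) ∈ Set.Ico _ _ from ⟨h1.le, h2⟩)
  have hz' : A ω = -(t₀ ^ 2 * B ω) := by have : A ω + t₀ ^ 2 * B ω = 0 := hz; linarith
  have hB0 : 0 ≤ B ω := by simp only [hB]; positivity
  refine ⟨t₀, ht₀, 16 * B ω, fun t ht => ?_⟩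
  have e : t ^ 2 * (A ω + t ^ 2 * B ω) = t ^ 2 * (t + t₀) * B ω * (t - t₀) := by rw [hz']; ring
  have p1 : 0 ≤ t := by linarith [ht.1]
  have p2 : 0 ≤ t₀ := by linarith [ht₀.1]
  have p3 : t ≤ 2 := by linarith [ht.2]
  have p4 : t₀ ≤ 2 := by linarith [ht₀.2]
  rw [hN, e, abs_mul, abs_of_nonneg (by positivity)]
  gcongr
  calc t ^ 2 * (t + t₀) ≤ 2 ^ 2 * (2 + 2) := by gcongr
    _ = 16 := by norm_num

/-- A square integrable function cannot blow up like the inverse of `symN v` at a zero. -/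
theorem lintegral_sq_eq_top_of_resonance {v ξ : E3} (hξ : ξ ≠ 0)
    (h0 : symN v ((2 * Real.pi) • ξ) = 0) {r : E3 → ℂ} (hr : Measurable r) {c : ℝ} (hc : 0 < c)
    {U : Set E3} (hU : U ∈ 𝓝 ξ)
    (h : ∀ᵐ η, η ∈ U → c ≤ |symN v ((2 * Real.pi) • η)| * ‖r η‖) :
    ∫⁻ η, ‖r η‖ₑ ^ 2 = ⊤ := by
  have hcont : Tendsto (fun p : ℝ × E3 => p.1 • p.2) (𝓝 1 ×ˢ 𝓝 ξ) (𝓝 ξ) := by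
    have : Continuous (fun p : ℝ × E3 => p.1 • p.2) := by fun_prop
    have := this.tendsto (1, ξ)
    rwa [one_smul, nhds_prod_eq] at this
  obtain ⟨pa, hpa, pb, hpb, hab⟩ := eventually_prod_iff.1 (hcont.eventually hU)
  obtain ⟨θ', hθ', hball⟩ := Metric.eventually_nhds_iff_ball.1 hpa
  set θ := min (θ' / 2) (1 / 2) with hθdef
  have hθ : 0 < θ := by positivity
  have hθ1 : θ ≤ 1 / 2 := min_le_right _ _
  have hθ2 : θ < θ' := lt_of_le_of_lt (min_le_left _ _) (by linarith)
  obtain ⟨V, hV, hVo, hξV⟩ := mem_nhds_iff.1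
    (hpb.and (exists_symN_zero_on_rays hξ h0 hθ hθ1))
  have hVpos : 0 < volume V := hVo.measure_pos volume ⟨ξ, hξV⟩
  set I := Set.Icc (1 - θ) (1 + θ) with hI
  set g : ℝ → E3 → ENNReal := fun t ω =>
    ((ENNReal.ofReal |symN v ((2 * Real.pi) • t • ω)|)⁻¹) ^ 2 with hg
  have hgm : Measurable (fun p : ℝ × E3 => g p.1 p.2) := by
    have : Continuous (fun p : ℝ × E3 => |symN v ((2 * Real.pi) • p.1 • p.2)|) :=
      ((continuous_symN v).comp (by fun_prop)).abs
    have := this.measurable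
    simp only [hg]
    fun_prop
  have hFm : Measurable (fun η => ‖r η‖ₑ ^ 2) := by fun_prop
  -- Averaging over dilations replaces polar coordinates: for each `t` the integral over `V` is
  -- bounded by that of `|r|²`, while exchanging the order of integration makes the integral in `t`
  -- infinite on every ray through `V`.
  have hlow : ∀ t ∈ I, ENNReal.ofReal c ^ 2 * ∫⁻ ω in V, g t ω ≤ 8 * ∫⁻ η, ‖r η‖ₑ ^ 2 := by
    intro t ht
    have ht0 : t ≠ 0 := by have := ht.1; linarith
    have hta : pa t := hball t (by
      rw [Metric.mem_ball, Real.dist_eq, abs_lt]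
      constructor <;> linarith [ht.1, ht.2])
    rw [← lintegral_const_mul' _ _ (by finiteness)]
    calc _ ≤ ∫⁻ ω in V, ‖r (t • ω)‖ₑ ^ 2 := by
          refine setLIntegral_mono_ae' hVo.measurableSet ?_
          filter_upwards [(quasiMeasurePreserving_smul ht0).ae h] with ω hω hωV
          have h1 := hω (hab hta (hV hωV).1)
          simp only [hg]
          rw [← mul_pow]
          gcongr
          rw [← div_eq_mul_inv]
          refine ENNReal.div_le_of_le_mul' ?_
          rw [← ofReal_norm, ← ENNReal.ofReal_mul (abs_nonneg _)]
          exact ENNReal.ofReal_le_ofReal h1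
      _ ≤ ∫⁻ ω, ‖r (t • ω)‖ₑ ^ 2 := setLIntegral_le_lintegral _ _
      _ ≤ _ := lintegral_comp_smul_le hFm (by linarith [ht.1])
  have htop : ∫⁻ t in I, ∫⁻ ω in V, g t ω = ⊤ := by
    rw [lintegral_lintegral_swap hgm.aemeasurable]
    have : ∫⁻ ω in V, ∫⁻ t in I, g t ω = ∫⁻ ω in V, ⊤ := by
      refine setLIntegral_congr_fun hVo.measurableSet fun ω hω => ?_
      obtain ⟨t₀, ht₀, L, hL⟩ := (hV hω).2
      exact lintegral_inv_sq_eq_top ht₀ hL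
    rw [this, setLIntegral_const, ENNReal.top_mul hVpos.ne']
  by_contra hfin
  have hup : ENNReal.ofReal c ^ 2 * ∫⁻ t in I, ∫⁻ ω in V, g t ω ≤
      8 * (∫⁻ η, ‖r η‖ₑ ^ 2) * volume I := by
    rw [← lintegral_const_mul' _ _ (by finiteness), ← setLIntegral_const]
    exact setLIntegral_mono' measurableSet_Icc hlow
  rw [htop, ENNReal.mul_top (by positivity), hI, Real.volume_Icc] at hup
  exact absurd hup (not_le.2 (ENNReal.mul_lt_top (ENNReal.mul_lt_top (by simp)
    (lt_top_iff_ne_top.2 hfin)) ENNReal.ofReal_lt_top))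

theorem angularFourier_eq (W : E3 → ℝ) (ξ : E3) :
    angularFourier W ((2 * Real.pi) • ξ) = 𝓕 (fun x => (W x : ℂ)) ξ := by
  rw [angularFourier, Real.fourier_eq']
  congr 1; ext x
  rw [inner_smul_right, smul_eq_mul]
  congr 2
  push_cast; ring

theorem symN_eq_zero_of_mem_resonantSet {v ξ : E3} (h : ξ ∈ resonantSet v) : symN v ξ = 0 := by
  obtain ⟨h0, h1⟩ := h
  have hp := norm_pos_iff.2 h0
  rw [inner_smul_right] at h1
  have e : symN v ξ = ‖ξ‖ ^ 2 * (1 + ‖ξ‖ ^ 2 - (‖ξ‖⁻¹ * inner ℝ v ξ) ^ 2) := by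
    rw [symN]; field_simp
  rw [e, h1, mul_zero]

theorem not_finiteEnergy_of_resonance {v : E3} {W : E3 → ℝ} (hW : Integrable W)
    (hres : ∃ ξ ∈ resonantSet v, angularFourier W ξ ≠ 0) {γ : 𝓢'(E3, ℂ)}
    (hγ : IsTravelingWave (ofIntegrable W hW) v γ) : ¬ FiniteEnergy γ := by
  rintro ⟨-, f, hf⟩
  obtain ⟨ξ₀, hξ₀, hne⟩ := hres
  have hp := Real.two_pi_pos
  obtain ⟨ξ, rfl⟩ : ∃ ξ : E3, ξ₀ = (2 * Real.pi) • ξ :=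
    ⟨(2 * Real.pi)⁻¹ • ξ₀, by rw [smul_smul, mul_inv_cancel₀ hp.ne', one_smul]⟩
  rw [angularFourier_eq] at hne
  have hξ : ξ ≠ 0 := fun h => hξ₀.1 (by rw [h, smul_zero])
  obtain ⟨h1, h2⟩ := profile_eqs_of_isTravelingWave hW hγ
  have hr : Represents (𝓕 f : Lp ℂ 2 (volume : Measure E3)) (𝓕 (reDist γ)) := by
    rw [hf, Lp.fourier_toTemperedDistribution_eq]
    exact represents_toTemperedDistribution _
  have hw := (represents_ofIntegrable W hW).fourier_of_integrable hW.ofReal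
  have key := symN_mul_fourier_re_ae_eq h1 h2 hw hr
  have hfin : ∫⁻ η, ‖(𝓕 f : Lp ℂ 2 (volume : Measure E3)) η‖ₑ ^ 2 < ⊤ := by
    have := (Lp.memLp (𝓕 f : Lp ℂ 2 (volume : Measure E3))).2
    rw [eLpNorm_lt_top_iff_lintegral_rpow_enorm_lt_top (by norm_num) (by norm_num)] at this
    simpa using this
  -- This is the modulus of the right-hand side of the equation for `Re γ`. It is continuous and
  -- positive at `ξ`, so `|N| |R̂|` is bounded below almost everywhere near `ξ`.
  set ψ : E3 → ℝ := fun η => (2 * Real.pi * ‖η‖) ^ 2 * ‖𝓕 (fun x => (W x : ℂ)) η‖ with hψ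
  have hψc : Continuous ψ := by
    have := continuous_fourier (f := fun x => (W x : ℂ)) hW.ofReal
    simp only [hψ]; fun_prop
  have hψ0 : 0 < ψ ξ := by
    have := norm_pos_iff.2 hξ; have := norm_pos_iff.2 hne
    simp only [hψ]; positivity
  have hU : {η | ψ ξ / 2 < ψ η} ∈ 𝓝 ξ := hψc.continuousAt.eventually_const_lt (by linarith)
  refine hfin.ne (lintegral_sq_eq_top_of_resonance hξ (symN_eq_zero_of_mem_resonantSet hξ₀)
    (Lp.stronglyMeasurable _).measurable (half_pos hψ0) hU ?_)
  filter_upwards [key] with η hη hηU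
  have := congrArg norm hη
  rw [norm_mul, norm_mul, norm_neg, Complex.norm_real, Complex.norm_real, Real.norm_eq_abs,
    Real.norm_of_nonneg (by positivity)] at this
  rw [this]
  exact (show ψ ξ / 2 < ψ η from hηU).le

end InertialWave

/-! ### The three velocity regimes together. -/

theorem theorem3p1 (v : E3) (b : ℝ) (hb : -(1 / 2) ≤ b) :
    (‖v‖ < 1 → ∀ (W : E3 → ℝ) (hW : Integrable W),
      TemperedDistribution.MemSobolev b 2 (ofIntegrable W hW) →
      ∃ γ : 𝓢'(E3, ℂ),
        (IsTravelingWave (ofIntegrable W hW) v γ ∧ Regular (-(3 / 2)) (-(1 / 2)) (b + 2) γ) ∧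
        (∀ γ' : 𝓢'(E3, ℂ), IsTravelingWave (ofIntegrable W hW) v γ' →
          Regular (-(3 / 2)) (-(1 / 2)) (b + 2) γ' → γ' = γ) ∧
        (FastDecaying W → Decays 3 2 γ)) ∧
    (‖v‖ = 1 → ∀ (W : E3 → ℝ) (hW : Integrable W),
      TemperedDistribution.MemSobolev b 2 (ofIntegrable W hW) →
      ∃ γ : 𝓢'(E3, ℂ),
        (IsTravelingWave (ofIntegrable W hW) v γ ∧ Regular (-(1 / 2)) (1 / 2) (b + 2) γ) ∧
        (∀ γ' : 𝓢'(E3, ℂ), IsTravelingWave (ofIntegrable W hW) v γ' →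
          Regular (-(1 / 2)) (1 / 2) (b + 2) γ' → γ' = γ) ∧
        (FastDecaying W → Decays 1 (2 / 3) γ)) ∧
    (1 < ‖v‖ → ∀ W : 𝓢(E3, ℝ), (∃ ξ ∈ resonantSet v, angularFourier W ξ ≠ 0) →
      ¬ ∃ γ : 𝓢'(E3, ℂ),
        IsTravelingWave (ofIntegrable W W.integrable) v γ ∧ FiniteEnergy γ) := by
  refine ⟨fun hv W hW hS => ?_, fun hv W hW hS => ?_, fun _ W hres => ?_⟩
  · obtain ⟨γ, hγ, hre, him⟩ := exists_travelingWave hv.le hb (smallBound_mRe_of_lt hv)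
      (by norm_num) (smallBound_mIm_of_lt hv) (by norm_num) hW hS
    exact ⟨γ, hγ, fun γ' h' hreg => eq_of_isTravelingWave hv.le hW hre him h' hreg,
      fun hd => decays_of_lt hv hW hd hre him⟩
  · obtain ⟨γ, hγ, hre, him⟩ := exists_travelingWave hv.le hb (smallBound_mRe_of_eq hv)
      (by norm_num) (smallBound_mIm_of_eq hv) (by norm_num) hW hS
    exact ⟨γ, hγ, fun γ' h' hreg => eq_of_isTravelingWave hv.le hW hre him h' hreg,
      fun hd => decays_of_eq hv hW hd hre him⟩
  · rintro ⟨γ, hγ, hE⟩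
    exact not_finiteEnergy_of_resonance W.integrable hres hγ hE
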